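/- Let $M$ be a smooth Riemannian manifold (without boundary, Hausdorff and second countable, not necessarily connected) that is complete as a metric space, with Riemannian measure $\mu$. Let $\mathcal V\to M$ be a smooth complex vector bundle of finite rank with a smooth hermitian metric $h$ and a smooth connection $\nabla$ that is compatible with $h$. Let $L^2(\mathcal V)$ be the space of square integrable sections of $\mathcal V$, modulo equality $\mu$-almost everywhere, and likewise $L^2(T^*M\otimes\mathcal V)$ and $L^2(T^*M\otimes T^*M\otimes\mathcal V)$ for the induced metrics. Let $\nabla^2u$ be the covariant derivative of $\nabla u$ for the connection on $T^*M\otimes\mathcal V$ induced by $\nabla$ and the Levi-Civita connection, and let $\operatorname{tr}\nabla^2u$ be its trace with respect to the Riemannian metric. Let $\nabla_c$ be the operator $u\mapsto\nabla u$ from $L^2(\mathcal V)$ to $L^2(T^*M\otimes\mathcal V)$ with domain $C_c^\infty(\mathcal V)$, let $\overline\nabla$ be its closure, let $\operatorname{div}=-(\nabla_c)^*$, and let $\Delta_B=-\operatorname{div}\overline\nabla$ be the Bochner Laplacian with domain $\mathcal D(\Delta_B)=\{u\in\mathcal D(\overline\nabla):\overline\nabla u\in\mathcal D(\operatorname{div})\}$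 and the graph norm $\|u\|+\|\Delta_Bu\|$. Let $W^{2,2}(\mathcal V)$ be the completion of $\{u\in C^\infty(\mathcal V): u,\nabla u,\nabla^2u\in L^2\}$, and $W^{2,2}_0(\mathcal V)$ the completion of $C_c^\infty(\mathcal V)$, for the norm $\|u\|+\|\nabla u\|+\|\nabla^2u\|$, where $\|\cdot\|$ is the $L^2$ norm. Then: 1. $W^{2,2}_0(\mathcal V)\subset\mathcal D(\Delta_B)$ continuously, that is, the identity on $C_c^\infty(\mathcal V)$ extends to an injective bounded linear map $\iota\colon W^{2,2}_0(\mathcal V)\to L^2(\mathcal V)$ whose range lies in $\mathcal D(\Delta_B)$, and there is a constant $C$ with $\|\iota w\|+\|\Delta_B\iota w\|\le C\|w\|_{W^{2,2}}$ for all $w\in W^{2,2}_0(\mathcal V)$. 2. $W^{2,2}(\mathcal V)\subset\mathcal D(\Delta_B)$ continuously, in the same sense. 3. If $u\in C^\infty(\mathcal V)\cap L^2(\mathcal V)$ and $\operatorname{tr}\nabla^2u\in L^2(\mathcal V)$, then $u\in\mathcal D(\Delta_B)$ and $\Delta_Bu=-\operatorname{tr}\nabla^2u$. -/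

import Mathlib

open Bundle Manifold MeasureTheory
open scoped ContDiff Topology ENNReal

set_option linter.unusedSectionVars false
noncomputable section

namespace Bochner

section LeviCivita

variable {E : Type*} [NormedAddCommGroup E] [NormedSpace ℝ E] [FiniteDimensional ℝ E]
  {H : Type*} [TopologicalSpace H] {I : ModelWithCorners ℝ E H}
  {M : Type*} [TopologicalSpace M] [ChartedSpace H M] [IsManifold I ∞ M]
  [RiemannianBundle (fun x : M ↦ TangentSpace I x)]
  [IsContMDiffRiemannianBundle I ∞ E (fun x : M ↦ TangentSpace I x)]

/-- The function `g(X, Y)` of two vector fields. -/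
def metricFun (X Y : Π x : M, TangentSpace I x) : M → ℝ := fun x ↦ inner ℝ (X x) (Y x)

/-- Right hand side of Koszul's formula. -/
def koszulForm (Y X Z : Π x : M, TangentSpace I x) (x : M) : ℝ :=
  (1 / 2 : ℝ) *
    ((d% (metricFun Y Z)) x (X x) + (d% (metricFun X Z)) x (Y x) - (d% (metricFun X Y)) x (Z x)
      + metricFun (VectorField.mlieBracket I X Y) Z x
      - metricFun (VectorField.mlieBracket I X Z) Y x
      - metricFun (VectorField.mlieBracket I Y Z) X x)

variable {x : M}

lemma mdiff_metricFun {X Y : Π x : M, TangentSpace I x}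
    (hX : MDiffAt (T% X) x) (hY : MDiffAt (T% Y) x) : MDiffAt (metricFun X Y) x :=
  MDifferentiableAt.inner_bundle (E := fun x : M ↦ TangentSpace I x) hX hY

lemma metricFun_comm (X Y : Π x : M, TangentSpace I x) : metricFun X Y = metricFun Y X := by
  funext y; exact real_inner_comm _ _

lemma metricFun_smul_left (f : M → ℝ) (X Y : Π x : M, TangentSpace I x) :
    metricFun (f • X) Y = f * metricFun X Y := by
  funext y; simp [metricFun, inner_smul_left]

lemma metricFun_add_left (X X' Y : Π x : M, TangentSpace I x) :
    metricFun (X + X') Y = metricFun X Y + metricFun X' Y := by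
  funext y; simp [metricFun, inner_add_left]

lemma metricFun_smul_right (f : M → ℝ) (X Y : Π x : M, TangentSpace I x) :
    metricFun X (f • Y) = f * metricFun X Y := by
  funext y; simp [metricFun, inner_smul_right]

lemma metricFun_add_right (X Y Y' : Π x : M, TangentSpace I x) :
    metricFun X (Y + Y') = metricFun X Y + metricFun X Y' := by
  funext y; simp [metricFun, inner_add_right]
open VectorField


lemma koszul_X {Y Z : Π x : M, TangentSpace I x}
    (hY : MDiffAt (T% Y) x) (hZ : MDiffAt (T% Z) x) :
    TensorialAt I E (fun X ↦ koszulForm Y X Z x) x where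
  smul {f X} hf hX := by
    simp only [koszulForm, metricFun_smul_left, metricFun_smul_right]
    rw [mvfderiv_mul hf (mdiff_metricFun hX hZ), mvfderiv_mul hf (mdiff_metricFun hX hY)]
    simp [metricFun, mlieBracket_smul_left hf hX, inner_add_left, inner_smul_left, real_inner_comm]
    ring
  add {X X'} hX hX' := by
    simp only [koszulForm, metricFun_add_left, metricFun_add_right]
    rw [mvfderiv_add (mdiff_metricFun hX hZ) (mdiff_metricFun hX' hZ),
      mvfderiv_add (mdiff_metricFun hX hY) (mdiff_metricFun hX' hY)]
    simp [metricFun, mlieBracket_add_left hX hX', inner_add_left]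
    ring

lemma koszul_Z {Y X : Π x : M, TangentSpace I x}
    (hY : MDiffAt (T% Y) x) (hX : MDiffAt (T% X) x) :
    TensorialAt I E (fun Z ↦ koszulForm Y X Z x) x where
  smul {f Z} hf hZ := by
    simp only [koszulForm, metricFun_smul_right]
    rw [mvfderiv_mul hf (mdiff_metricFun hX hZ), mvfderiv_mul hf (mdiff_metricFun hY hZ)]
    simp [metricFun, mlieBracket_smul_right hf hZ, inner_add_left, inner_smul_left,
      real_inner_comm]
    ring
  add {Z Z'} hZ hZ' := by
    simp only [koszulForm, metricFun_add_right]
    rw [mvfderiv_add (mdiff_metricFun hX hZ) (mdiff_metricFun hX hZ'),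
      mvfderiv_add (mdiff_metricFun hY hZ) (mdiff_metricFun hY hZ')]
    simp [metricFun, mlieBracket_add_right hZ hZ', inner_add_left]
    ring

/-- Koszul's formula as a bilinear form in the values of `X` and `Z` at `x`. -/
def koszulBilin (Y : Π x : M, TangentSpace I x) (x : M) (hY : MDiffAt (T% Y) x) :
    TangentSpace I x →L[ℝ] TangentSpace I x →L[ℝ] ℝ :=
  TensorialAt.mkHom₂ (fun X Z ↦ koszulForm Y X Z x) x
    (fun _ hZ ↦ koszul_X hY hZ) (fun _ hX ↦ koszul_Z hY hX)

instance (x : M) : FiniteDimensional ℝ (TangentSpace I x) :=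
  inferInstanceAs (FiniteDimensional ℝ E)

instance (x : M) : CompleteSpace (TangentSpace I x) := FiniteDimensional.complete ℝ _

open Classical in
/-- `∇ Y` at `x`, the vector `∇_v Y` being defined by Koszul's formula; the value at a point where
`Y` is not differentiable is irrelevant. -/
def leviCivitaFun (Y : Π x : M, TangentSpace I x) (x : M) :
    TangentSpace I x →L[ℝ] TangentSpace I x :=
  if hY : MDiffAt (T% Y) x then
    InnerProductSpace.continuousLinearMapOfBilin (𝕜 := ℝ) (koszulBilin Y x hY)
  else 0

lemma inner_leviCivitaFun {Y X Z : Π x : M, TangentSpace I x} (hY : MDiffAt (T% Y) x)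
    (hX : MDiffAt (T% X) x) (hZ : MDiffAt (T% Z) x) :
    inner ℝ (leviCivitaFun Y x (X x)) (Z x) = koszulForm Y X Z x := by
  rw [leviCivitaFun, dif_pos hY, InnerProductSpace.continuousLinearMapOfBilin_apply]
  exact TensorialAt.mkHom₂_apply _ _ hX hZ

lemma leviCivita_ext {v w : TangentSpace I x}
    (h : ∀ Z : Π x : M, TangentSpace I x, MDiffAt (T% Z) x →
      inner ℝ v (Z x) = inner ℝ w (Z x)) : v = w := by
  refine ext_inner_right ℝ fun z ↦ ?_
  have := h (FiberBundle.extend E z) (FiberBundle.mdifferentiableAt_extend ..)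
  simpa using this

/-- The Levi-Civita connection of a smooth Riemannian metric. -/
def leviCivita : CovariantDerivative I E (fun x : M ↦ TangentSpace I x) where
  toFun := leviCivitaFun
  isCovariantDerivativeOnUniv :=
    { add := by
        intro Y Y' x hY hY' _
        ext v : 1
        have hX : MDiffAt (T% (FiberBundle.extend E v)) x := FiberBundle.mdifferentiableAt_extend ..
        have hv : FiberBundle.extend E v x = v := by simp
        refine leviCivita_ext fun Z hZ ↦ ?_
        have h1 := inner_leviCivitaFun hY hX hZ
        have h2 := inner_leviCivitaFun hY' hX hZ
        have h3 := inner_leviCivitaFun (mdifferentiableAt_add_section hY hY') hX hZ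
        rw [hv] at h1 h2 h3
        rw [add_apply, inner_add_left, h1, h2, h3]
        simp only [koszulForm, metricFun_add_left, metricFun_add_right]
        rw [mvfderiv_add (mdiff_metricFun hY hZ) (mdiff_metricFun hY' hZ),
          mvfderiv_add (mdiff_metricFun hX hY) (mdiff_metricFun hX hY')]
        simp [metricFun, mlieBracket_add_left hY hY', mlieBracket_add_right hY hY', inner_add_left]
        ring
      leibniz := by
        intro Y f x hY hf _
        ext v : 1
        have hX : MDiffAt (T% (FiberBundle.extend E v)) x := FiberBundle.mdifferentiableAt_extend ..
        have hv : FiberBundle.extend E v x = v := by simp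
        refine leviCivita_ext fun Z hZ ↦ ?_
        have h1 := inner_leviCivitaFun hY hX hZ
        have h3 := inner_leviCivitaFun (hf.smul_section hY) hX hZ
        rw [hv] at h1 h3
        rw [add_apply, inner_add_left, smul_apply,
          inner_smul_left, h1]
        refine h3.trans ?_
        simp only [koszulForm, metricFun_smul_left, metricFun_smul_right]
        rw [mvfderiv_mul hf (mdiff_metricFun hY hZ), mvfderiv_mul hf (mdiff_metricFun hX hY)]
        simp [metricFun, mlieBracket_smul_left hf hY, mlieBracket_smul_right hf hY, inner_add_left,
          inner_smul_left, real_inner_comm]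
        ring }

lemma leviCivita_metric {X Y Z : Π x : M, TangentSpace I x}
    (hX : MDiffAt (T% X) x) (hY : MDiffAt (T% Y) x) (hZ : MDiffAt (T% Z) x) :
    d% (metricFun Y Z) x (X x) = inner ℝ (leviCivita Y x (X x)) (Z x)
      + inner ℝ (Y x) (leviCivita Z x (X x)) := by
  have h1 := inner_leviCivitaFun hY hX hZ
  have h2 := inner_leviCivitaFun hZ hX hY
  rw [real_inner_comm (leviCivita Z x (X x)) (Y x)]
  refine Eq.trans ?_ (congrArg₂ (· + ·) h1.symm h2.symm)
  simp only [koszulForm, metricFun_comm Z Y, metricFun, mlieBracket_swap_apply (V := Z) (W := Y),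
    inner_neg_left]
  ring

lemma leviCivita_torsion {X Y : Π x : M, TangentSpace I x}
    (hX : MDiffAt (T% X) x) (hY : MDiffAt (T% Y) x) :
    leviCivita Y x (X x) - leviCivita X x (Y x) = mlieBracket I X Y x := by
  refine leviCivita_ext fun Z hZ ↦ ?_
  have h1 := inner_leviCivitaFun hY hX hZ
  have h2 := inner_leviCivitaFun hX hY hZ
  rw [inner_sub_left]
  refine (congrArg₂ (· - ·) h1 h2).trans ?_
  simp only [koszulForm, metricFun_comm Y X, metricFun, mlieBracket_swap_apply (V := Y) (W := X),
    inner_neg_left]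
  ring

end LeviCivita

section Hom

variable {E : Type*} [NormedAddCommGroup E] [NormedSpace ℝ E] [FiniteDimensional ℝ E]
  {H : Type*} [TopologicalSpace H] {I : ModelWithCorners ℝ E H}
  {M : Type*} [TopologicalSpace M] [ChartedSpace H M] [IsManifold I ∞ M]
  [RiemannianBundle (fun x : M ↦ TangentSpace I x)]
  [IsContMDiffRiemannianBundle I ∞ E (fun x : M ↦ TangentSpace I x)]
  {F : Type*} [NormedAddCommGroup F] [NormedSpace ℝ F]
  {V : M → Type*} [TopologicalSpace (TotalSpace F V)] [∀ x, NormedAddCommGroup (V x)]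
  [∀ x, NormedSpace ℝ (V x)] [FiberBundle F V] [VectorBundle ℝ F V]

lemma homDeriv_tensorial (cov : CovariantDerivative I F V)
    (A : Π x : M, TangentSpace I x →L[ℝ] V x) (x : M)
    (hA : MDifferentiableAt I (I.prod 𝓘(ℝ, E →L[ℝ] F))
      (fun y ↦ TotalSpace.mk' (E →L[ℝ] F) y (A y)) x) :
    TensorialAt I E (fun W : Π x : M, TangentSpace I x ↦
      (cov (fun y ↦ A y (W y)) x - (A x) ∘L (leviCivita W x) : TangentSpace I x →L[ℝ] V x)) x where
  smul {f W} hf hW := by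
    have hAW : MDiffAt (T% (fun y ↦ A y (W y))) x :=
      MDifferentiableAt.clm_bundle_apply (F₁ := E) (F₂ := F) hA hW
    have h1 : (fun y ↦ A y ((f • W) y)) = f • (fun y ↦ A y (W y)) := by
      funext y; simp
    have h2 := cov.isCovariantDerivativeOnUniv.leibniz hAW hf
    have h3 := (leviCivita (I := I) (M := M)).isCovariantDerivativeOnUniv.leibniz hW hf
    rw [h1, h2, h3]
    ext v
    simp
    module
  add {W W'} hW hW' := by
    have hAW : MDiffAt (T% (fun y ↦ A y (W y))) x :=
      MDifferentiableAt.clm_bundle_apply (F₁ := E) (F₂ := F) hA hW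
    have hAW' : MDiffAt (T% (fun y ↦ A y (W' y))) x :=
      MDifferentiableAt.clm_bundle_apply (F₁ := E) (F₂ := F) hA hW'
    have h1 : (fun y ↦ A y ((W + W') y)) = (fun y ↦ A y (W y)) + (fun y ↦ A y (W' y)) := by
      funext y; simp
    have h2 := cov.isCovariantDerivativeOnUniv.add hAW hAW'
    have h3 := (leviCivita (I := I) (M := M)).isCovariantDerivativeOnUniv.add hW hW'
    rw [h1, h2, h3]
    ext v
    simp
    abel

open Classical in
/-- The connection induced on `T*M ⊗ V = Hom(TM, V)` by the Levi-Civita connection and `cov`: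
`homDeriv cov A x v w = (∇_v A)(w)`, where `(∇_v A)(W) = ∇_v (A W) - A (∇_v W)`. -/
def homDeriv (cov : CovariantDerivative I F V) (A : Π x : M, TangentSpace I x →L[ℝ] V x) (x : M) :
    TangentSpace I x →L[ℝ] TangentSpace I x →L[ℝ] V x :=
  if hA : MDifferentiableAt I (I.prod 𝓘(ℝ, E →L[ℝ] F))
      (fun y ↦ TotalSpace.mk' (E →L[ℝ] F) y (A y)) x then
    (TensorialAt.mkHom _ x (homDeriv_tensorial cov A x hA)).flip
  else 0

end Hom
section Volume

variable {n : ℕ} {M : Type*} [TopologicalSpace M] [ChartedSpace (EuclideanSpace ℝ (Fin n)) M]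
  [IsManifold (𝓡 n) ∞ M]

/-- The coordinate vector fields `∂₁, …, ∂ₙ` of the chart at `p`, on the domain of that chart
(and zero elsewhere). -/
def coordFrame (p : M) (i : Fin n) : Π x : M, TangentSpace (𝓡 n) x :=
  (trivializationAt (EuclideanSpace ℝ (Fin n)) (fun x : M ↦ TangentSpace (𝓡 n) x) p).localFrame
    (EuclideanSpace.basisFun (Fin n) ℝ).toBasis i

variable [RiemannianBundle (fun x : M ↦ TangentSpace (𝓡 n) x)]

/-- The matrix `g_{ij} = g(∂ᵢ, ∂ⱼ)` of the metric in the chart at `p`. -/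
def gramMatrix (p x : M) : Matrix (Fin n) (Fin n) ℝ :=
  Matrix.of fun i j ↦ inner ℝ (coordFrame p i x) (coordFrame p j x)

/-- The measure `√(det g_{ij}) dx¹ ⋯ dxⁿ` on the domain of the chart at `p`, extended by zero. -/
def chartVolume [MeasurableSpace M] (p : M) : Measure M :=
  (Measure.map (chartAt (EuclideanSpace ℝ (Fin n)) p).symm
    (volume.restrict (chartAt (EuclideanSpace ℝ (Fin n)) p).target)).withDensity
      fun x ↦ ENNReal.ofReal (Real.sqrt (gramMatrix (n := n) p x).det)

variable (n M) in
/-- The Riemannian volume measure. The measures `chartVolume p` agree on the intersections of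
chart domains; their supremum is the measure on `M` which restricts to `chartVolume p` on the
domain of the chart at `p`, for every `p`. -/
def riemannianVolume [MeasurableSpace M] : Measure M := ⨆ p : M, chartVolume (n := n) p

end Volume

section L2

/-- A hermitian inner product on each fibre of a family `W` of complex vector spaces over `M`,
together with the notion of measurable section (up to null sets of a given measure), such that the
inner product of two measurable sections is a measurable function. -/
structure FibreMetric {M : Type*} [MeasurableSpace M] (W : M → Type*)
    [∀ x, AddCommGroup (W x)] [∀ x, Module ℂ (W x)] where
  core : ∀ x, InnerProductSpace.Core ℂ (W x)
  measurableSections : Measure M → Submodule ℂ (Π x, W x)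
  aestronglyMeasurable_inner : ∀ (ν : Measure M) (s t : Π x, W x),
    s ∈ measurableSections ν → t ∈ measurableSections ν →
      AEStronglyMeasurable (fun x ↦ (core x).inner (s x) (t x)) ν

namespace FibreMetric

variable {M : Type*} [MeasurableSpace M] {W : M → Type*}
  [∀ x, AddCommGroup (W x)] [∀ x, Module ℂ (W x)] (m : FibreMetric W) (μ : Measure M)

/-- `|s(x)|²` -/
def normSq (s : Π x, W x) (x : M) : ℝ := ((m.core x).inner (s x) (s x)).re

lemma inner_integrable {s t : Π x, W x} (hs : s ∈ m.measurableSections μ)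
    (hs2 : Integrable (m.normSq s) μ)
    (ht : t ∈ m.measurableSections μ) (ht2 : Integrable (m.normSq t) μ) :
    Integrable (fun x ↦ (m.core x).inner (s x) (t x)) μ := by
  refine (hs2.add ht2).mono' (m.aestronglyMeasurable_inner μ s t hs ht) (.of_forall fun x ↦ ?_)
  let _ := m.core x
  let _ := (m.core x).toNormedAddCommGroup
  let _ : InnerProductSpace ℂ (W x) := InnerProductSpace.ofCore (m.core x).toCore
  have h1 : ‖(inner ℂ (s x) (t x) : ℂ)‖ ≤ ‖s x‖ * ‖t x‖ := norm_inner_le_norm _ _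
  have h2 : ((inner ℂ (s x) (s x) : ℂ)).re = ‖s x‖ ^ 2 := inner_self_eq_norm_sq (𝕜 := ℂ) (s x)
  have h3 : ((inner ℂ (t x) (t x) : ℂ)).re = ‖t x‖ ^ 2 := inner_self_eq_norm_sq (𝕜 := ℂ) (t x)
  change ‖(inner ℂ (s x) (t x) : ℂ)‖ ≤ (inner ℂ (s x) (s x) : ℂ).re + (inner ℂ (t x) (t x) : ℂ).re
  rw [h2, h3]
  nlinarith [sq_nonneg (‖s x‖ - ‖t x‖), sq_nonneg (‖s x‖), sq_nonneg (‖t x‖)]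

/-- The measurable sections `s` with `∫ |s|² dμ < ∞`. -/
def squareIntegrable : Submodule ℂ (Π x, W x) where
  carrier := {s | s ∈ m.measurableSections μ ∧ Integrable (m.normSq s) μ}
  zero_mem' := by
    refine ⟨zero_mem _, ?_⟩
    have : m.normSq (0 : Π x, W x) = fun _ ↦ 0 := by
      funext x
      let _ := (m.core x).toCore
      have : (m.core x).inner (0 : W x) (0 : W x) = 0 := InnerProductSpace.Core.inner_zero_left _
      simp [normSq, this]
    rw [this]
    exact integrable_zero _ _ _
  add_mem' {s t} hs ht := by
    refine ⟨add_mem hs.1 ht.1, ?_⟩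
    have h1 := m.inner_integrable μ hs.1 hs.2 ht.1 ht.2
    have h2 := m.inner_integrable μ ht.1 ht.2 hs.1 hs.2
    have : m.normSq (s + t) = fun x ↦ (m.normSq s x + ((m.core x).inner (s x) (t x)).re)
        + (((m.core x).inner (t x) (s x)).re + m.normSq t x) := by
      funext x
      let _ := (m.core x).toCore
      have h3 : (m.core x).inner (s x + t x) (s x + t x) = _ :=
        (m.core x).add_left (s x) (t x) (s x + t x)
      have h4 : (m.core x).inner (s x) (s x + t x) = _ :=
        InnerProductSpace.Core.inner_add_right (s x) (s x) (t x)
      have h5 : (m.core x).inner (t x) (s x + t x) = _ :=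
        InnerProductSpace.Core.inner_add_right (t x) (s x) (t x)
      simp only [normSq, Pi.add_apply, h3, h4, h5, Complex.add_re]
    rw [this]
    exact (hs.2.add h1.re).add (h2.re.add ht.2)
  smul_mem' c s hs := by
    refine ⟨Submodule.smul_mem _ c hs.1, ?_⟩
    have : m.normSq (c • s) = fun x ↦ ‖c‖ ^ 2 * m.normSq s x := by
      funext x
      let _ := (m.core x).toCore
      have h3 : (m.core x).inner (c • s x) (c • s x) = _ :=
        (m.core x).smul_left (s x) (c • s x) c
      have h4 : (m.core x).inner (s x) (c • s x) = _ :=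
        InnerProductSpace.Core.inner_smul_right (s x) (s x) (r := c)
      simp only [normSq, Pi.smul_apply, h3, h4]
      rw [← mul_assoc, Complex.conj_mul', ← Complex.ofReal_pow, Complex.re_ofReal_mul]
    rw [this]
    exact hs.2.const_mul _

/-- Square integrable sections, as a type carrying the `L²` seminorm. -/
def PreL2 : Type _ := m.squareIntegrable μ

instance : AddCommGroup (m.PreL2 μ) := inferInstanceAs (AddCommGroup (m.squareIntegrable μ))
instance : Module ℂ (m.PreL2 μ) := inferInstanceAs (Module ℂ (m.squareIntegrable μ))

/-- The inner product `∫ h(s(x), t(x)) dμ(x)`. -/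
@[reducible] def preL2Core : PreInnerProductSpace.Core ℂ (m.PreL2 μ) where
  inner s t := ∫ x, (m.core x).inner (s.1 x) (t.1 x) ∂μ
  conj_inner_symm s t := by
    rw [← integral_conj]
    exact integral_congr_ae (.of_forall fun x ↦ (m.core x).conj_inner_symm _ _)
  re_inner_nonneg s := by
    have h : RCLike.re (∫ x, (m.core x).inner (s.1 x) (s.1 x) ∂μ)
        = ∫ x, RCLike.re ((m.core x).inner (s.1 x) (s.1 x)) ∂μ :=
      (integral_re (m.inner_integrable μ s.2.1 s.2.2 s.2.1 s.2.2)).symm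
    rw [h]
    exact integral_nonneg fun x ↦ (m.core x).re_inner_nonneg _
  add_left s s' t := by
    rw [← integral_add (m.inner_integrable μ s.2.1 s.2.2 t.2.1 t.2.2)
      (m.inner_integrable μ s'.2.1 s'.2.2 t.2.1 t.2.2)]
    exact integral_congr_ae (.of_forall fun x ↦ (m.core x).add_left _ _ _)
  smul_left s t c := by
    rw [← integral_const_mul]
    exact integral_congr_ae (.of_forall fun x ↦ (m.core x).smul_left _ _ _)

instance : SeminormedAddCommGroup (m.PreL2 μ) :=
  @InnerProductSpace.Core.toSeminormedAddCommGroup ℂ _ _ _ _ (m.preL2Core μ)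

instance : InnerProductSpace ℂ (m.PreL2 μ) := InnerProductSpace.ofCore (m.preL2Core μ)

/-- The space `L²` of square integrable sections modulo equality almost everywhere. -/
def L2 : Type _ := SeparationQuotient (m.PreL2 μ)

instance : NormedAddCommGroup (m.L2 μ) :=
  inferInstanceAs (NormedAddCommGroup (SeparationQuotient (m.PreL2 μ)))

instance : InnerProductSpace ℂ (m.L2 μ) :=
  inferInstanceAs (InnerProductSpace ℂ (SeparationQuotient (m.PreL2 μ)))

/-- The class in `L²` of a square integrable section. -/
def toL2 : m.squareIntegrable μ →ₗ[ℂ] m.L2 μ :=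
  (SeparationQuotient.mkCLM ℂ (m.PreL2 μ)).toLinearMap

lemma inner_toL2 (s t : m.squareIntegrable μ) :
    inner ℂ (m.toL2 μ s) (m.toL2 μ t) = ∫ x, (m.core x).inner (s.1 x) (t.1 x) ∂μ := rfl

end FibreMetric
end L2

section BundleMetric

variable {n : ℕ} {M : Type*} [TopologicalSpace M] [ChartedSpace (EuclideanSpace ℝ (Fin n)) M]
  [IsManifold (𝓡 n) ∞ M] [SecondCountableTopology M] [MeasurableSpace M] [BorelSpace M]

lemma aestronglyMeasurable_of_local {β : Type*} [TopologicalSpace β]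
    [TopologicalSpace.PseudoMetrizableSpace β] {f : M → β} {ν : Measure M} (U : M → Set M)
    (hU : ∀ x, U x ∈ 𝓝 x) (hf : ∀ x, AEStronglyMeasurable f (ν.restrict (U x))) :
    AEStronglyMeasurable f ν := by
  obtain ⟨s, hs, hsU⟩ := TopologicalSpace.countable_cover_nhds hU
  have := hs.to_subtype
  rw [← Measure.restrict_univ (μ := ν), ← hsU, Set.biUnion_eq_iUnion,
    aestronglyMeasurable_iUnion_iff]
  exact fun i ↦ hf i

section Base

variable {F : Type*} [NormedAddCommGroup F] [NormedSpace ℂ F] [FiniteDimensional ℂ F]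
  {V : M → Type*} [TopologicalSpace (TotalSpace F V)] [∀ x, NormedAddCommGroup (V x)]
  [∀ x, InnerProductSpace ℂ (V x)] [FiberBundle F V] [VectorBundle ℂ F V] [VectorBundle ℝ F V]

variable (n F V) in
/-- The hermitian inner products on the fibres of the complex vector bundle `V` depend smoothly on
the base point. -/
class IsSmoothHermitianBundle : Prop where
  exists_contMDiff : ∃ h : Π x : M, V x →L[ℝ] V x →L[ℝ] ℂ,
    ContMDiff (𝓡 n) ((𝓡 n).prod 𝓘(ℝ, F →L[ℝ] F →L[ℝ] ℂ)) ∞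
      (fun x ↦ TotalSpace.mk' (F →L[ℝ] F →L[ℝ] ℂ) x (h x))
    ∧ ∀ (x : M) (v w : V x), inner ℂ v w = h x v w

variable [ContMDiffVectorBundle ∞ F V (𝓡 n)] [IsSmoothHermitianBundle n F V]

variable (n F V) in
/-- The metric of `V`; a section is measurable if it is so in the local trivializations. -/
def bundleMetric : FibreMetric V where
  core x := InnerProductSpace.toCore
  measurableSections ν :=
    { carrier := {s | ∀ p : M, AEStronglyMeasurable
        (fun x ↦ (trivializationAt F V p ⟨x, s x⟩).2) (ν.restrict (trivializationAt F V p).baseSet)}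
      zero_mem' := by
        intro p
        refine (aestronglyMeasurable_const (b := (0 : F))).congr ?_
        filter_upwards [ae_restrict_mem (trivializationAt F V p).open_baseSet.measurableSet]
          with x hx
        exact (((trivializationAt F V p).linear ℂ hx).map_zero).symm
      add_mem' := by
        intro s t hs ht p
        refine ((hs p).add (ht p)).congr ?_
        filter_upwards [ae_restrict_mem (trivializationAt F V p).open_baseSet.measurableSet]
          with x hx
        exact (((trivializationAt F V p).linear ℂ hx).map_add _ _).symm
      smul_mem' := by
        intro c s hs p
        refine ((hs p).const_smul c).congr ?_
        filter_upwards [ae_restrict_mem (trivializationAt F V p).open_baseSet.measurableSet]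
          with x hx
        exact (((trivializationAt F V p).linear ℂ hx).map_smul _ _).symm }
  aestronglyMeasurable_inner ν s t hs ht := by
    obtain ⟨h, hh, hinner⟩ := IsSmoothHermitianBundle.exists_contMDiff (n := n) (F := F) (V := V)
    refine aestronglyMeasurable_of_local (fun p ↦ (trivializationAt F V p).baseSet)
      (fun p ↦ (trivializationAt F V p).open_baseSet.mem_nhds
        (FiberBundle.mem_baseSet_trivializationAt F V p)) fun p ↦ ?_
    let e := trivializationAt F V p
    let b := Module.finBasis ℝ F
    have hmeas : MeasurableSet e.baseSet := e.open_baseSet.measurableSet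
    have hc : ∀ u : Π x, V x, AEStronglyMeasurable (fun x ↦ (e ⟨x, u x⟩).2)
        (ν.restrict e.baseSet) → ∀ i, AEStronglyMeasurable
        (fun x ↦ b.repr (e ⟨x, u x⟩).2 i) (ν.restrict e.baseSet) := by
      intro u hu i
      exact (LinearMap.continuous_of_finiteDimensional (b.coord i)).comp_aestronglyMeasurable hu
    have hG : ∀ i j, AEStronglyMeasurable
        (fun x ↦ h x (e.localFrame b i x) (e.localFrame b j x)) (ν.restrict e.baseSet) := by
      intro i j
      refine ContinuousOn.aestronglyMeasurable ?_ hmeas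
      have h1 := Bundle.Trivialization.contMDiffOn_localFrame_baseSet (I := 𝓡 n) ∞ e b i
      have h2 := Bundle.Trivialization.contMDiffOn_localFrame_baseSet (I := 𝓡 n) ∞ e b j
      have h3 := ContMDiffOn.clm_bundle_apply₂ (F₁ := F) (F₂ := F) (F₃ := ℂ)
        (E₃ := Bundle.Trivial M ℂ) hh.contMDiffOn h1 h2
      intro x hx
      have h4 := h3 x hx
      rw [Bundle.contMDiffWithinAt_section] at h4
      exact h4.continuousWithinAt
    have hsum : AEStronglyMeasurable (fun x ↦ ∑ i, ∑ j,
        (b.repr (e ⟨x, s x⟩).2 i) • (b.repr (e ⟨x, t x⟩).2 j) •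
          h x (e.localFrame b i x) (e.localFrame b j x)) (ν.restrict e.baseSet) := by
      refine Finset.aestronglyMeasurable_fun_sum _ fun i _ ↦
        Finset.aestronglyMeasurable_fun_sum _ fun j _ ↦ ?_
      exact (hc s (hs p) i).smul ((hc t (ht p) j).smul (hG i j))
    refine hsum.congr ?_
    filter_upwards [ae_restrict_mem hmeas] with x hx
    have hexp : ∀ v : V x, v = ∑ i, b.repr (e ⟨x, v⟩).2 i • e.localFrame b i x := by
      intro v
      conv_lhs => rw [← (e.basisAt b hx).sum_repr v]
      refine Finset.sum_congr rfl fun i _ ↦ ?_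
      rw [e.localFrame_apply_of_mem_baseSet b hx]
      simp [Bundle.Trivialization.basisAt, Bundle.Trivialization.linearEquivAt_apply]
    change _ = inner ℂ (s x) (t x)
    rw [hinner]
    conv_rhs => rw [hexp (s x), hexp (t x)]
    simp only [map_sum, map_smul, FunLike.coe_sum, Finset.sum_apply,
      FunLike.coe_smul, Pi.smul_apply, Finset.smul_sum]
    rw [Finset.sum_comm]
    exact Finset.sum_congr rfl fun i _ ↦ Finset.sum_congr rfl fun j _ ↦ smul_comm _ _ _

end Base

section HomMetric

lemma sum_orthonormal_eq_gram {T : Type*} [NormedAddCommGroup T] [InnerProductSpace ℝ T]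
    {ι κ : Type*} [Fintype ι] [Fintype κ] [DecidableEq ι] [DecidableEq κ]
    (e : OrthonormalBasis ι ℝ T) (b : Module.Basis κ ℝ T) (K : T →ₗ[ℝ] T →ₗ[ℝ] ℂ) :
    ∑ i, K (e i) (e i)
      = ∑ j, ∑ k, ((Matrix.of fun j k ↦ (inner ℝ (b j) (b k) : ℝ))⁻¹ j k) • K (b j) (b k) := by
  set Q := b.toMatrix e with hQ
  set P := e.toBasis.toMatrix b with hP
  have hQP : Q * P = 1 := by
    have := b.toMatrix_mul_toMatrix_flip e.toBasis
    simpa using this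
  have hPQ : P * Q = 1 := by
    have := e.toBasis.toMatrix_mul_toMatrix_flip b
    simpa only [OrthonormalBasis.coe_toBasis] using this
  have hG : (Matrix.of fun j k ↦ (inner ℝ (b j) (b k) : ℝ)) = P.transpose * P := by
    ext j k
    rw [Matrix.mul_apply, Matrix.of_apply, ← e.sum_inner_mul_inner]
    refine Finset.sum_congr rfl fun i _ ↦ ?_
    simp [hP, Module.Basis.toMatrix_apply, e.repr_apply_apply, real_inner_comm]
  have hinv : (Matrix.of fun j k ↦ (inner ℝ (b j) (b k) : ℝ))⁻¹ = Q * Q.transpose := by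
    apply Matrix.inv_eq_left_inv
    rw [hG, Matrix.mul_assoc, ← Matrix.mul_assoc Q.transpose, ← Matrix.transpose_mul, hPQ,
      Matrix.transpose_one, Matrix.one_mul, hQP]
  rw [hinv]
  have he : ∀ i, e i = ∑ j, Q j i • b j := fun i ↦ (b.sum_repr (e i)).symm
  have h1 : ∀ i, K (e i) (e i) = ∑ j, ∑ k, (Q j i * Q k i) • K (b j) (b k) := by
    intro i
    conv_lhs => rw [he i]
    simp only [map_sum, map_smul, LinearMap.coe_sum, Finset.sum_apply, LinearMap.smul_apply,
      Finset.smul_sum, smul_smul]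
    rw [Finset.sum_comm]
    exact Finset.sum_congr rfl fun i _ ↦ Finset.sum_congr rfl fun j _ ↦ by rw [mul_comm]
  simp_rw [h1]
  rw [Finset.sum_comm]
  refine Finset.sum_congr rfl fun j _ ↦ ?_
  rw [Finset.sum_comm]
  refine Finset.sum_congr rfl fun k _ ↦ ?_
  rw [← Finset.sum_smul, Matrix.mul_apply]
  rfl

variable [RiemannianBundle (fun x : M ↦ TangentSpace (𝓡 n) x)]
  [IsContMDiffRiemannianBundle (𝓡 n) ∞ (EuclideanSpace ℝ (Fin n))
    (fun x : M ↦ TangentSpace (𝓡 n) x)]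
  {W : M → Type*} [∀ x, AddCommGroup (W x)] [∀ x, Module ℂ (W x)] [∀ x, Module ℝ (W x)]
  [∀ x, IsScalarTower ℝ ℂ (W x)] [∀ x, SMulCommClass ℝ ℂ (W x)]
  [∀ x, TopologicalSpace (W x)] [∀ x, IsTopologicalAddGroup (W x)]
  [∀ x, ContinuousConstSMul ℂ (W x)]

variable (n) in
/-- The Hilbert-Schmidt inner product `⟨A, B⟩ = ∑ᵢ h(A eᵢ, B eᵢ)` on `T*ₓM ⊗ Wₓ = Hom(TₓM, Wₓ)`,
for an orthonormal basis `(eᵢ)` of `TₓM`. -/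
@[reducible] def homCore (x : M) (c : InnerProductSpace.Core ℂ (W x)) :
    InnerProductSpace.Core ℂ (TangentSpace (𝓡 n) x →L[ℝ] W x) where
  inner A B := ∑ i, c.inner (A (stdOrthonormalBasis ℝ (TangentSpace (𝓡 n) x) i))
    (B (stdOrthonormalBasis ℝ (TangentSpace (𝓡 n) x) i))
  conj_inner_symm A B := by
    rw [map_sum]
    exact Finset.sum_congr rfl fun i _ ↦ c.conj_inner_symm _ _
  re_inner_nonneg A := by
    rw [map_sum]
    exact Finset.sum_nonneg fun i _ ↦ c.re_inner_nonneg _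
  add_left A A' B := by
    rw [← Finset.sum_add_distrib]
    exact Finset.sum_congr rfl fun i _ ↦ c.add_left _ _ _
  smul_left A B r := by
    rw [Finset.mul_sum]
    exact Finset.sum_congr rfl fun i _ ↦ c.smul_left _ _ _
  definite A hA := by
    let _ := c
    have h0 : ∑ i, RCLike.re (c.inner (A (stdOrthonormalBasis ℝ (TangentSpace (𝓡 n) x) i))
        (A (stdOrthonormalBasis ℝ (TangentSpace (𝓡 n) x) i))) = 0 := by
      rw [← map_sum, hA, map_zero]
    rw [Finset.sum_eq_zero_iff_of_nonneg fun i _ ↦ c.re_inner_nonneg _] at h0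
    have h1 : ∀ i, A (stdOrthonormalBasis ℝ (TangentSpace (𝓡 n) x) i) = 0 := by
      intro i
      refine c.definite _ (Complex.ext (h0 i (Finset.mem_univ i)) ?_)
      exact InnerProductSpace.Core.inner_self_im (𝕜 := ℂ)
        (A (stdOrthonormalBasis ℝ (TangentSpace (𝓡 n) x) i))
    apply ContinuousLinearMap.coe_injective
    exact (stdOrthonormalBasis ℝ (TangentSpace (𝓡 n) x)).toBasis.ext fun i ↦ by simp [h1]

variable (n) in
/-- The metric induced on `T*M ⊗ W = Hom(TM, W)`; a section is measurable if its components in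
local coordinates are measurable sections of `W`. -/
def homMetric (m : FibreMetric W) :
    FibreMetric (fun x : M ↦ TangentSpace (𝓡 n) x →L[ℝ] W x) where
  core x := homCore n x (m.core x)
  measurableSections ν :=
    { carrier := {A | ∀ (p : M) (i : Fin n), (fun x ↦ A x (coordFrame p i x)) ∈
        m.measurableSections (ν.restrict (chartAt (EuclideanSpace ℝ (Fin n)) p).source)}
      zero_mem' := fun p i ↦ zero_mem _
      add_mem' := fun hA hB p i ↦ add_mem (hA p i) (hB p i)
      smul_mem' := fun c _ hA p i ↦ Submodule.smul_mem _ c (hA p i) }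
  aestronglyMeasurable_inner ν A B hA hB := by
    refine aestronglyMeasurable_of_local
      (fun p ↦ (chartAt (EuclideanSpace ℝ (Fin n)) p).source)
      (fun p ↦ chart_source_mem_nhds _ p) fun p ↦ ?_
    let U := (chartAt (EuclideanSpace ℝ (Fin n)) p).source
    have hU : MeasurableSet U := (chartAt (EuclideanSpace ℝ (Fin n)) p).open_source.measurableSet
    have hG : ∀ i j, AEMeasurable (fun x ↦ gramMatrix (n := n) p x i j) (ν.restrict U) := by
      intro i j
      refine ContinuousOn.aemeasurable ?_ hU
      have h1 := Bundle.Trivialization.contMDiffOn_localFrame_baseSet (I := 𝓡 n) ∞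
        (trivializationAt (EuclideanSpace ℝ (Fin n)) (fun x : M ↦ TangentSpace (𝓡 n) x) p)
        (EuclideanSpace.basisFun (Fin n) ℝ).toBasis
      exact (ContMDiffOn.inner_bundle (n := ∞) (E := fun x : M ↦ TangentSpace (𝓡 n) x)
        (h1 i) (h1 j)).continuousOn
    have hGm : AEMeasurable (fun x i j ↦ gramMatrix (n := n) p x i j) (ν.restrict U) :=
      aemeasurable_pi_lambda _ fun i ↦ aemeasurable_pi_lambda _ fun j ↦ hG i j
    have hinv : ∀ i j, AEMeasurable (fun x ↦ (gramMatrix (n := n) p x)⁻¹ i j) (ν.restrict U) := by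
      intro i j
      have : Measurable (fun A : Fin n → Fin n → ℝ ↦ (Matrix.of A)⁻¹ i j) := by
        have h : (fun A : Fin n → Fin n → ℝ ↦ (Matrix.of A)⁻¹ i j)
            = fun A ↦ ((Matrix.of A).det)⁻¹ * (Matrix.of A).adjugate i j := by
          funext A
          simp [Matrix.inv_def]
        rw [h]
        have h0 : Continuous (fun A : Fin n → Fin n → ℝ ↦ Matrix.of A) := continuous_id
        have h1 : Continuous (fun A : Fin n → Fin n → ℝ ↦ (Matrix.of A).det) := h0.matrix_det
        have h2 : Continuous (fun A : Fin n → Fin n → ℝ ↦ (Matrix.of A).adjugate i j) :=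
          h0.matrix_adjugate.matrix_elem i j
        exact h1.measurable.inv.mul h2.measurable
      exact this.comp_aemeasurable hGm
    have hsum : AEStronglyMeasurable (fun x ↦ ∑ i, ∑ j, ((gramMatrix (n := n) p x)⁻¹ i j) •
        (m.core x).inner (A x (coordFrame p i x)) (B x (coordFrame p j x))) (ν.restrict U) := by
      refine Finset.aestronglyMeasurable_fun_sum _ fun i _ ↦
        Finset.aestronglyMeasurable_fun_sum _ fun j _ ↦ ?_
      exact (hinv i j).aestronglyMeasurable.smul
        (m.aestronglyMeasurable_inner _ _ _ (hA p i) (hB p j))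
    refine hsum.congr ?_
    filter_upwards [ae_restrict_mem hU] with x hx
    let _ := m.core x
    have hr : ∀ (r : ℝ) (w : W x), r • w = (r : ℂ) • w := fun r w ↦
      (algebraMap_smul ℂ r w).symm
    let K : TangentSpace (𝓡 n) x →ₗ[ℝ] TangentSpace (𝓡 n) x →ₗ[ℝ] ℂ :=
      LinearMap.mk₂ ℝ (fun v w ↦ (m.core x).inner (A x v) (B x w))
        (fun v v' w ↦ by rw [map_add]; exact (m.core x).add_left _ _ _)
        (fun r v w ↦ by
          rw [map_smul, hr]
          refine ((m.core x).smul_left _ _ _).trans ?_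
          simp)
        (fun v w w' ↦ by
          rw [map_add]
          exact InnerProductSpace.Core.inner_add_right (𝕜 := ℂ) _ _ _)
        (fun r v w ↦ by
          rw [map_smul, hr]
          refine (InnerProductSpace.Core.inner_smul_right (𝕜 := ℂ) _ _).trans ?_
          simp)
    have hb : ∀ i, coordFrame p i x = ((trivializationAt (EuclideanSpace ℝ (Fin n))
        (fun x : M ↦ TangentSpace (𝓡 n) x) p).basisAt
          (EuclideanSpace.basisFun (Fin n) ℝ).toBasis hx) i := fun i ↦
      Bundle.Trivialization.localFrame_apply_of_mem_baseSet _ _ hx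
    have key := sum_orthonormal_eq_gram (stdOrthonormalBasis ℝ (TangentSpace (𝓡 n) x))
      ((trivializationAt (EuclideanSpace ℝ (Fin n))
        (fun x : M ↦ TangentSpace (𝓡 n) x) p).basisAt
          (EuclideanSpace.basisFun (Fin n) ℝ).toBasis hx) K
    simp_rw [← hb] at key
    exact key.symm

end HomMetric

end BundleMetric


section Operators

variable {n : ℕ} {M : Type*} [TopologicalSpace M] [ChartedSpace (EuclideanSpace ℝ (Fin n)) M]
  [IsManifold (𝓡 n) ∞ M] [SecondCountableTopology M] [MeasurableSpace M] [BorelSpace M]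
  [RiemannianBundle (fun x : M ↦ TangentSpace (𝓡 n) x)]
  [IsContMDiffRiemannianBundle (𝓡 n) ∞ (EuclideanSpace ℝ (Fin n))
    (fun x : M ↦ TangentSpace (𝓡 n) x)]
  {F : Type*} [NormedAddCommGroup F] [NormedSpace ℂ F] [FiniteDimensional ℂ F]
  {V : M → Type*} [TopologicalSpace (TotalSpace F V)] [∀ x, NormedAddCommGroup (V x)]
  [∀ x, InnerProductSpace ℂ (V x)] [FiberBundle F V] [VectorBundle ℂ F V] [VectorBundle ℝ F V]
  [ContMDiffVectorBundle ∞ F V (𝓡 n)] [IsSmoothHermitianBundle n F V]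

variable (n F) in
/-- The section `σ` is differentiable at `x`. -/
abbrev SectionMDiffAt (σ : Π x : M, V x) (x : M) : Prop :=
  MDifferentiableAt (𝓡 n) ((𝓡 n).prod 𝓘(ℝ, F)) (fun y ↦ TotalSpace.mk' F y (σ y)) x

variable (n F V) in
/-- A smooth connection on the complex bundle `V` that is compatible with the hermitian metric.
(`∇_v σ` at `x` is written `toFun σ x v`.) -/
structure HermitianConnection extends CovariantDerivative (𝓡 n) F V where
  contMDiff : CovariantDerivative.ContMDiffCovariantDerivative toCovariantDerivative ∞
  complex_leibniz : ∀ {σ : Π x : M, V x} {f : M → ℂ} {x : M}, SectionMDiffAt n F σ x → MDifferentiableAt (𝓡 n) 𝓘(ℝ, ℂ) f x →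
    ∀ v : TangentSpace (𝓡 n) x,
      toFun (fun y ↦ f y • σ y) x v = f x • toFun σ x v + (mvfderiv (𝓡 n) f x v) • σ x
  compatible : ∀ {σ τ : Π x : M, V x} {x : M}, SectionMDiffAt n F σ x → SectionMDiffAt n F τ x →
    ∀ v : TangentSpace (𝓡 n) x,
      mvfderiv (𝓡 n) (fun y ↦ (inner ℂ (σ y) (τ y) : ℂ)) x v
        = inner ℂ (toFun σ x v) (τ x) + inner ℂ (σ x) (toFun τ x v)

namespace HermitianConnection

variable (n F V) in
/-- The space `C^∞(V)` of smooth sections. -/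
def smoothSections : Submodule ℂ (Π x : M, V x) where
  carrier := {u | ContMDiff (𝓡 n) ((𝓡 n).prod 𝓘(ℝ, F)) ∞ (fun x ↦ TotalSpace.mk' F x (u x))}
  zero_mem' := contMDiff_zeroSection ℝ V
  add_mem' hu hv := hu.add_section hv
  smul_mem' c u hu := by
    intro x
    have h := hu x
    rw [Bundle.contMDiffAt_section] at h ⊢
    have h2 : ContMDiffAt (𝓡 n) 𝓘(ℝ, F) ∞
        (fun y ↦ (ContinuousLinearMap.lsmul ℝ ℂ c : F →L[ℝ] F)
          (trivializationAt F V x ⟨y, u y⟩).2) x :=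
      ContMDiffAt.clm_apply contMDiffAt_const h
    refine h2.congr_of_eventuallyEq ?_
    filter_upwards [(trivializationAt F V x).open_baseSet.mem_nhds
      (FiberBundle.mem_baseSet_trivializationAt F V x)] with y hy
    exact ((trivializationAt F V x).linear ℂ hy).map_smul _ _

variable (V) in
/-- Sections with compact support. -/
def compactlySupported : Submodule ℂ (Π x : M, V x) where
  carrier := {u | IsCompact (closure {x | u x ≠ 0})}
  zero_mem' := by simp
  add_mem' {u v} hu hv := by
    refine (hu.union hv).of_isClosed_subset isClosed_closure ?_
    rw [← closure_union]
    refine closure_mono fun x hx ↦ ?_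
    by_contra hc
    simp only [Set.mem_union, Set.mem_ofPred_eq, not_or, not_not] at hc
    exact hx (by simp [hc.1, hc.2])
  smul_mem' c u hu := by
    refine hu.of_isClosed_subset isClosed_closure (closure_mono fun x hx hux ↦ hx ?_)
    simp [hux]

variable (D : HermitianConnection n F V)

/-- `∇u`, a section of `T*M ⊗ V = Hom(TM, V)`. -/
def grad (u : Π x : M, V x) : Π x : M, TangentSpace (𝓡 n) x →L[ℝ] V x :=
  D.toCovariantDerivative u

/-- `∇²u`, a section of `T*M ⊗ T*M ⊗ V = Hom(TM, Hom(TM, V))`. -/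
def hess (u : Π x : M, V x) : Π x : M, TangentSpace (𝓡 n) x →L[ℝ] TangentSpace (𝓡 n) x →L[ℝ] V x :=
  homDeriv D.toCovariantDerivative (D.grad u)

/-- `tr ∇²u = ∑ᵢ ∇²u(eᵢ, eᵢ)` for an orthonormal basis `(eᵢ)` of the tangent space. -/
def trHess (u : Π x : M, V x) (x : M) : V x :=
  ∑ i, D.hess u x (stdOrthonormalBasis ℝ (TangentSpace (𝓡 n) x) i)
    (stdOrthonormalBasis ℝ (TangentSpace (𝓡 n) x) i)

lemma mdiffAt_of_smooth {u : Π x : M, V x} (hu : u ∈ smoothSections n F V) (x : M) :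
    SectionMDiffAt n F u x :=
  (hu x).mdifferentiableAt (by simp)

lemma mdiffAt_grad {u : Π x : M, V x} (hu : u ∈ smoothSections n F V) (x : M) :
    MDifferentiableAt (𝓡 n) ((𝓡 n).prod 𝓘(ℝ, EuclideanSpace ℝ (Fin n) →L[ℝ] F))
      (fun y ↦ TotalSpace.mk' (EuclideanSpace ℝ (Fin n) →L[ℝ] F) y (D.grad u y)) x := by
  have h := (D.contMDiff.contMDiff.contMDiff (σ := u) (by simpa using hu.contMDiffOn))
  exact (h.contMDiffAt (x := x) Filter.univ_mem).mdifferentiableAt (by simp)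

lemma grad_add {u v : Π x : M, V x} (hu : u ∈ smoothSections n F V)
    (hv : v ∈ smoothSections n F V) : D.grad (u + v) = D.grad u + D.grad v := by
  funext x
  exact D.isCovariantDerivativeOnUniv.add (mdiffAt_of_smooth hu x) (mdiffAt_of_smooth hv x)

lemma cov_smul (c : ℂ) {u : Π x : M, V x} {x : M} (hu : SectionMDiffAt n F u x) :
    D.toFun (c • u) x = c • D.toFun u x := by
  ext v
  have h := D.complex_leibniz (f := fun _ ↦ c) hu mdifferentiableAt_const v
  simp only [mvfderiv, mfderiv_const, ContinuousLinearMap.comp_zero, zero_apply, zero_smul,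
    add_zero] at h
  exact h

lemma grad_smul (c : ℂ) {u : Π x : M, V x} (hu : u ∈ smoothSections n F V) :
    D.grad (c • u) = c • D.grad u := by
  funext x
  exact D.cov_smul c (mdiffAt_of_smooth hu x)

lemma hess_apply {u : Π x : M, V x} (hu : u ∈ smoothSections n F V) (x : M)
    (v w : TangentSpace (𝓡 n) x) :
    D.hess u x v w = D.toFun (fun y ↦ D.grad u y (FiberBundle.extend (EuclideanSpace ℝ (Fin n)) w y)) x v
      - D.grad u x (leviCivita (FiberBundle.extend (EuclideanSpace ℝ (Fin n)) w) x v) := by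
  rw [hess, homDeriv, dif_pos (D.mdiffAt_grad hu x)]
  rfl

lemma mdiffAt_grad_extend {u : Π x : M, V x} (hu : u ∈ smoothSections n F V) {x : M}
    (w : TangentSpace (𝓡 n) x) :
    SectionMDiffAt n F (fun y ↦ D.grad u y (FiberBundle.extend (EuclideanSpace ℝ (Fin n)) w y)) x :=
  MDifferentiableAt.clm_bundle_apply (F₁ := EuclideanSpace ℝ (Fin n)) (F₂ := F)
    (D.mdiffAt_grad hu x) (FiberBundle.mdifferentiableAt_extend ..)

lemma hess_add {u v : Π x : M, V x} (hu : u ∈ smoothSections n F V)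
    (hv : v ∈ smoothSections n F V) : D.hess (u + v) = D.hess u + D.hess v := by
  funext x
  ext a b
  have h := D.isCovariantDerivativeOnUniv.add (D.mdiffAt_grad_extend hu b)
    (D.mdiffAt_grad_extend hv b)
  have h1 : (fun y ↦ D.grad (u + v) y (FiberBundle.extend (EuclideanSpace ℝ (Fin n)) b y))
      = (fun y ↦ D.grad u y (FiberBundle.extend (EuclideanSpace ℝ (Fin n)) b y))
        + fun y ↦ D.grad v y (FiberBundle.extend (EuclideanSpace ℝ (Fin n)) b y) := by
    rw [D.grad_add hu hv]; rfl
  simp only [Pi.add_apply, add_apply]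
  rw [D.hess_apply (add_mem hu hv), D.hess_apply hu, D.hess_apply hv, h1, h, D.grad_add hu hv]
  simp only [Pi.add_apply, add_apply]
  abel

lemma hess_smul (c : ℂ) {u : Π x : M, V x} (hu : u ∈ smoothSections n F V) :
    D.hess (c • u) = c • D.hess u := by
  funext x
  ext a b
  have h := D.cov_smul c (D.mdiffAt_grad_extend hu b)
  have h1 : (fun y ↦ D.grad (c • u) y (FiberBundle.extend (EuclideanSpace ℝ (Fin n)) b y))
      = c • fun y ↦ D.grad u y (FiberBundle.extend (EuclideanSpace ℝ (Fin n)) b y) := by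
    rw [D.grad_smul c hu]; rfl
  simp only [Pi.smul_apply, smul_apply]
  rw [D.hess_apply (Submodule.smul_mem _ c hu), D.hess_apply hu, h1, h, D.grad_smul c hu]
  simp only [Pi.smul_apply, smul_apply, smul_sub]

/-- The Hilbert space `L²(V)`. -/
abbrev L2V (_D : HermitianConnection n F V) : Type _ :=
  (bundleMetric n F V).L2 (riemannianVolume n M)

/-- The Hilbert space `L²(T*M ⊗ V)`. -/
abbrev L2TV (_D : HermitianConnection n F V) : Type _ :=
  (homMetric n (bundleMetric n F V)).L2 (riemannianVolume n M)

/-- The Hilbert space `L²(T*M ⊗ T*M ⊗ V)`. -/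
abbrev L2TTV (_D : HermitianConnection n F V) : Type _ :=
  (homMetric n (homMetric n (bundleMetric n F V))).L2 (riemannianVolume n M)

/-- `u` is a square integrable section of `V`. -/
abbrev MemL2V (_D : HermitianConnection n F V) (u : Π x : M, V x) : Prop :=
  u ∈ (bundleMetric n F V).squareIntegrable (riemannianVolume n M)

/-- `w` is a square integrable section of `T*M ⊗ V`. -/
abbrev MemL2TV (_D : HermitianConnection n F V)
    (w : Π x : M, TangentSpace (𝓡 n) x →L[ℝ] V x) : Prop :=
  w ∈ (homMetric n (bundleMetric n F V)).squareIntegrable (riemannianVolume n M)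

/-- `w` is a square integrable section of `T*M ⊗ T*M ⊗ V`. -/
abbrev MemL2TTV (_D : HermitianConnection n F V)
    (w : Π x : M, TangentSpace (𝓡 n) x →L[ℝ] TangentSpace (𝓡 n) x →L[ℝ] V x) : Prop :=
  w ∈ (homMetric n (homMetric n (bundleMetric n F V))).squareIntegrable (riemannianVolume n M)

/-- The class in `L²(V)` of a square integrable section. -/
def classV (u : Π x : M, V x) (hu : D.MemL2V u) : D.L2V :=
  (bundleMetric n F V).toL2 (riemannianVolume n M) ⟨u, hu⟩

/-- The class in `L²(T*M ⊗ V)` of a square integrable section. -/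
def classTV (w : Π x : M, TangentSpace (𝓡 n) x →L[ℝ] V x) (hw : D.MemL2TV w) : D.L2TV :=
  (homMetric n (bundleMetric n F V)).toL2 (riemannianVolume n M) ⟨w, hw⟩

/-- The class in `L²(T*M ⊗ T*M ⊗ V)` of a square integrable section. -/
def classTTV (w : Π x : M, TangentSpace (𝓡 n) x →L[ℝ] TangentSpace (𝓡 n) x →L[ℝ] V x)
    (hw : D.MemL2TTV w) : D.L2TTV :=
  (homMetric n (homMetric n (bundleMetric n F V))).toL2 (riemannianVolume n M) ⟨w, hw⟩

/-- The smooth sections `u` in `P` with `u` and `∇u` in `L²`. -/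
def sobolevSections₁ (P : Submodule ℂ (Π x : M, V x)) : Submodule ℂ (Π x : M, V x) where
  carrier := {u | u ∈ P ∧ u ∈ smoothSections n F V ∧ D.MemL2V u ∧ D.MemL2TV (D.grad u)}
  zero_mem' := by
    refine ⟨zero_mem _, zero_mem _, zero_mem _, ?_⟩
    have : D.grad 0 = 0 := by simpa using D.grad_smul 0 (zero_mem _)
    rw [this]
    exact zero_mem _
  add_mem' {u v} hu hv := by
    refine ⟨add_mem hu.1 hv.1, add_mem hu.2.1 hv.2.1, add_mem hu.2.2.1 hv.2.2.1, ?_⟩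
    rw [D.grad_add hu.2.1 hv.2.1]
    exact add_mem hu.2.2.2 hv.2.2.2
  smul_mem' c u hu := by
    refine ⟨Submodule.smul_mem _ c hu.1, Submodule.smul_mem _ c hu.2.1,
      Submodule.smul_mem _ c hu.2.2.1, ?_⟩
    rw [D.grad_smul c hu.2.1]
    exact Submodule.smul_mem _ c hu.2.2.2

/-- The smooth sections `u` in `P` with `u`, `∇u` and `∇²u` in `L²`. -/
def sobolevSections₂ (P : Submodule ℂ (Π x : M, V x)) : Submodule ℂ (Π x : M, V x) where
  carrier := {u | u ∈ D.sobolevSections₁ P ∧ D.MemL2TTV (D.hess u)}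
  zero_mem' := by
    refine ⟨zero_mem _, ?_⟩
    have : D.hess 0 = 0 := by
      funext x
      ext a b
      have h := congrArg (fun A ↦ A x a b) (D.hess_smul 0 (u := 0) (zero_mem _))
      simp only [smul_zero] at h
      refine h.trans ?_
      simp only [Pi.smul_apply, smul_apply, zero_smul]
      rfl
    rw [this]
    exact zero_mem _
  add_mem' {u v} hu hv := by
    refine ⟨add_mem hu.1 hv.1, ?_⟩
    rw [D.hess_add hu.1.2.1 hv.1.2.1]
    exact add_mem hu.2 hv.2
  smul_mem' c u hu := by
    refine ⟨Submodule.smul_mem _ c hu.1, ?_⟩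
    rw [D.hess_smul c hu.1.2.1]
    exact Submodule.smul_mem _ c hu.2

/-- `u ↦ (u, ∇u)`, with values in `L²(V) × L²(T*M ⊗ V)`. -/
def jet₁ (P : Submodule ℂ (Π x : M, V x)) : D.sobolevSections₁ P →ₗ[ℂ] D.L2V × D.L2TV where
  toFun u := (D.classV u.1 u.2.2.2.1, D.classTV (D.grad u.1) u.2.2.2.2)
  map_add' u v := by
    refine Prod.ext (map_add ((bundleMetric n F V).toL2 (riemannianVolume n M))
      ⟨u.1, u.2.2.2.1⟩ ⟨v.1, v.2.2.2.1⟩) ?_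
    refine Eq.trans ?_ (map_add ((homMetric n (bundleMetric n F V)).toL2 (riemannianVolume n M))
      ⟨D.grad u.1, u.2.2.2.2⟩ ⟨D.grad v.1, v.2.2.2.2⟩)
    exact congrArg _ (Subtype.ext (D.grad_add u.2.2.1 v.2.2.1))
  map_smul' c u := by
    refine Prod.ext (map_smul ((bundleMetric n F V).toL2 (riemannianVolume n M))
      c ⟨u.1, u.2.2.2.1⟩) ?_
    refine Eq.trans ?_ (map_smul ((homMetric n (bundleMetric n F V)).toL2 (riemannianVolume n M))
      c ⟨D.grad u.1, u.2.2.2.2⟩)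
    exact congrArg _ (Subtype.ext (D.grad_smul c u.2.2.1))

/-- `u ↦ ∇²u`, with values in `L²(T*M ⊗ T*M ⊗ V)`. -/
def hessL2 (P : Submodule ℂ (Π x : M, V x)) : D.sobolevSections₂ P →ₗ[ℂ] D.L2TTV where
  toFun u := D.classTTV (D.hess u.1) u.2.2
  map_add' u v := by
    refine Eq.trans ?_ (map_add ((homMetric n (homMetric n (bundleMetric n F V))).toL2
      (riemannianVolume n M)) ⟨D.hess u.1, u.2.2⟩ ⟨D.hess v.1, v.2.2⟩)
    exact congrArg _ (Subtype.ext (D.hess_add u.2.1.2.1 v.2.1.2.1))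
  map_smul' c u := by
    refine Eq.trans ?_ (map_smul ((homMetric n (homMetric n (bundleMetric n F V))).toL2
      (riemannianVolume n M)) c ⟨D.hess u.1, u.2.2⟩)
    exact congrArg _ (Subtype.ext (D.hess_smul c u.2.1.2.1))

/-- The inclusion of the sections in `sobolevSections₂ P` into those in `sobolevSections₁ P`. -/
def incl (P : Submodule ℂ (Π x : M, V x)) : D.sobolevSections₂ P →ₗ[ℂ] D.sobolevSections₁ P :=
  Submodule.inclusion fun _ hu ↦ hu.1

/-- `sobolevSections₂ P` as a type carrying the norm `‖u‖ + ‖∇u‖ + ‖∇²u‖`. -/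
def PreSobolev (P : Submodule ℂ (Π x : M, V x)) : Type _ := D.sobolevSections₂ P

instance (P : Submodule ℂ (Π x : M, V x)) : AddCommGroup (D.PreSobolev P) :=
  inferInstanceAs (AddCommGroup (D.sobolevSections₂ P))

instance (P : Submodule ℂ (Π x : M, V x)) : Module ℂ (D.PreSobolev P) :=
  inferInstanceAs (Module ℂ (D.sobolevSections₂ P))

/-- The Sobolev norm `‖u‖ + ‖∇u‖ + ‖∇²u‖` (all norms being `L²` norms). -/
def sobolevNorm (P : Submodule ℂ (Π x : M, V x)) (u : D.sobolevSections₂ P) : ℝ :=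
  ‖D.classV u.1 u.2.1.2.2.1‖ + ‖D.classTV (D.grad u.1) u.2.1.2.2.2‖
    + ‖D.classTTV (D.hess u.1) u.2.2‖

lemma sobolevNorm_eq (P : Submodule ℂ (Π x : M, V x)) (u : D.sobolevSections₂ P) :
    D.sobolevNorm P u = ‖(D.jet₁ P (D.incl P u)).1‖ + ‖(D.jet₁ P (D.incl P u)).2‖
      + ‖D.hessL2 P u‖ := rfl

lemma sobolevNorm_add_le (P : Submodule ℂ (Π x : M, V x)) (u v : D.sobolevSections₂ P) :
    D.sobolevNorm P (u + v) ≤ D.sobolevNorm P u + D.sobolevNorm P v := by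
  rw [sobolevNorm_eq, sobolevNorm_eq, sobolevNorm_eq]
  have h1 := norm_add_le (D.jet₁ P (D.incl P u)).1 (D.jet₁ P (D.incl P v)).1
  have h2 := norm_add_le (D.jet₁ P (D.incl P u)).2 (D.jet₁ P (D.incl P v)).2
  have h3 := norm_add_le (D.hessL2 P u) (D.hessL2 P v)
  rw [map_add, map_add, map_add, Prod.fst_add, Prod.snd_add]
  linarith

lemma sobolevNorm_smul (P : Submodule ℂ (Π x : M, V x)) (c : ℂ) (u : D.sobolevSections₂ P) :
    D.sobolevNorm P (c • u) = ‖c‖ * D.sobolevNorm P u := by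
  rw [sobolevNorm_eq, sobolevNorm_eq, map_smul, map_smul, map_smul, Prod.smul_fst, Prod.smul_snd,
    norm_smul, norm_smul, norm_smul]
  ring

lemma sobolevNorm_zero (P : Submodule ℂ (Π x : M, V x)) : D.sobolevNorm P 0 = 0 := by
  simpa using D.sobolevNorm_smul P 0 0

lemma sobolevNorm_neg (P : Submodule ℂ (Π x : M, V x)) (u : D.sobolevSections₂ P) :
    D.sobolevNorm P (-u) = D.sobolevNorm P u := by
  rw [← neg_one_smul ℂ u, sobolevNorm_smul]
  simp

instance (P : Submodule ℂ (Π x : M, V x)) : SeminormedAddCommGroup (D.PreSobolev P) :=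
  AddGroupSeminorm.toSeminormedAddCommGroup
    { toFun := D.sobolevNorm P
      map_zero' := D.sobolevNorm_zero P
      add_le' := D.sobolevNorm_add_le P
      neg' := D.sobolevNorm_neg P }

instance (P : Submodule ℂ (Π x : M, V x)) : NormedSpace ℂ (D.PreSobolev P) where
  norm_smul_le c u := (D.sobolevNorm_smul P c u).le

/-- `W^{2,2}(V)`: the completion, for the Sobolev norm, of the space of smooth sections `u` such
that `u`, `∇u` and `∇²u` are square integrable. -/
abbrev W22 : Type _ := UniformSpace.Completion (D.PreSobolev ⊤)

/-- `W₀^{2,2}(V)`: the completion of `C_c^∞(V)` for the Sobolev norm. (For a smooth section `u` with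
compact support, `u`, `∇u` and `∇²u` are automatically square integrable.) -/
abbrev W22₀ : Type _ := UniformSpace.Completion (D.PreSobolev (compactlySupported V))

variable {D} in
/-- The class in `L²(V)` of an element of the dense subspace of `W^{2,2}(V)` or `W₀^{2,2}(V)`. -/
def PreSobolev.toL2V {P : Submodule ℂ (Π x : M, V x)} (u : D.PreSobolev P) : D.L2V :=
  D.classV u.1 u.2.1.2.2.1

/-- The graph of `∇_c`, the connection with domain `C_c^∞(V)`, in `L²(V) × L²(T*M ⊗ V)`. -/
def gradGraph : Submodule ℂ (D.L2V × D.L2TV) :=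
  LinearMap.range (D.jet₁ (compactlySupported V))

/-- The graph of `div = -(∇_c)*`: the pairs `(w, f)` with `⟨∇v, w⟩ = -⟨v, f⟩` for `v ∈ C_c^∞(V)`. -/
def divGraph : Submodule ℂ (D.L2TV × D.L2V) where
  carrier := {p | ∀ q ∈ D.gradGraph, (inner ℂ q.2 p.1 : ℂ) = -inner ℂ q.1 p.2}
  zero_mem' := fun q _ ↦ by simp
  add_mem' {p p'} hp hp' := fun q hq ↦ by
    rw [Prod.fst_add, Prod.snd_add, inner_add_right, inner_add_right, hp q hq, hp' q hq]
    ring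
  smul_mem' c p hp := fun q hq ↦ by
    rw [Prod.smul_fst, Prod.smul_snd, inner_smul_right, inner_smul_right, hp q hq]
    ring

/-- The graph of the Bochner Laplacian `Δ_B = -div ∇̄`, where `∇̄` is the closure of `∇_c`: the
pairs `(u, f)` such that `u ∈ D(∇̄)`, `∇̄u ∈ D(div)` and `f = -div ∇̄u`. -/
def bochnerGraph : Submodule ℂ (D.L2V × D.L2V) where
  carrier := {p | ∃ w : D.L2TV, (p.1, w) ∈ D.gradGraph.topologicalClosure ∧
    (w, -p.2) ∈ D.divGraph}
  zero_mem' := ⟨0, zero_mem _, by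
    rw [Prod.snd_zero, neg_zero]
    exact zero_mem D.divGraph⟩
  add_mem' {p p'} := by
    rintro ⟨w, h1, h2⟩ ⟨w', h1', h2'⟩
    refine ⟨w + w', add_mem h1 h1', ?_⟩
    have := add_mem h2 h2'
    rw [Prod.mk_add_mk, ← neg_add] at this
    exact this
  smul_mem' c p := by
    rintro ⟨w, h1, h2⟩
    refine ⟨c • w, Submodule.smul_mem _ c h1, ?_⟩
    have := Submodule.smul_mem _ c h2
    rw [Prod.smul_mk, smul_neg] at this
    exact this

/-- The Bochner Laplacian, as an unbounded operator on `L²(V)`. -/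
def bochnerLaplacian : D.L2V →ₗ.[ℂ] D.L2V := D.bochnerGraph.toLinearPMap

end HermitianConnection

end Operators

end Bochner

end

/-! Everything rests on Green's formula and on completeness. For `v` smooth with compact support and
`u` smooth, `⟨∇v, ∇u⟩ + ⟨v, tr ∇²u⟩` is the divergence of a compactly supported vector field, so its
integral vanishes (`integral_greenFun`). Hence, if `∇u` and `tr ∇²u` are square integrable, then
`∇u` lies in the domain of `div` and `div ∇u = tr ∇²u` (`mem_divGraph_of_smooth`). Completeness
enters only through `exists_cutoffs`: closed balls are compact by Hopf-Rinow, so smoothed distance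
functions give smooth compactly supported `χ_k → 1` with `|dχ_k| ≤ 5 / (k + 1)`.

For smooth `u` with `u` and `tr ∇²u` in `L²`, Green's formula with `v = χ_k² u` bounds `∫ χ_k²
|∇u|²` independently of `k` (Caccioppoli), so `∇u` is in `L²` by Fatou. Then `χ_k u → u` and `∇(χ_k
u) → ∇u` in `L²`, which puts `u` in the domain of the closure of `∇_c`. This is the third claim.

The two embeddings are instances of one theorem, `exists_sobolev_embedding`, for the Sobolev
completion of the sections in any subspace `P`. The maps `u`, `∇u`, `∇²u`, `tr ∇²u` are bounded for
the Sobolev norm and extend to the completion; since the graphs of the closure of `∇_c` and of `div`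
are closed, the relations between these maps survive, and the estimate follows.

Injectivity is the delicate point, because the completion is abstract: if the limit in `L²(V)` is
zero, the limits of the gradients and of the Hessians must be shown to vanish too. For gradients
this is closability of `∇_c`, which is Green's formula once more
(`eq_zero_of_mem_closure_gradGraph`). For Hessians, integration by parts in charts turns the pairing
of `∇²v` with `χ_k ∇²u` into a pairing of `∇v` with a fixed element of `L²`
(`exists_integral_inner_hess_eq`). So when the limit gradient is zero, the limit Hessian is
orthogonal to every `χ_k ∇²u`, hence to every `∇²u`, hence to itself
(`hess_eq_zero_of_grad_eq_zero`). -/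

noncomputable section

namespace Bochner

local notation "𝔼" n:max => EuclideanSpace ℝ (Fin n)

/-! ### The Riemannian measure in a chart. -/

section ChartMeasure

variable {n : ℕ} {M : Type*} [TopologicalSpace M] [ChartedSpace (𝔼 n) M]
  [IsManifold (𝓡 n) ∞ M]

/-- The coordinate fields of the chart at `p` form a basis of the tangent space. -/
def coordBasis (p : M) {x : M} (hx : x ∈ (chartAt (𝔼 n) p).source) :
    Module.Basis (Fin n) ℝ (TangentSpace (𝓡 n) x) :=
  (trivializationAt (𝔼 n) (fun x : M ↦ TangentSpace (𝓡 n) x) p).basisAt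
    (EuclideanSpace.basisFun (Fin n) ℝ).toBasis hx

lemma coordFrame_eq_coordBasis (p : M) {x : M}
    (hx : x ∈ (chartAt (𝔼 n) p).source) (i : Fin n) :
    coordFrame p i x = coordBasis p hx i :=
  Bundle.Trivialization.localFrame_apply_of_mem_baseSet _ _ hx

lemma coordFrame_eq_tangentCoordChange (p : M) {x : M}
    (hx : x ∈ (chartAt (𝔼 n) p).source) (i : Fin n) :
    coordFrame p i x = tangentCoordChange (𝓡 n) p x x (EuclideanSpace.basisFun (Fin n) ℝ i) := by
  rw [coordFrame_eq_coordBasis p hx]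
  have h := TangentBundle.symmL_trivializationAt_eq_core (𝕜 := ℝ) (I := 𝓡 n) hx
  have h2 := congrArg (fun L : 𝔼 n →L[ℝ] TangentSpace (𝓡 n) x ↦
    L (EuclideanSpace.basisFun (Fin n) ℝ i)) h
  refine Eq.trans ?_ h2
  rw [Trivialization.symmL_apply]
  · simp [coordBasis, Trivialization.basisAt]
    rfl
  · exact hx

lemma contMDiffOn_coordFrame (p : M) (i : Fin n) :
    ContMDiffOn (𝓡 n) ((𝓡 n).prod 𝓘(ℝ, 𝔼 n)) ∞
      (fun x ↦ TotalSpace.mk' (𝔼 n) x (coordFrame p i x)) (chartAt (𝔼 n) p).source :=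
  Bundle.Trivialization.contMDiffOn_localFrame_baseSet (I := 𝓡 n) ∞
    (trivializationAt (𝔼 n) (fun x : M ↦ TangentSpace (𝓡 n) x) p)
    (EuclideanSpace.basisFun (Fin n) ℝ).toBasis i

lemma coordFrame_change (p q : M) {x : M}
    (hp : x ∈ (chartAt (𝔼 n) p).source)
    (hq : x ∈ (chartAt (𝔼 n) q).source) (i : Fin n) :
    coordFrame q i x = ∑ j, LinearMap.toMatrix (EuclideanSpace.basisFun (Fin n) ℝ).toBasis
      (EuclideanSpace.basisFun (Fin n) ℝ).toBasis
      (tangentCoordChange (𝓡 n) q p x : 𝔼 n →ₗ[ℝ] 𝔼 n) j i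
        • coordFrame p j x := by
  rw [coordFrame_eq_tangentCoordChange q hq,
    ← tangentCoordChange_comp (w := q) (x := p) (y := x) (z := x)
      ⟨⟨by simpa using hq, by simpa using hp⟩, by simp⟩]
  conv_lhs => rw [← (EuclideanSpace.basisFun (Fin n) ℝ).toBasis.sum_repr
    (tangentCoordChange (𝓡 n) q p x (EuclideanSpace.basisFun (Fin n) ℝ i))]
  rw [map_sum]
  refine Finset.sum_congr rfl fun j _ ↦ ?_
  rw [coordFrame_eq_tangentCoordChange p hp, map_smul, LinearMap.toMatrix_apply]
  simp
  rfl

variable [RiemannianBundle (fun x : M ↦ TangentSpace (𝓡 n) x)]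

/-- The coordinate frames differ by the Jacobian matrix `J`, so the Gram matrices are congruent:
`G_q = Jᵀ G_p J`. After a square root, the factor is the `|det J|` of the change of variables
formula. -/
lemma gramMatrix_change (p q : M) {x : M}
    (hp : x ∈ (chartAt (𝔼 n) p).source)
    (hq : x ∈ (chartAt (𝔼 n) q).source) :
    (gramMatrix (n := n) q x).det
      = (tangentCoordChange (𝓡 n) q p x).det ^ 2 * (gramMatrix (n := n) p x).det := by
  set J := LinearMap.toMatrix (EuclideanSpace.basisFun (Fin n) ℝ).toBasis
      (EuclideanSpace.basisFun (Fin n) ℝ).toBasis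
      (tangentCoordChange (𝓡 n) q p x : 𝔼 n →ₗ[ℝ] 𝔼 n)
    with hJ
  have hG : gramMatrix (n := n) q x = J.transpose * gramMatrix (n := n) p x * J := by
    ext i j
    simp only [gramMatrix, Matrix.of_apply]
    rw [coordFrame_change p q hp hq, coordFrame_change p q hp hq, sum_inner]
    simp only [inner_sum, inner_smul_left, inner_smul_right, Matrix.mul_apply, Matrix.of_apply,
      Matrix.transpose_apply, Finset.sum_mul]
    rw [Finset.sum_comm]
    refine Finset.sum_congr rfl fun a _ ↦ Finset.sum_congr rfl fun b _ ↦ ?_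
    rw [← hJ, RCLike.conj_to_real]
    ring
  have hd : (tangentCoordChange (𝓡 n) q p x).det = J.det := by
    rw [hJ, LinearMap.det_toMatrix]
  rw [hG, Matrix.det_mul, Matrix.det_mul, Matrix.det_transpose, hd]
  ring

lemma gramMatrix_det_pos (p : M) {x : M}
    (hp : x ∈ (chartAt (𝔼 n) p).source) :
    0 < (gramMatrix (n := n) p x).det := by
  have hG : gramMatrix (n := n) p x = Matrix.gram ℝ (coordBasis p hp) := by
    ext i j
    simp [gramMatrix, Matrix.gram, coordFrame_eq_coordBasis p hp]
  rw [hG]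
  exact (Matrix.posDef_gram_of_linearIndependent (coordBasis p hp).linearIndependent).det_pos

variable [IsContMDiffRiemannianBundle (𝓡 n) ∞ (𝔼 n)
    (fun x : M ↦ TangentSpace (𝓡 n) x)]

lemma contMDiffOn_gramMatrix (p : M) (i j : Fin n) :
    ContMDiffOn (𝓡 n) 𝓘(ℝ, ℝ) ∞ (fun x ↦ gramMatrix (n := n) p x i j)
      (chartAt (𝔼 n) p).source :=
  ContMDiffOn.inner_bundle (n := ∞) (E := fun x : M ↦ TangentSpace (𝓡 n) x)
    (contMDiffOn_coordFrame p i) (contMDiffOn_coordFrame p j)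

lemma contMDiffOn_gramMatrix_det (p : M) :
    ContMDiffOn (𝓡 n) 𝓘(ℝ, ℝ) ∞ (fun x ↦ (gramMatrix (n := n) p x).det)
      (chartAt (𝔼 n) p).source := by
  simp only [Matrix.det_apply]
  refine contMDiffOn_finsetSum fun σ _ ↦ ?_
  simp only [Units.smul_def, zsmul_eq_mul]
  refine contMDiffOn_const.mul ?_
  exact contMDiffOn_finsetProd fun i _ ↦ contMDiffOn_gramMatrix p _ _

lemma continuousOn_sqrt_gram (p : M) :
    ContinuousOn (fun x ↦ Real.sqrt (gramMatrix (n := n) p x).det)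
      (chartAt (𝔼 n) p).source :=
  (contMDiffOn_gramMatrix_det p).continuousOn.sqrt

variable [MeasurableSpace M] [BorelSpace M]

/-- The density of the Riemannian volume in the chart at `p` -/
def chartDensity (p : M) (y : 𝔼 n) : ℝ :=
  Real.sqrt (gramMatrix (n := n) p ((chartAt (𝔼 n) p).symm y)).det

lemma continuousOn_chartDensity (p : M) :
    ContinuousOn (chartDensity (n := n) p) (chartAt (𝔼 n) p).target :=
  (continuousOn_sqrt_gram p).comp (chartAt (𝔼 n) p).continuousOn_symm
    (chartAt (𝔼 n) p).mapsTo_symm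

lemma aemeasurable_chartAt_symm (p : M) : AEMeasurable (chartAt (𝔼 n) p).symm
    (volume.restrict (chartAt (𝔼 n) p).target) :=
  (chartAt (𝔼 n) p).continuousOn_symm.aemeasurable
    (chartAt (𝔼 n) p).open_target.measurableSet

/-- The pushed-forward measure is carried by the chart domain. Measurability of the density
therefore follows from its continuity on that domain. -/
lemma map_chartAt_symm_restrict (p : M) :
    (Measure.map (chartAt (𝔼 n) p).symm
    (volume.restrict (chartAt (𝔼 n) p).target)).restrict
      (chartAt (𝔼 n) p).source = Measure.map
      (chartAt (𝔼 n) p).symm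
    (volume.restrict (chartAt (𝔼 n) p).target) := by
  have ho := (chartAt (𝔼 n) p).open_target.measurableSet
  have hs := (chartAt (𝔼 n) p).open_source.measurableSet
  refine Measure.restrict_eq_self_of_ae_mem ?_
  refine (ae_map_iff (aemeasurable_chartAt_symm p) hs).2 ?_
  filter_upwards [ae_restrict_mem ho] with y hy
  exact (chartAt (𝔼 n) p).map_target hy

lemma aemeasurable_sqrt_gram (p : M) :
    AEMeasurable (fun x ↦ ENNReal.ofReal (Real.sqrt (gramMatrix (n := n) p x).det))
    (Measure.map (chartAt (𝔼 n) p).symm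
    (volume.restrict (chartAt (𝔼 n) p).target)) := by
  rw [← map_chartAt_symm_restrict]
  exact ((continuousOn_sqrt_gram p).aemeasurable
    (chartAt (𝔼 n) p).open_source.measurableSet).ennreal_ofReal

lemma lintegral_chartVolume (p : M) {f : M → ℝ≥0∞} (hf : Measurable f) :
    ∫⁻ x, f x ∂(chartVolume (n := n) p)
      = ∫⁻ y in (chartAt (𝔼 n) p).target,
        ENNReal.ofReal (chartDensity p y) *
          f ((chartAt (𝔼 n) p).symm y) := by
  rw [chartVolume, lintegral_withDensity_eq_lintegral_mul₀ (aemeasurable_sqrt_gram p)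
    hf.aemeasurable, lintegral_map' ((aemeasurable_sqrt_gram p).mul hf.aemeasurable)
      (aemeasurable_chartAt_symm p)]
  rfl

lemma chartVolume_apply (p : M) {A : Set M} (hA : MeasurableSet A) :
    chartVolume (n := n) p A = ∫⁻ y in ((chartAt (𝔼 n) p).target ∩
      (chartAt (𝔼 n) p).symm ⁻¹' A), ENNReal.ofReal (chartDensity p y) := by
  have ho := (chartAt (𝔼 n) p).open_target.measurableSet
  rw [← lintegral_indicator_one hA, lintegral_chartVolume p (measurable_one.indicator hA)]
  have hm : MeasurableSet ((chartAt (𝔼 n) p).target ∩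
      (chartAt (𝔼 n) p).symm ⁻¹' A) := by
    have := (continuousOn_iff_continuous_domRestrict.1
      (chartAt (𝔼 n) p).continuousOn_symm).measurable hA
    have := ho.subtype_image this
    convert this using 1
    ext y
    simp [and_comm]
  rw [← lintegral_indicator ho, ← lintegral_indicator hm]
  congr 1
  ext y
  by_cases h1 : y ∈ (chartAt (𝔼 n) p).target <;>
  by_cases h2 : (chartAt (𝔼 n) p).symm y ∈ A <;>
  simp [h1, h2, Set.indicator]

/-- Change of variables along the transition map: its Jacobian cancels against the change of `√det
g` from one chart to the other. -/
lemma chartVolume_apply_eq_of_subset (p q : M) {A : Set M} (hA : MeasurableSet A)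
    (hp : A ⊆ (chartAt (𝔼 n) p).source) (hq : A ⊆ (chartAt (𝔼 n) q).source) :
    chartVolume (n := n) p A = chartVolume (n := n) q A := by
  set φ := chartAt (𝔼 n) p with hφ
  set ψ := chartAt (𝔼 n) q with hψ
  have hm : MeasurableSet (ψ.target ∩ ψ.symm ⁻¹' A) := by
    have := (continuousOn_iff_continuous_domRestrict.1 ψ.continuousOn_symm).measurable hA
    convert ψ.open_target.measurableSet.subtype_image this using 1
    ext y
    simp [and_comm]
  have himage : φ.target ∩ φ.symm ⁻¹' A = (φ ∘ ψ.symm) '' (ψ.target ∩ ψ.symm ⁻¹' A) := by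
    ext y
    constructor
    · rintro ⟨h1, h2⟩
      refine ⟨ψ (φ.symm y), ⟨ψ.map_source (hq h2), ?_⟩, ?_⟩
      · simpa [ψ.left_inv (hq h2)] using h2
      · simp [ψ.left_inv (hq h2), φ.right_inv h1]
    · rintro ⟨z, ⟨h1, h2⟩, rfl⟩
      exact ⟨φ.map_source (hp h2), by simpa [φ.left_inv (hp h2)] using h2⟩
  have hinj : Set.InjOn (φ ∘ ψ.symm) (ψ.target ∩ ψ.symm ⁻¹' A) :=
    φ.injOn.comp (ψ.symm.injOn.mono Set.inter_subset_left) fun z hz ↦ hp hz.2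
  have hder : ∀ z ∈ ψ.target ∩ ψ.symm ⁻¹' A, HasFDerivWithinAt (φ ∘ ψ.symm)
      (tangentCoordChange (𝓡 n) q p (ψ.symm z)) (ψ.target ∩ ψ.symm ⁻¹' A) z := by
    intro z hz
    have h := hasFDerivWithinAt_tangentCoordChange (I := 𝓡 n) (x := q) (y := p) (z := ψ.symm z)
      ⟨by simpa using hq hz.2, by simpa using hp hz.2⟩
    have hz' : extChartAt (𝓡 n) q (ψ.symm z) = z := by simpa using ψ.right_inv hz.1
    rw [hz'] at h
    exact h.mono (by simp)
  rw [chartVolume_apply p hA, chartVolume_apply q hA, himage,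
    lintegral_image_eq_lintegral_abs_det_fderiv_mul volume hm hder hinj]
  refine setLIntegral_congr_fun hm fun z hz ↦ ?_
  rw [← ENNReal.ofReal_mul (abs_nonneg _)]
  congr 1
  have hz2 : φ.symm ((φ ∘ ψ.symm) z) = ψ.symm z := φ.left_inv (hp hz.2)
  rw [chartDensity, chartDensity, hz2, gramMatrix_change p q (hp hz.2) (hq hz.2),
    Real.sqrt_mul (sq_nonneg _), Real.sqrt_sq_eq_abs]

lemma chartVolume_compl_source (p : M) :
    chartVolume (n := n) p (chartAt (𝔼 n) p).sourceᶜ = 0 := by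
  rw [chartVolume_apply p (chartAt (𝔼 n) p).open_source.measurableSet.compl]
  have : (chartAt (𝔼 n) p).target ∩ (chartAt (𝔼 n) p).symm ⁻¹' (chartAt (𝔼 n) p).sourceᶜ = ∅ := by
    ext y
    simp only [Set.mem_inter_iff, Set.mem_preimage, Set.mem_compl_iff, Set.mem_empty_iff_false,
      iff_false, not_and, not_not]
    exact fun h ↦ (chartAt (𝔼 n) p).map_target h
  rw [this]
  simp

lemma chartVolume_le (p : M) : chartVolume (n := n) p ≤ riemannianVolume n M :=
  le_iSup (fun p : M ↦ chartVolume (n := n) p) p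

/-- A supremum of measures is not computed set by set, so the upper bound is obtained from a
competitor: one measure that dominates every `chartVolume q` and whose restriction to the domain of
the chart at `p` is `chartVolume p`. -/
lemma riemannianVolume_restrict_source (p : M) :
    (riemannianVolume n M).restrict (chartAt (𝔼 n) p).source = chartVolume (n := n) p := by
  have hs := (chartAt (𝔼 n) p).open_source.measurableSet
  have hself : (chartVolume (n := n) p).restrict (chartAt (𝔼 n) p).source = chartVolume p :=
    Measure.restrict_eq_self_of_ae_mem (chartVolume_compl_source p)
  refine le_antisymm ?_ ?_
  -- Inside the domain at `p` the two chart measures agree on the overlap and `chartVolume q`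
  -- vanishes off its own domain; outside, the full measure is used as the bound.
  · have hub : riemannianVolume n M ≤ chartVolume (n := n) p
        + (riemannianVolume n M).restrict (chartAt (𝔼 n) p).sourceᶜ := by
      refine iSup_le fun q ↦ ?_
      refine Measure.le_iff.2 fun A hA ↦ ?_
      rw [← measure_inter_add_sdiff A hs, Measure.add_apply, Measure.restrict_apply hA]
      refine add_le_add ?_ ?_
      · have hq := (chartAt (𝔼 n) q).open_source.measurableSet
        rw [← measure_inter_add_sdiff (A ∩ _) hq]
        have h0 : chartVolume (n := n) q ((A ∩ (chartAt (𝔼 n) p).source) \ (chartAt (𝔼 n) q).source)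
            = 0 :=
          measure_mono_null (fun x hx ↦ hx.2) (chartVolume_compl_source q)
        rw [h0, add_zero, chartVolume_apply_eq_of_subset q p ((hA.inter hs).inter hq)
          (fun x hx ↦ hx.2) (fun x hx ↦ hx.1.2)]
        exact measure_mono fun x hx ↦ hx.1.1
      · exact chartVolume_le q _
    refine (Measure.restrict_mono_measure hub _).trans ?_
    rw [Measure.restrict_add, hself, Measure.restrict_restrict hs]
    simp
  · rw [← hself]
    exact Measure.restrict_mono_measure (chartVolume_le p) _

/-- The density is continuous, hence integrable on a closed coordinate ball. This is what makes
continuous functions with compact support integrable. -/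
instance : IsLocallyFiniteMeasure (riemannianVolume n M) := by
  refine ⟨fun x ↦ ?_⟩
  set φ := chartAt (𝔼 n) x with hφ
  have hx : φ x ∈ φ.target := mem_chart_target _ x
  obtain ⟨r, hr, hball⟩ := Metric.nhds_basis_closedBall.mem_iff.1 (φ.open_target.mem_nhds hx)
  have hnhd : φ.source ∩ φ ⁻¹' (Metric.ball (φ x) r) ∈ 𝓝 x :=
    (φ.isOpen_inter_preimage Metric.isOpen_ball).mem_nhds
      ⟨mem_chart_source _ x, Metric.mem_ball_self hr⟩
  refine ⟨_, hnhd, ?_⟩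
  have hme := (φ.isOpen_inter_preimage (Metric.isOpen_ball (x := φ x) (ε := r))).measurableSet
  have h1 : riemannianVolume n M (φ.source ∩ φ ⁻¹' (Metric.ball (φ x) r))
      = chartVolume (n := n) x (φ.source ∩ φ ⁻¹' (Metric.ball (φ x) r)) := by
    rw [← riemannianVolume_restrict_source x, Measure.restrict_apply hme]
    congr 1
    exact (Set.inter_eq_left.2 fun y hy ↦ hy.1).symm
  rw [h1, chartVolume_apply x hme]
  have hK : IntegrableOn (chartDensity (n := n) x) (Metric.closedBall (φ x) r) :=
    ((continuousOn_chartDensity x).mono hball).integrableOn_compact (isCompact_closedBall _ _)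
  refine lt_of_le_of_lt (lintegral_mono_set ?_) hK.lintegral_lt_top
  rintro y ⟨hy1, hy2, hy3⟩
  refine Metric.ball_subset_closedBall ?_
  have : φ (φ.symm y) ∈ Metric.ball (φ x) r := hy3
  rwa [φ.right_inv hy1] at this

lemma integral_riemannianVolume (p : M) {f : M → ℂ}
    (hf : ContinuousOn f (chartAt (𝔼 n) p).source)
    (hf0 : ∀ x ∉ (chartAt (𝔼 n) p).source, f x = 0) :
    ∫ x, f x ∂(riemannianVolume n M)
      = ∫ y in (chartAt (𝔼 n) p).target,
          chartDensity p y • f ((chartAt (𝔼 n) p).symm y) := by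
  have hs := (chartAt (𝔼 n) p).open_source.measurableSet
  rw [← setIntegral_eq_integral_of_forall_compl_eq_zero hf0, riemannianVolume_restrict_source,
    chartVolume, integral_withDensity_eq_integral_toReal_smul₀ (aemeasurable_sqrt_gram p)
      (.of_forall fun x ↦ ENNReal.ofReal_lt_top),
    integral_map (aemeasurable_chartAt_symm p)]
  · refine integral_congr_ae (.of_forall fun y ↦ ?_)
    simp only [chartDensity]
    rw [ENNReal.toReal_ofReal (Real.sqrt_nonneg _)]
  · refine (aemeasurable_sqrt_gram p).ennreal_toReal.aestronglyMeasurable.smul ?_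
    rw [← map_chartAt_symm_restrict]
    exact hf.aestronglyMeasurable hs

end ChartMeasure

/-! ### Derivative of a determinant. -/

section Jacobi

variable {n : ℕ} {X : Type*} [NormedAddCommGroup X] [NormedSpace ℝ X]

/-- Jacobi's formula for the derivative of a determinant. -/
lemma hasFDerivAt_det {A : X → Matrix (Fin n) (Fin n) ℝ} {A' : Fin n → Fin n → X →L[ℝ] ℝ} {y : X}
    (hA : ∀ i j, HasFDerivAt (fun z ↦ A z i j) (A' i j) y) :
    HasFDerivAt (fun z ↦ (A z).det) (∑ i, ∑ j, (A y).adjugate j i • A' i j) y := by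
  let d : ContinuousMultilinearMap ℝ (fun _ : Fin n ↦ (Fin n → ℝ)) ℝ :=
    ⟨(Matrix.detRowAlternating (n := Fin n) (R := ℝ)).toMultilinearMap, by
      have : Continuous fun B : Fin n → Fin n → ℝ ↦ (Matrix.of B).det :=
        Continuous.matrix_det continuous_id
      exact this⟩
  have hd := d.hasFDerivAt (fun i j ↦ A y i j)
  have hA2 : HasFDerivAt (fun z ↦ (fun i j ↦ A z i j : Fin n → Fin n → ℝ))
      (ContinuousLinearMap.pi fun i ↦ ContinuousLinearMap.pi fun j ↦ A' i j) y :=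
    hasFDerivAt_pi.2 fun i ↦ hasFDerivAt_pi.2 fun j ↦ hA i j
  have h := HasFDerivAt.comp y hd hA2
  refine h.congr_fderiv ?_
  ext v
  simp only [ContinuousLinearMap.comp_apply, ContinuousMultilinearMap.linearDeriv_apply]
  simp only [FunLike.coe_sum, Finset.sum_apply, smul_apply, smul_eq_mul]
  refine Finset.sum_congr rfl fun i _ ↦ ?_
  have h1 : d (Function.update (fun i j ↦ A y i j) i
      ((ContinuousLinearMap.pi fun i ↦ ContinuousLinearMap.pi fun j ↦ A' i j) v i))
      = ((A y).updateRow i (fun j ↦ A' i j v)).det := rfl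
  -- The derivative of a multilinear map replaces one row at a time; by Cramer's rule the resulting
  -- determinant is an entry of the adjugate applied to the new row.
  rw [h1, ← Matrix.cramer_transpose_apply, Matrix.cramer_eq_adjugate_mulVec, Matrix.mulVec,
    dotProduct, ← Matrix.adjugate_transpose]
  rfl

end Jacobi

/-! ### Derivatives along coordinate fields. -/

section ChartDeriv

variable {n : ℕ} {M : Type*} [TopologicalSpace M] [ChartedSpace (𝔼 n) M]
  [IsManifold (𝓡 n) ∞ M]
variable {G : Type*} [NormedAddCommGroup G] [NormedSpace ℝ G]

lemma mvfderiv_congr_of_eventuallyEq {f g : M → G} {x : M} (h : f =ᶠ[𝓝 x] g) :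
    mvfderiv (𝓡 n) f x = mvfderiv (𝓡 n) g x := by
  have h1 := h.mfderiv_eq (I := 𝓡 n) (I' := 𝓘(ℝ, G))
  ext v
  exact congrArg (fun L : 𝔼 n →L[ℝ] G ↦ L v) h1

lemma mfderiv_chartAt_symm (p : M) {x : M} (hx : x ∈ (chartAt (𝔼 n) p).source) (i : Fin n) :
    (mfderiv 𝓘(ℝ, 𝔼 n) (𝓡 n) (chartAt (𝔼 n) p).symm (chartAt (𝔼 n) p x) :
      𝔼 n →L[ℝ] 𝔼 n) (EuclideanSpace.basisFun (Fin n) ℝ i) = coordFrame p i x := by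
  rw [coordFrame_eq_coordBasis p hx]
  have h := TangentBundle.symmL_trivializationAt (I := 𝓡 n) hx
  have h2 := congrArg (fun L : 𝔼 n →L[ℝ] TangentSpace (𝓡 n) x ↦
    L (EuclideanSpace.basisFun (Fin n) ℝ i)) h
  have h3 : coordBasis p hx i = _ := Eq.trans (by
    rw [Trivialization.symmL_apply]
    · simp [coordBasis, Trivialization.basisAt]
      rfl
    · exact hx) h2
  rw [h3]
  simp [mfderivWithin_univ]
  rfl

lemma mdifferentiableAt_chartAt_symm (p : M) {x : M} (hx : x ∈ (chartAt (𝔼 n) p).source) :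
    MDifferentiableAt 𝓘(ℝ, 𝔼 n) (𝓡 n) (chartAt (𝔼 n) p).symm (chartAt (𝔼 n) p x) :=
  ((contMDiffOn_chart_symm (I := 𝓡 n) (n := ∞) (x := p)).contMDiffAt
    ((chartAt (𝔼 n) p).open_target.mem_nhds ((chartAt (𝔼 n) p).map_source hx))).mdifferentiableAt
      (by simp)

lemma mvfderiv_coordFrame (p : M) {x : M} (hx : x ∈ (chartAt (𝔼 n) p).source) {f : M → G}
    (hf : MDifferentiableAt (𝓡 n) 𝓘(ℝ, G) f x) (i : Fin n) :
    mvfderiv (𝓡 n) f x (coordFrame p i x)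
      = fderiv ℝ (f ∘ (chartAt (𝔼 n) p).symm) (chartAt (𝔼 n) p x)
        (EuclideanSpace.basisFun (Fin n) ℝ i) := by
  have hxx : (chartAt (𝔼 n) p).symm (chartAt (𝔼 n) p x) = x := (chartAt (𝔼 n) p).left_inv hx
  have hc := mfderiv_comp_of_eq (I := 𝓘(ℝ, 𝔼 n)) (I' := 𝓡 n) (I'' := 𝓘(ℝ, G))
    hf (mdifferentiableAt_chartAt_symm p hx) hxx
  rw [← mfderiv_eq_fderiv, hc, ← mfderiv_chartAt_symm p hx, hxx]
  rfl

lemma contDiffOn_comp_chartAt_symm (p : M) {f : M → G} {m : ℕ∞ω} (hm : m ≤ (∞ : ℕ∞ω))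
    (hf : ContMDiffOn (𝓡 n) 𝓘(ℝ, G) m f (chartAt (𝔼 n) p).source) :
    ContDiffOn ℝ m (f ∘ (chartAt (𝔼 n) p).symm) (chartAt (𝔼 n) p).target := by
  rw [← contMDiffOn_iff_contDiffOn]
  exact hf.comp ((contMDiffOn_chart_symm (I := 𝓡 n) (n := ∞) (x := p)).of_le hm)
    (chartAt (𝔼 n) p).mapsTo_symm

/-- The orders are kept general because test functions are only `C¹` (`k = 1`, `m = 0`) while the
metric coefficients are smooth. -/
lemma contMDiffOn_mvfderiv_coordFrame (p : M) {f : M → G} {m k : ℕ∞ω} (hk : k ≤ (∞ : ℕ∞ω))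
    (hf : ContMDiffOn (𝓡 n) 𝓘(ℝ, G) k f (chartAt (𝔼 n) p).source) (hmk : m + 1 ≤ k)
    (i : Fin n) :
    ContMDiffOn (𝓡 n) 𝓘(ℝ, G) m (fun x ↦ mvfderiv (𝓡 n) f x (coordFrame p i x))
      (chartAt (𝔼 n) p).source := by
  have h1 := (contDiffOn_comp_chartAt_symm p hk hf).fderiv_of_isOpen
    (chartAt (𝔼 n) p).open_target hmk
  have h2 : ContDiffOn ℝ m (fun y ↦ fderiv ℝ (f ∘ (chartAt (𝔼 n) p).symm) y
      (EuclideanSpace.basisFun (Fin n) ℝ i)) (chartAt (𝔼 n) p).target :=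
    h1.clm_apply contDiffOn_const
  have hmk' : m ≤ (∞ : ℕ∞ω) := (le_self_add.trans hmk).trans hk
  have h3 := h2.contMDiffOn.comp ((contMDiffOn_chart (I := 𝓡 n) (n := ∞) (x := p)).of_le hmk')
    (chartAt (𝔼 n) p).mapsTo
  refine h3.congr fun x hx ↦ ?_
  have hne : k ≠ 0 := by
    rintro rfl
    simp at hmk
  exact mvfderiv_coordFrame p hx ((hf.contMDiffAt
    ((chartAt (𝔼 n) p).open_source.mem_nhds hx)).mdifferentiableAt hne) i

lemma mdifferentiableAt_coordFrame (p : M) {x : M} (hx : x ∈ (chartAt (𝔼 n) p).source)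
    (i : Fin n) : MDifferentiableAt (𝓡 n) ((𝓡 n).prod 𝓘(ℝ, 𝔼 n))
      (fun y ↦ TotalSpace.mk' (𝔼 n) y (coordFrame p i y)) x :=
  ((contMDiffOn_coordFrame p i).contMDiffAt
    ((chartAt (𝔼 n) p).open_source.mem_nhds hx)).mdifferentiableAt (by simp)

/-- The bracket commutes with pullback along the inverse chart, where coordinate fields become
constant; the pullback at a point is invertible. -/
lemma mlieBracket_coordFrame (p : M) {x : M} (hx : x ∈ (chartAt (𝔼 n) p).source) (i j : Fin n) :
    VectorField.mlieBracket (𝓡 n) (coordFrame p i) (coordFrame p j) x = 0 := by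
  have : IsManifold (𝓡 n) (minSmoothness ℝ 2) M := by
    rw [minSmoothness_of_isRCLikeNormedField]
    exact .of_le (n := ∞) ENat.LEInfty.out
  set φ := chartAt (𝔼 n) p with hφ
  have hxx : φ.symm (φ x) = x := φ.left_inv hx
  have hinv : ∀ y ∈ φ.target, (mfderiv 𝓘(ℝ, 𝔼 n) (𝓡 n) φ.symm y).IsInvertible := by
    intro y hy
    have := isInvertible_mfderivWithin_extChartAt_symm (I := 𝓡 n) (x := p) (y := y)
      (by simpa using hy)
    rw [modelWithCornersSelf_coe, Set.range_id, mfderivWithin_univ] at this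
    exact this
  have hpull : ∀ k, ∀ y ∈ φ.target, VectorField.mpullback 𝓘(ℝ, 𝔼 n) (𝓡 n) φ.symm (coordFrame p k) y
      = EuclideanSpace.basisFun (Fin n) ℝ k := by
    intro k y hy
    rw [VectorField.mpullback_apply]
    have h := mfderiv_chartAt_symm p (φ.map_target hy) k
    rw [φ.right_inv hy] at h
    rw [← h]
    exact (hinv y hy).inverse_apply_self _
  have hb := VectorField.mpullback_mlieBracket (I := 𝓘(ℝ, 𝔼 n)) (I' := 𝓡 n) (f := φ.symm)
    (x₀ := φ x) (n := ∞) (V := coordFrame p i) (W := coordFrame p j)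
    (by rw [hxx]; exact mdifferentiableAt_coordFrame p hx i)
    (by rw [hxx]; exact mdifferentiableAt_coordFrame p hx j)
    ((contMDiffOn_chart_symm (I := 𝓡 n) (n := ∞) (x := p)).contMDiffAt
      (φ.open_target.mem_nhds (φ.map_source hx)))
    (by rw [minSmoothness_of_isRCLikeNormedField]; exact ENat.LEInfty.out)
  have he : ∀ k, VectorField.mpullback 𝓘(ℝ, 𝔼 n) (𝓡 n) φ.symm (coordFrame p k) =ᶠ[𝓝 (φ x)]
      fun _ ↦ EuclideanSpace.basisFun (Fin n) ℝ k := fun k ↦ by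
    filter_upwards [φ.open_target.mem_nhds (φ.map_source hx)] with y hy
    exact hpull k y hy
  rw [(he i).mlieBracket_vectorField_eq (he j), VectorField.mpullback_apply] at hb
  have h0 : VectorField.mlieBracket (𝓡 n) (fun _ : 𝔼 n ↦ EuclideanSpace.basisFun (Fin n) ℝ i)
      (fun _ ↦ EuclideanSpace.basisFun (Fin n) ℝ j) (φ x) = 0 := by
    have h := congrFun (VectorField.mlieBracketWithin_eq_lieBracketWithin (𝕜 := ℝ)
      (V := fun _ : 𝔼 n ↦ EuclideanSpace.basisFun (Fin n) ℝ i)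
      (W := fun _ : 𝔼 n ↦ EuclideanSpace.basisFun (Fin n) ℝ j) (s := Set.univ)) (φ x)
    refine ((congrFun (VectorField.mlieBracketWithin_univ (I := 𝓡 n)
      (V := fun _ : 𝔼 n ↦ EuclideanSpace.basisFun (Fin n) ℝ i)
      (W := fun _ : 𝔼 n ↦ EuclideanSpace.basisFun (Fin n) ℝ j)) (φ x)).symm.trans h).trans ?_
    simp [VectorField.lieBracketWithin]
    rfl
  have h1 := hb.trans h0
  rw [(hinv _ (φ.map_source hx)).inverse_apply_eq, map_zero, hxx] at h1
  exact h1

/-! ### Divergence of coordinate fields and the divergence theorem for them. -/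

section Divergence

variable [RiemannianBundle (fun x : M ↦ TangentSpace (𝓡 n) x)]
  [IsContMDiffRiemannianBundle (𝓡 n) ∞ (𝔼 n) (fun x : M ↦ TangentSpace (𝓡 n) x)]

/-- The divergence `tr ∇X` of a vector field. -/
def divergence (X : Π x : M, TangentSpace (𝓡 n) x) (x : M) : ℝ :=
  LinearMap.trace ℝ (TangentSpace (𝓡 n) x) (leviCivita X x).toLinearMap

/-- Pairing `A bᵢ` with `bⱼ` multiplies the matrix of `A` by the Gram matrix, and the inverse Gram
matrix undoes this. -/
lemma trace_eq_sum_gram_inv {T : Type*} [NormedAddCommGroup T] [InnerProductSpace ℝ T]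
    {ι : Type*} [Fintype ι] [DecidableEq ι] (b : Module.Basis ι ℝ T) (A : T →ₗ[ℝ] T) :
    LinearMap.trace ℝ T A = ∑ i, ∑ j,
      (Matrix.of fun j k ↦ (inner ℝ (b j) (b k) : ℝ))⁻¹ i j * inner ℝ (A (b i)) (b j) := by
  set G : Matrix ι ι ℝ := Matrix.of fun j k ↦ (inner ℝ (b j) (b k) : ℝ) with hG
  have hdet : IsUnit G.det := by
    have : G = Matrix.gram ℝ b := by
      ext i j
      simp [hG, Matrix.gram]
    rw [this]
    exact (Matrix.posDef_gram_of_linearIndependent b.linearIndependent).det_pos.ne'.isUnit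
  have hGs : G.transpose = G := by
    ext i j
    simp [hG, real_inner_comm]
  have hinvs : (G⁻¹).transpose = G⁻¹ := by rw [Matrix.transpose_nonsing_inv, hGs]
  rw [LinearMap.trace_eq_matrix_trace ℝ b, Matrix.trace]
  refine Finset.sum_congr rfl fun i _ ↦ ?_
  rw [Matrix.diag_apply, LinearMap.toMatrix_apply]
  have h1 : ∀ j, inner ℝ (A (b i)) (b j) = ∑ l, b.repr (A (b i)) l * G l j := by
    intro j
    conv_lhs => rw [← b.sum_repr (A (b i))]
    rw [sum_inner]
    refine Finset.sum_congr rfl fun l _ ↦ ?_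
    rw [inner_smul_left]
    rfl
  have h2 : ∀ j, G⁻¹ i j = G⁻¹ j i := fun j ↦ congrFun (congrFun hinvs j) i
  simp_rw [h1, Finset.mul_sum, h2]
  rw [Finset.sum_comm]
  have h3 : ∀ l, ∑ j, G⁻¹ j i * (b.repr (A (b i)) l * G l j) = b.repr (A (b i)) l * (G * G⁻¹) l i := by
    intro l
    rw [Matrix.mul_apply, Finset.mul_sum]
    exact Finset.sum_congr rfl fun j _ ↦ by ring
  simp_rw [h3, Matrix.mul_nonsing_inv G hdet, Matrix.one_apply]
  simp

lemma gramMatrix_symm (p x : M) (i j : Fin n) :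
    gramMatrix (n := n) p x i j = gramMatrix p x j i := by
  simp [gramMatrix, real_inner_comm]

lemma gramMatrix_inv_symm (p x : M) (i j : Fin n) :
    (gramMatrix (n := n) p x)⁻¹ i j = (gramMatrix p x)⁻¹ j i := by
  have hGs : (gramMatrix (n := n) p x).transpose = gramMatrix p x := by
    ext i j
    exact gramMatrix_symm p x j i
  have hinvs : ((gramMatrix (n := n) p x)⁻¹).transpose = (gramMatrix p x)⁻¹ := by
    rw [Matrix.transpose_nonsing_inv, hGs]
  exact congrFun (congrFun hinvs j) i

/-- Brackets drop out of Koszul's formula. Of the three remaining derivatives, `∂ᵢ g_{kj} - ∂ⱼ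
g_{ik}` is antisymmetric in `i, j` and disappears against the symmetric inverse matrix. -/
lemma divergence_coordFrame (p : M) {x : M} (hx : x ∈ (chartAt (𝔼 n) p).source) (k : Fin n) :
    divergence (coordFrame p k) x = (1 / 2 : ℝ) * ∑ i, ∑ j, (gramMatrix (n := n) p x)⁻¹ i j *
      mvfderiv (𝓡 n) (fun y ↦ gramMatrix (n := n) p y i j) x (coordFrame p k x) := by
  have hG : (Matrix.of fun i j ↦ (inner ℝ (coordBasis p hx i) (coordBasis p hx j) : ℝ))
      = gramMatrix (n := n) p x := by
    ext i j
    simp [gramMatrix, coordFrame_eq_coordBasis p hx]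
  have hk : ∀ i j, inner ℝ (leviCivita (coordFrame p k) x (coordFrame p i x)) (coordFrame p j x)
      = (1 / 2 : ℝ) * (mvfderiv (𝓡 n) (fun y ↦ gramMatrix (n := n) p y k j) x (coordFrame p i x)
        + mvfderiv (𝓡 n) (fun y ↦ gramMatrix (n := n) p y i j) x (coordFrame p k x)
        - mvfderiv (𝓡 n) (fun y ↦ gramMatrix (n := n) p y i k) x (coordFrame p j x)) := by
    intro i j
    refine (inner_leviCivitaFun (mdifferentiableAt_coordFrame p hx k)
      (mdifferentiableAt_coordFrame p hx i) (mdifferentiableAt_coordFrame p hx j)).trans ?_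
    have hm : ∀ a b, metricFun (coordFrame p a) (coordFrame p b)
        = fun y ↦ gramMatrix (n := n) p y a b := fun a b ↦ rfl
    have h0 : ∀ a b c, metricFun (VectorField.mlieBracket (𝓡 n) (coordFrame p a) (coordFrame p b))
        (coordFrame p c) x = 0 := fun a b c ↦ by
      simp [metricFun, mlieBracket_coordFrame p hx]
    simp only [koszulForm, hm, h0]
    ring
  rw [divergence, trace_eq_sum_gram_inv (coordBasis p hx), hG]
  simp only [ContinuousLinearMap.coe_coe, ← coordFrame_eq_coordBasis p hx, hk]
  have hsw : ∑ i, ∑ j, (gramMatrix (n := n) p x)⁻¹ i j *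
      mvfderiv (𝓡 n) (fun y ↦ gramMatrix (n := n) p y k j) x (coordFrame p i x)
      = ∑ i, ∑ j, (gramMatrix (n := n) p x)⁻¹ i j *
      mvfderiv (𝓡 n) (fun y ↦ gramMatrix (n := n) p y i k) x (coordFrame p j x) := by
    rw [Finset.sum_comm]
    refine Finset.sum_congr rfl fun i _ ↦ Finset.sum_congr rfl fun j _ ↦ ?_
    rw [gramMatrix_inv_symm p x]
    simp_rw [gramMatrix_symm p _ k i]
  have hlin : ∀ i j, (gramMatrix (n := n) p x)⁻¹ i j * ((1 / 2 : ℝ) *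
      (mvfderiv (𝓡 n) (fun y ↦ gramMatrix (n := n) p y k j) x (coordFrame p i x)
        + mvfderiv (𝓡 n) (fun y ↦ gramMatrix (n := n) p y i j) x (coordFrame p k x)
        - mvfderiv (𝓡 n) (fun y ↦ gramMatrix (n := n) p y i k) x (coordFrame p j x)))
      = (1 / 2 : ℝ) * ((gramMatrix (n := n) p x)⁻¹ i j *
          mvfderiv (𝓡 n) (fun y ↦ gramMatrix (n := n) p y k j) x (coordFrame p i x))
        + (1 / 2 : ℝ) * ((gramMatrix (n := n) p x)⁻¹ i j *
          mvfderiv (𝓡 n) (fun y ↦ gramMatrix (n := n) p y i j) x (coordFrame p k x))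
        - (1 / 2 : ℝ) * ((gramMatrix (n := n) p x)⁻¹ i j *
          mvfderiv (𝓡 n) (fun y ↦ gramMatrix (n := n) p y i k) x (coordFrame p j x)) :=
    fun i j ↦ by ring
  simp_rw [hlin, Finset.sum_sub_distrib, Finset.sum_add_distrib, ← Finset.mul_sum]
  rw [hsw]
  ring

lemma contMDiffOn_gramMatrix_inv (p : M) (i j : Fin n) :
    ContMDiffOn (𝓡 n) 𝓘(ℝ, ℝ) ∞ (fun x ↦ (gramMatrix (n := n) p x)⁻¹ i j)
      (chartAt (𝔼 n) p).source := by
  have h : ∀ x, (gramMatrix (n := n) p x)⁻¹ i j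
      = ((gramMatrix (n := n) p x).det)⁻¹ * (gramMatrix (n := n) p x).adjugate i j := by
    intro x
    simp [Matrix.inv_def]
  simp_rw [h]
  have hdet : ContMDiffOn (𝓡 n) 𝓘(ℝ, ℝ) ∞ (fun x ↦ ((gramMatrix (n := n) p x).det)⁻¹)
      (chartAt (𝔼 n) p).source := fun x hx ↦
    (contMDiffOn_gramMatrix_det p x hx).inv₀ (gramMatrix_det_pos p hx).ne'
  refine hdet.mul ?_
  simp only [Matrix.adjugate_apply, Matrix.det_apply]
  refine contMDiffOn_finsetSum fun σ _ ↦ ?_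
  simp only [Units.smul_def, zsmul_eq_mul]
  refine contMDiffOn_const.mul (contMDiffOn_finsetProd fun a _ ↦ ?_)
  by_cases h : σ a = j
  · simp only [h, Matrix.updateRow_self]
    exact contMDiffOn_const
  · simp only [Matrix.updateRow_ne h]
    exact contMDiffOn_gramMatrix p _ _

lemma contMDiffOn_divergence_coordFrame (p : M) (k : Fin n) :
    ContMDiffOn (𝓡 n) 𝓘(ℝ, ℝ) ∞ (divergence (coordFrame (n := n) p k))
      (chartAt (𝔼 n) p).source := by
  refine ContMDiffOn.congr ?_ fun x hx ↦ divergence_coordFrame p hx k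
  refine contMDiffOn_const.mul (contMDiffOn_finsetSum fun i _ ↦ contMDiffOn_finsetSum fun j _ ↦ ?_)
  exact (contMDiffOn_gramMatrix_inv p i j).mul
    (contMDiffOn_mvfderiv_coordFrame p le_rfl (contMDiffOn_gramMatrix p i j) (by simp) k)

/-- Jacobi's formula gives `∂ₖ √det g = ½ √det g · tr(g⁻¹ ∂ₖ g)`, and half the trace is the
divergence of `∂ₖ`. This links the trace of the connection with the measure. -/
lemma hasFDerivAt_chartDensity (p : M) {x : M} (hx : x ∈ (chartAt (𝔼 n) p).source) :
    DifferentiableAt ℝ (chartDensity (n := n) p) (chartAt (𝔼 n) p x) ∧ ∀ k,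
    fderiv ℝ (chartDensity (n := n) p) (chartAt (𝔼 n) p x) (EuclideanSpace.basisFun (Fin n) ℝ k)
      = chartDensity (n := n) p (chartAt (𝔼 n) p x) * divergence (coordFrame p k) x := by
  set φ := chartAt (𝔼 n) p with hφ
  have hxx : φ.symm (φ x) = x := φ.left_inv hx
  have hmd : ∀ i j, MDifferentiableAt (𝓡 n) 𝓘(ℝ, ℝ) (fun y ↦ gramMatrix (n := n) p y i j) x :=
    fun i j ↦ ((contMDiffOn_gramMatrix p i j).contMDiffAt
      (φ.open_source.mem_nhds hx)).mdifferentiableAt (by simp)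
  have hd : ∀ i j, DifferentiableAt ℝ (fun y ↦ gramMatrix (n := n) p (φ.symm y) i j) (φ x) := by
    intro i j
    have := contDiffOn_comp_chartAt_symm p le_rfl (contMDiffOn_gramMatrix (n := n) p i j)
    exact (this.contDiffAt (φ.open_target.mem_nhds (φ.map_source hx))).differentiableAt (by simp)
  have hdet := hasFDerivAt_det (A := fun y ↦ gramMatrix (n := n) p (φ.symm y))
    (fun i j ↦ (hd i j).hasFDerivAt)
  have hpos := gramMatrix_det_pos (n := n) p hx
  have hsq := hdet.sqrt (by rw [hxx]; exact hpos.ne')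
  refine ⟨hsq.differentiableAt, fun k ↦ ?_⟩
  have h1 := hsq.fderiv
  change fderiv ℝ (chartDensity (n := n) p) (φ x) = _ at h1
  rw [h1, divergence_coordFrame p hx, chartDensity, ← hφ, hxx]
  simp only [smul_apply, FunLike.coe_sum, Finset.sum_apply, smul_eq_mul]
  have h2 : ∀ i j, fderiv ℝ (fun y ↦ gramMatrix (n := n) p (φ.symm y) i j) (φ x)
      (EuclideanSpace.basisFun (Fin n) ℝ k)
      = mvfderiv (𝓡 n) (fun y ↦ gramMatrix (n := n) p y i j) x (coordFrame p k x) := fun i j ↦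
    (mvfderiv_coordFrame p hx (hmd i j) k).symm
  have h3 : ∀ i j, (gramMatrix (n := n) p x).adjugate j i
      = (gramMatrix (n := n) p x).det * (gramMatrix (n := n) p x)⁻¹ i j := by
    intro i j
    rw [gramMatrix_inv_symm, Matrix.inv_def]
    simp [hpos.ne']
  simp_rw [h2, h3, Finset.mul_sum]
  refine Finset.sum_congr rfl fun i _ ↦ Finset.sum_congr rfl fun j _ ↦ ?_
  have hs0 : 0 < √(gramMatrix (n := n) p x).det := Real.sqrt_pos.2 hpos
  have hs1 : √(gramMatrix (n := n) p x).det * √(gramMatrix (n := n) p x).det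
      = (gramMatrix (n := n) p x).det := Real.mul_self_sqrt hpos.le
  field_simp
  rw [pow_two, hs1]

variable [MeasurableSpace M] [BorelSpace M]

/-- In the chart, the integrand times the density is `∂ₖ(√det g · f)`, the derivative of a compactly
supported `C¹` function on Euclidean space. -/
lemma integral_deriv_add_divergence_coordFrame [T2Space M] (p : M) {f : M → ℂ}
    (hf : ContMDiff (𝓡 n) 𝓘(ℝ, ℂ) 1 f) (hc : HasCompactSupport f)
    (hs : tsupport f ⊆ (chartAt (𝔼 n) p).source) (k : Fin n) :
    ∫ x, (mvfderiv (𝓡 n) f x (coordFrame p k x) + divergence (coordFrame p k) x • f x)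
      ∂(riemannianVolume n M) = 0 := by
  set φ := chartAt (𝔼 n) p with hφ
  have hfs : ∀ x ∉ φ.source, f =ᶠ[𝓝 x] 0 := fun x hx ↦
    notMem_tsupport_iff_eventuallyEq.1 fun h ↦ hx (hs h)
  have hcont : ContinuousOn (fun x ↦ mvfderiv (𝓡 n) f x (coordFrame p k x)
      + divergence (coordFrame p k) x • f x) φ.source :=
    (contMDiffOn_mvfderiv_coordFrame (m := 0) p (k := 1) (by simp) hf.contMDiffOn
      (by simp) k).continuousOn.add
      ((contMDiffOn_divergence_coordFrame p k).continuousOn.smul hf.continuous.continuousOn)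
  rw [integral_riemannianVolume p hcont]
  swap
  · intro x hx
    have h0 : mvfderiv (𝓡 n) f x = 0 := by
      rw [mvfderiv_congr_of_eventuallyEq (hfs x hx)]
      exact mvfderiv_zero
    have h1 : f x = 0 := (hfs x hx).eq_of_nhds
    simp [h0, h1]
  -- The extension by zero is `C¹` on all of Euclidean space: the support of `f` has compact, hence
  -- closed, image inside the chart target.
  set F : 𝔼 n → ℂ := φ.target.indicator fun y ↦ chartDensity p y • f (φ.symm y) with hF
  have hK : IsCompact (φ '' tsupport f) := hc.isCompact.image_of_continuousOn
    (φ.continuousOn.mono hs)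
  have hF0 : ∀ y ∉ φ '' tsupport f, F y = 0 := by
    intro y hy
    by_cases hyt : y ∈ φ.target
    · have : f (φ.symm y) = 0 := by
        by_contra hne
        exact hy ⟨φ.symm y, subset_tsupport f hne, φ.right_inv hyt⟩
      simp [hF, hyt, this]
    · simp [hF, hyt]
  have hFt : ∀ y ∈ φ.target, F =ᶠ[𝓝 y] fun y ↦ chartDensity p y • f (φ.symm y) := by
    intro y hy
    filter_upwards [φ.open_target.mem_nhds hy] with z hz
    simp [hF, hz]
  have hdens : ContDiffOn ℝ 1 (chartDensity (n := n) p) φ.target := by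
    have h1 : ContDiffOn ℝ 1 ((fun x ↦ (gramMatrix (n := n) p x).det) ∘ φ.symm) φ.target :=
      contDiffOn_comp_chartAt_symm p (by simp)
        ((contMDiffOn_gramMatrix_det (n := n) p).of_le (by simp))
    exact h1.sqrt fun y hy ↦ (gramMatrix_det_pos p (φ.map_target hy)).ne'
  have hfc : ContDiffOn ℝ 1 (f ∘ φ.symm) φ.target :=
    contDiffOn_comp_chartAt_symm p (by simp) hf.contMDiffOn
  have hFsm : ContDiff ℝ 1 F := by
    rw [contDiff_iff_contDiffAt]
    intro y
    by_cases hy : y ∈ φ.target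
    · refine ContDiffAt.congr_of_eventuallyEq ?_ (hFt y hy)
      exact (hdens.smul hfc).contDiffAt (φ.open_target.mem_nhds hy)
    · have : F =ᶠ[𝓝 y] fun _ ↦ 0 := by
        have hyK : y ∉ φ '' tsupport f := by
          rintro ⟨x, hx, rfl⟩
          exact hy (φ.map_source (hs hx))
        filter_upwards [hK.isClosed.isOpen_compl.mem_nhds hyK] with z hz
        exact hF0 z hz
      exact contDiffAt_const.congr_of_eventuallyEq this
  have hFc : HasCompactSupport F := HasCompactSupport.intro hK hF0
  set v := EuclideanSpace.basisFun (Fin n) ℝ k with hv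
  have hint : ∫ y, fderiv ℝ F y v = 0 := by
    have hF'c : HasCompactSupport fun y ↦ fderiv ℝ F y v := hFc.fderiv_apply (𝕜 := ℝ) v
    have hF'i : Integrable (fun y ↦ fderiv ℝ F y v) :=
      ((hFsm.continuous_fderiv (by simp)).clm_apply continuous_const).integrable_of_hasCompactSupport hF'c
    have hFi : Integrable F := hFsm.continuous.integrable_of_hasCompactSupport hFc
    -- Integration by parts against the constant function `1`.
    have := integral_mul_fderiv_eq_neg_fderiv_mul_of_integrable (μ := volume) (𝕜 := ℂ)
      (f := fun _ : 𝔼 n ↦ (1 : ℂ)) (g := F) (v := v) (by simp) (by simpa using hF'i)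
      (by simpa using hFi) (fun _ _ ↦ differentiableAt_const _)
      (fun y _ ↦ (hFsm.differentiable (by simp)) y)
    simpa using this
  have hzero : ∀ y ∉ φ.target, fderiv ℝ F y v = 0 := by
    intro y hy
    have hyK : y ∉ tsupport F := by
      intro h
      have h2 : tsupport F ⊆ φ '' tsupport f :=
        closure_minimal (fun z hz ↦ by_contra fun hz' ↦ hz (hF0 z hz')) hK.isClosed
      obtain ⟨x, hx, rfl⟩ := h2 h
      exact hy (φ.map_source (hs hx))
    rw [fderiv_of_notMem_tsupport (𝕜 := ℝ) hyK]
    rfl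
  rw [← hint, ← setIntegral_eq_integral_of_forall_compl_eq_zero hzero]
  refine setIntegral_congr_fun φ.open_target.measurableSet fun y hy ↦ ?_
  have hy' := φ.map_target hy
  obtain ⟨hdd, hdk⟩ := hasFDerivAt_chartDensity (n := n) p hy'
  rw [← hφ, φ.right_inv hy] at hdd hdk
  have hfd : DifferentiableAt ℝ (f ∘ φ.symm) y :=
    (hfc.contDiffAt (φ.open_target.mem_nhds hy)).differentiableAt (by simp)
  have hmf := mvfderiv_coordFrame p hy' (hf.mdifferentiableAt (by simp)) k (x := φ.symm y)
  rw [← hφ, φ.right_inv hy] at hmf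
  change chartDensity p y • (mvfderiv (𝓡 n) f (φ.symm y) (coordFrame p k (φ.symm y))
    + divergence (coordFrame p k) (φ.symm y) • f (φ.symm y)) = fderiv ℝ F y v
  rw [(hFt y hy).fderiv_eq, hmf]
  have hprod := (hdd.hasFDerivAt.smul hfd.hasFDerivAt).fderiv
  have hprod2 : fderiv ℝ (fun y ↦ chartDensity p y • f (φ.symm y)) y v = _ :=
    congrArg (fun L : 𝔼 n →L[ℝ] ℂ ↦ L v) hprod
  rw [hprod2]
  have h5 : chartDensity p y • (fderiv ℝ (f ∘ φ.symm) y v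
      + divergence (coordFrame p k) (φ.symm y) • f (φ.symm y))
      = chartDensity p y • fderiv ℝ (f ∘ φ.symm) y v
        + fderiv ℝ (chartDensity p) y v • f (φ.symm y) := by
    rw [hv, hdk, smul_add, mul_smul]
  exact h5

end Divergence

end ChartDeriv

/-! ### Smooth orthonormal frames and the divergence theorem for general fields. -/

section Frame

variable {n : ℕ} {M : Type*} [TopologicalSpace M] [ChartedSpace (𝔼 n) M]
  [IsManifold (𝓡 n) ∞ M]

/-- The vector field `X` is smooth on `U`. -/
abbrev SmoothFieldOn (X : Π x : M, TangentSpace (𝓡 n) x) (U : Set M) : Prop :=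
  ContMDiffOn (𝓡 n) ((𝓡 n).prod 𝓘(ℝ, 𝔼 n)) ∞ (fun x ↦ TotalSpace.mk' (𝔼 n) x (X x)) U

/-- The vector field `X` is differentiable at `x`. -/
abbrev FieldMDiffAt (X : Π x : M, TangentSpace (𝓡 n) x) (x : M) : Prop :=
  MDifferentiableAt (𝓡 n) ((𝓡 n).prod 𝓘(ℝ, 𝔼 n)) (fun x ↦ TotalSpace.mk' (𝔼 n) x (X x)) x

lemma SmoothFieldOn.mdiffAt {X : Π x : M, TangentSpace (𝓡 n) x} {U : Set M}
    (hX : SmoothFieldOn X U) (hU : IsOpen U) {x : M} (hx : x ∈ U) : FieldMDiffAt X x :=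
  (hX.contMDiffAt (hU.mem_nhds hx)).mdifferentiableAt (by simp)

variable [RiemannianBundle (fun x : M ↦ TangentSpace (𝓡 n) x)]
  [IsContMDiffRiemannianBundle (𝓡 n) ∞ (𝔼 n) (fun x : M ↦ TangentSpace (𝓡 n) x)]

lemma SmoothFieldOn.inner {X Y : Π x : M, TangentSpace (𝓡 n) x} {U : Set M}
    (hX : SmoothFieldOn X U) (hY : SmoothFieldOn Y U) :
    ContMDiffOn (𝓡 n) 𝓘(ℝ, ℝ) ∞ (fun x ↦ (inner ℝ (X x) (Y x) : ℝ)) U :=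
  ContMDiffOn.inner_bundle (IB := 𝓡 n) (F := 𝔼 n) (n := ∞)
    (E := fun x : M ↦ TangentSpace (𝓡 n) x) hX hY

/-- The orthonormal frame obtained from the coordinate frame by the Gram-Schmidt process. -/
def orthoFrame (p : M) (i : Fin n) (x : M) : TangentSpace (𝓡 n) x :=
  InnerProductSpace.gramSchmidtNormed ℝ (fun j ↦ coordFrame p j x) i

lemma linearIndependent_coordFrame (p : M) {x : M} (hx : x ∈ (chartAt (𝔼 n) p).source) :
    LinearIndependent ℝ fun j ↦ coordFrame (n := n) p j x := by
  simp_rw [coordFrame_eq_coordBasis p hx]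
  exact (coordBasis p hx).linearIndependent

/-- Strong induction on the index: each projection is a quotient of smooth functions whose
denominator does not vanish, because the coordinate frame is linearly independent. -/
lemma smoothFieldOn_gramSchmidt (p : M) (i : Fin n) :
    SmoothFieldOn (fun x ↦ InnerProductSpace.gramSchmidt ℝ (fun j ↦ coordFrame p j x) i)
      (chartAt (𝔼 n) p).source := by
  induction i using WellFoundedLT.induction with
  | ind i ih =>
  have h : ∀ x, InnerProductSpace.gramSchmidt ℝ (fun j ↦ coordFrame p j x) i
      = (coordFrame p i - fun x ↦ ∑ j ∈ Finset.Iio i, ((fun x ↦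
        (inner ℝ (InnerProductSpace.gramSchmidt ℝ (fun j ↦ coordFrame p j x) j) (coordFrame p i x)
          / inner ℝ (InnerProductSpace.gramSchmidt ℝ (fun j ↦ coordFrame p j x) j)
            (InnerProductSpace.gramSchmidt ℝ (fun j ↦ coordFrame p j x) j) : ℝ))
        • (fun x ↦ InnerProductSpace.gramSchmidt ℝ (fun j ↦ coordFrame p j x) j)) x) x := by
    intro x
    rw [InnerProductSpace.gramSchmidt_def]
    simp only [Pi.sub_apply, Pi.smul_apply']
    congr 1
    refine Finset.sum_congr rfl fun j _ ↦ ?_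
    rw [Submodule.starProjection_singleton, real_inner_self_eq_norm_sq]
    rfl
  simp_rw [h]
  refine (contMDiffOn_coordFrame p i).sub_section (.sum_section fun j hj ↦ ?_)
  have hj' := ih j (Finset.mem_Iio.1 hj)
  refine ContMDiffOn.smul_section (fun x hx ↦ ?_) hj'
  refine ((hj'.inner (contMDiffOn_coordFrame p i)) x hx).div₀ ((hj'.inner hj') x hx) ?_
  exact inner_self_ne_zero.2 (InnerProductSpace.gramSchmidt_ne_zero (𝕜 := ℝ) j
    (linearIndependent_coordFrame p hx))

lemma smoothFieldOn_orthoFrame (p : M) (i : Fin n) :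
    SmoothFieldOn (orthoFrame (n := n) p i) (chartAt (𝔼 n) p).source := by
  have h := smoothFieldOn_gramSchmidt (n := n) p i
  have hsq : ContMDiffOn (𝓡 n) 𝓘(ℝ, ℝ) ∞ (fun x ↦ ‖InnerProductSpace.gramSchmidt ℝ
      (fun j ↦ coordFrame (n := n) p j x) i‖⁻¹) (chartAt (𝔼 n) p).source := by
    intro x hx
    have hne := InnerProductSpace.gramSchmidt_ne_zero (𝕜 := ℝ) i (linearIndependent_coordFrame p hx)
    have h1 := (h.inner h) x hx
    have h2 : ContMDiffWithinAt (𝓡 n) 𝓘(ℝ, ℝ) ∞ (fun x ↦ Real.sqrt (inner ℝ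
      (InnerProductSpace.gramSchmidt ℝ (fun j ↦ coordFrame (n := n) p j x) i)
      (InnerProductSpace.gramSchmidt ℝ (fun j ↦ coordFrame (n := n) p j x) i)))
      (chartAt (𝔼 n) p).source x :=
      (Real.contDiffAt_sqrt (inner_self_ne_zero.2 hne)).contMDiffAt.comp_contMDiffWithinAt x h1
    have h3 := h2.inv₀ (Real.sqrt_ne_zero'.2 (real_inner_self_pos.2 hne))
    refine h3.congr (fun y hy ↦ ?_) ?_ <;> rw [norm_eq_sqrt_real_inner]
  exact hsq.smul_section h

/-- The orthonormal frame of the chart at `p`, as an orthonormal basis of the tangent space. -/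
def orthoBasis (p : M) {x : M} (hx : x ∈ (chartAt (𝔼 n) p).source) :
    OrthonormalBasis (Fin n) ℝ (TangentSpace (𝓡 n) x) :=
  OrthonormalBasis.mk (v := fun i ↦ orthoFrame p i x)
    (InnerProductSpace.gramSchmidtNormed_orthonormal (linearIndependent_coordFrame p hx)) (by
      have h1 := InnerProductSpace.span_gramSchmidtNormed_range (𝕜 := ℝ)
        (fun j ↦ coordFrame (n := n) p j x)
      have h2 : Submodule.span ℝ (Set.range fun j ↦ coordFrame (n := n) p j x) = ⊤ := by
        simp_rw [coordFrame_eq_coordBasis p hx]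
        exact (coordBasis p hx).span_eq
      rw [InnerProductSpace.span_gramSchmidt, h2] at h1
      exact h1.ge)

lemma orthoBasis_apply (p : M) {x : M} (hx : x ∈ (chartAt (𝔼 n) p).source) (i : Fin n) :
    orthoBasis p hx i = orthoFrame p i x := by
  exact congrFun (OrthonormalBasis.coe_mk _ _) i

lemma inner_orthoFrame (p : M) {x : M} (hx : x ∈ (chartAt (𝔼 n) p).source) (i j : Fin n) :
    (inner ℝ (orthoFrame p i x) (orthoFrame p j x) : ℝ) = if i = j then 1 else 0 := by
  rw [← orthoBasis_apply p hx, ← orthoBasis_apply p hx]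
  exact orthonormal_iff_ite.1 (orthoBasis p hx).orthonormal i j

lemma mdiffAt_orthoFrame (p : M) {x : M} (hx : x ∈ (chartAt (𝔼 n) p).source) (i : Fin n) :
    FieldMDiffAt (orthoFrame (n := n) p i) x :=
  (smoothFieldOn_orthoFrame p i).mdiffAt (chartAt (𝔼 n) p).open_source hx

lemma mvfderiv_metricFun_orthoFrame (p : M) {x : M} (hx : x ∈ (chartAt (𝔼 n) p).source)
    (i j : Fin n) : mvfderiv (𝓡 n) (metricFun (orthoFrame p i) (orthoFrame (n := n) p j)) x = 0 := by
  have h : metricFun (orthoFrame p i) (orthoFrame (n := n) p j) =ᶠ[𝓝 x]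
      fun _ ↦ if i = j then 1 else 0 := by
    filter_upwards [(chartAt (𝔼 n) p).open_source.mem_nhds hx] with y hy
    exact inner_orthoFrame p hy i j
  rw [mvfderiv_congr_of_eventuallyEq h]
  exact mvfderiv_const _

/-- The inner products of frame fields are locally constant, so metric compatibility makes the
connection form antisymmetric. -/
lemma inner_leviCivita_orthoFrame_swap (p : M) {x : M} (hx : x ∈ (chartAt (𝔼 n) p).source)
    (v : TangentSpace (𝓡 n) x) (i j : Fin n) :
    (inner ℝ (leviCivita (orthoFrame p i) x v) (orthoFrame p j x) : ℝ)
      = - inner ℝ (orthoFrame p i x) (leviCivita (orthoFrame p j) x v) := by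
  have hX : FieldMDiffAt (FiberBundle.extend (𝔼 n) v) x := FiberBundle.mdifferentiableAt_extend ..
  have h := leviCivita_metric hX (mdiffAt_orthoFrame p hx i) (mdiffAt_orthoFrame p hx j)
  rw [mvfderiv_metricFun_orthoFrame p hx] at h
  have hv : FiberBundle.extend (𝔼 n) v x = v := by simp
  rw [hv] at h
  have h' : (0 : ℝ) = _ := h
  linarith

lemma divergence_eq_sum (p : M) {x : M} (hx : x ∈ (chartAt (𝔼 n) p).source)
    (X : Π x : M, TangentSpace (𝓡 n) x) : divergence X x
      = ∑ i, inner ℝ (orthoFrame p i x) (leviCivita X x (orthoFrame p i x)) := by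
  rw [divergence, LinearMap.trace_eq_sum_inner _ (orthoBasis p hx)]
  simp_rw [orthoBasis_apply]
  rfl

/-- Pairing with `eₖ` and using antisymmetry turns `∑ ⟨∇_{eᵢ} eᵢ, eₖ⟩` into `-∑ ⟨eᵢ, ∇_{eᵢ} eₖ⟩`,
minus a trace. In Green's formula this trades the connection terms for divergences. -/
lemma sum_leviCivita_orthoFrame (p : M) {x : M} (hx : x ∈ (chartAt (𝔼 n) p).source) :
    ∑ i, leviCivita (orthoFrame p i) x (orthoFrame p i x)
      = - ∑ j, divergence (orthoFrame p j) x • orthoFrame (n := n) p j x := by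
  refine InnerProductSpace.ext_inner_right_basis (orthoBasis p hx).toBasis fun k ↦ ?_
  simp only [OrthonormalBasis.coe_toBasis, orthoBasis_apply, inner_neg_left, sum_inner,
    inner_smul_left, inner_orthoFrame p hx, divergence_eq_sum p hx]
  simp only [inner_leviCivita_orthoFrame_swap p hx]
  simp

/-- For an orthonormal frame only the brackets survive in Koszul's formula, and brackets of smooth
fields are smooth. This is how smoothness of the Levi-Civita connection enters. -/
lemma contMDiffOn_inner_leviCivita_orthoFrame (p : M) (i j k : Fin n) :
    ContMDiffOn (𝓡 n) 𝓘(ℝ, ℝ) ∞ (fun x ↦ (inner ℝ (leviCivita (orthoFrame p i) x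
      (orthoFrame p j x)) (orthoFrame p k x) : ℝ)) (chartAt (𝔼 n) p).source := by
  have hbr : ∀ a b, SmoothFieldOn (VectorField.mlieBracket (𝓡 n) (orthoFrame (n := n) p a)
      (orthoFrame p b)) (chartAt (𝔼 n) p).source := by
    intro a b x hx
    refine ContMDiffAt.contMDiffWithinAt ?_
    have ha := (smoothFieldOn_orthoFrame (n := n) p a).contMDiffAt
      ((chartAt (𝔼 n) p).open_source.mem_nhds hx)
    have hb := (smoothFieldOn_orthoFrame (n := n) p b).contMDiffAt
      ((chartAt (𝔼 n) p).open_source.mem_nhds hx)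
    have : IsManifold (𝓡 n) (minSmoothness ℝ 2) M := by
      rw [minSmoothness_of_isRCLikeNormedField]
      exact .of_le (n := ∞) ENat.LEInfty.out
    have : IsManifold (𝓡 n) ((⊤ : ℕ∞) + 1) M := by simpa using ‹IsManifold (𝓡 n) ∞ M›
    exact ContMDiffAt.mlieBracket_vectorField (m := ⊤) (n := ⊤) ha hb (by
      rw [minSmoothness_of_isRCLikeNormedField]; simp)
  have hk : ∀ x ∈ (chartAt (𝔼 n) p).source, (inner ℝ (leviCivita (orthoFrame p i) x
      (orthoFrame p j x)) (orthoFrame p k x) : ℝ) = (1 / 2 : ℝ) *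
      (inner ℝ (VectorField.mlieBracket (𝓡 n) (orthoFrame p j) (orthoFrame p i) x)
          (orthoFrame (n := n) p k x)
        - inner ℝ (VectorField.mlieBracket (𝓡 n) (orthoFrame p j) (orthoFrame p k) x)
          (orthoFrame (n := n) p i x)
        - inner ℝ (VectorField.mlieBracket (𝓡 n) (orthoFrame p i) (orthoFrame p k) x)
          (orthoFrame (n := n) p j x)) := by
    intro x hx
    refine (inner_leviCivitaFun (mdiffAt_orthoFrame p hx i) (mdiffAt_orthoFrame p hx j)
      (mdiffAt_orthoFrame p hx k)).trans ?_
    rw [koszulForm, mvfderiv_metricFun_orthoFrame p hx, mvfderiv_metricFun_orthoFrame p hx,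
      mvfderiv_metricFun_orthoFrame p hx]
    simp [metricFun]
  refine ContMDiffOn.congr ?_ hk
  refine contMDiffOn_const.mul ((ContMDiffOn.sub ?_ ?_).sub ?_)
  · exact (hbr _ _).inner (smoothFieldOn_orthoFrame p _)
  · exact (hbr _ _).inner (smoothFieldOn_orthoFrame p _)
  · exact (hbr _ _).inner (smoothFieldOn_orthoFrame p _)

lemma covariantDerivative_sum {F : Type*} [NormedAddCommGroup F] [NormedSpace ℝ F]
    {V : M → Type*} [TopologicalSpace (TotalSpace F V)] [∀ x, AddCommGroup (V x)]
    [∀ x, Module ℝ (V x)] [∀ x, TopologicalSpace (V x)] [∀ x, IsTopologicalAddGroup (V x)]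
    [∀ x, ContinuousSMul ℝ (V x)] [FiberBundle F V] [VectorBundle ℝ F V]
    (cov : CovariantDerivative (𝓡 n) F V) {ι : Type*} (s : Finset ι) {σ : ι → Π x : M, V x} {x : M}
    (hσ : ∀ i, MDifferentiableAt (𝓡 n) ((𝓡 n).prod 𝓘(ℝ, F))
      (fun y ↦ TotalSpace.mk' F y (σ i y)) x) :
    cov (∑ i ∈ s, σ i) x = ∑ i ∈ s, cov (σ i) x := by
  classical
  induction s using Finset.induction_on with
  | empty => simp [cov.zero]
  | insert a s ha ih =>
    rw [Finset.sum_insert ha, Finset.sum_insert ha, ← ih]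
    refine cov.isCovariantDerivativeOnUniv.add (hσ a) ?_
    have := MDifferentiableAt.sum_section (s := s) (t := σ) fun i _ ↦ hσ i
    simpa only [Finset.sum_apply] using this

/-- The coefficients are `∑ⱼ g^{kj} ⟨X, ∂ⱼ⟩`, visibly smooth. -/
lemma exists_coordFrame_coeff (p : M) {X : Π x : M, TangentSpace (𝓡 n) x}
    (hX : SmoothFieldOn X (chartAt (𝔼 n) p).source) :
    ∃ a : Fin n → M → ℝ,
      (∀ k, ContMDiffOn (𝓡 n) 𝓘(ℝ, ℝ) ∞ (a k) (chartAt (𝔼 n) p).source) ∧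
      ∀ x ∈ (chartAt (𝔼 n) p).source, X x = ∑ k, a k x • coordFrame p k x := by
  refine ⟨fun k x ↦ ∑ j, (gramMatrix (n := n) p x)⁻¹ k j * inner ℝ (X x) (coordFrame p j x),
    fun k ↦ contMDiffOn_finsetSum fun j _ ↦ (contMDiffOn_gramMatrix_inv p k j).mul
      (hX.inner (contMDiffOn_coordFrame p j)), fun x hx ↦ ?_⟩
  have hb : ∀ i, coordFrame p i x = coordBasis p hx i := coordFrame_eq_coordBasis p hx
  have hdet : IsUnit (gramMatrix (n := n) p x).det := (gramMatrix_det_pos p hx).ne'.isUnit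
  refine InnerProductSpace.ext_inner_right_basis (coordBasis p hx) fun i ↦ ?_
  rw [← hb, sum_inner]
  simp only [inner_smul_left, RCLike.conj_to_real]
  have hG : ∀ k, (inner ℝ (coordFrame p k x) (coordFrame p i x) : ℝ) = gramMatrix p x k i :=
    fun k ↦ rfl
  simp_rw [hG, Finset.sum_mul]
  rw [Finset.sum_comm]
  have h1 : ∀ j, ∑ k, (gramMatrix (n := n) p x)⁻¹ k j * inner ℝ (X x) (coordFrame p j x)
      * gramMatrix (n := n) p x k i
      = inner ℝ (X x) (coordFrame p j x) * (((gramMatrix (n := n) p x)⁻¹ * gramMatrix (n := n) p x : Matrix (Fin n) (Fin n) ℝ) j i) := by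
    intro j
    rw [Matrix.mul_apply, Finset.mul_sum]
    refine Finset.sum_congr rfl fun k _ ↦ ?_
    rw [gramMatrix_inv_symm p x k j]
    ring
  simp_rw [h1, Matrix.nonsing_inv_mul _ hdet, Matrix.one_apply]
  simp

/-- The Leibniz rule for `∇(a ∂ₖ)`; the derivative of `a` contributes the rank-one map `da ⊗ ∂ₖ`,
whose trace is `da(∂ₖ)`. -/
lemma divergence_sum_smul_coordFrame (p : M) {X : Π x : M, TangentSpace (𝓡 n) x}
    (hX : SmoothFieldOn X (chartAt (𝔼 n) p).source) {a : Fin n → M → ℝ}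
    (ha : ∀ k, ContMDiffOn (𝓡 n) 𝓘(ℝ, ℝ) ∞ (a k) (chartAt (𝔼 n) p).source)
    (haX : ∀ x ∈ (chartAt (𝔼 n) p).source, X x = ∑ k, a k x • coordFrame p k x)
    {x : M} (hx : x ∈ (chartAt (𝔼 n) p).source) :
    divergence X x = ∑ k, (a k x * divergence (coordFrame p k) x
      + mvfderiv (𝓡 n) (a k) x (coordFrame p k x)) := by
  have hnhd := (chartAt (𝔼 n) p).open_source.mem_nhds hx
  have had : ∀ k, MDifferentiableAt (𝓡 n) 𝓘(ℝ, ℝ) (a k) x := fun k ↦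
    ((ha k).contMDiffAt hnhd).mdifferentiableAt (by simp)
  have hs : ∀ k, FieldMDiffAt (a k • coordFrame p k) x := fun k ↦
    (had k).smul_section (mdifferentiableAt_coordFrame p hx k)
  have hsum : FieldMDiffAt (∑ k, a k • coordFrame p k) x := by
    have := MDifferentiableAt.sum_section (s := Finset.univ) (t := fun k ↦ a k • coordFrame p k)
      fun i _ ↦ hs i
    rw [FieldMDiffAt]
    simpa only [Finset.sum_apply] using this
  have hcong : leviCivita X x = leviCivita (∑ k, a k • coordFrame p k) x := by
    refine leviCivita.isCovariantDerivativeOnUniv.congr_of_eventuallyEq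
      (hX.mdiffAt (chartAt (𝔼 n) p).open_source hx) hsum Filter.univ_mem ?_
    filter_upwards [hnhd] with y hy
    rw [haX y hy]
    simp
  rw [divergence, hcong, covariantDerivative_sum leviCivita _ hs]
  have hL : ∀ k, leviCivita (a k • coordFrame p k) x = a k x • leviCivita (coordFrame p k) x
      + (mvfderiv (𝓡 n) (a k) x).smulRight (coordFrame p k x) := fun k ↦
    leviCivita.isCovariantDerivativeOnUniv.leibniz (mdifferentiableAt_coordFrame p hx k) (had k)
  simp_rw [hL]
  have hcoe : ((∑ k, (a k x • leviCivita (coordFrame p k) x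
      + (mvfderiv (𝓡 n) (a k) x).smulRight (coordFrame p k x)) :
        TangentSpace (𝓡 n) x →L[ℝ] TangentSpace (𝓡 n) x)).toLinearMap
      = ∑ k, (a k x • (leviCivita (coordFrame p k) x).toLinearMap
        + (mvfderiv (𝓡 n) (a k) x).toLinearMap.smulRight (coordFrame p k x)) := by
    ext v
    simp
  rw [hcoe, map_sum]
  refine Finset.sum_congr rfl fun k _ ↦ ?_
  rw [map_add, map_smul, LinearMap.trace_smulRight]
  rfl

lemma contMDiffOn_mvfderiv (p : M) {G : Type*} [NormedAddCommGroup G] [NormedSpace ℝ G]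
    {X : Π x : M, TangentSpace (𝓡 n) x}
    (hX : SmoothFieldOn X (chartAt (𝔼 n) p).source) {f : M → G} {m k : ℕ∞ω}
    (hk : k ≤ (∞ : ℕ∞ω)) (hf : ContMDiffOn (𝓡 n) 𝓘(ℝ, G) k f (chartAt (𝔼 n) p).source)
    (hmk : m + 1 ≤ k) :
    ContMDiffOn (𝓡 n) 𝓘(ℝ, G) m (fun x ↦ mvfderiv (𝓡 n) f x (X x)) (chartAt (𝔼 n) p).source := by
  obtain ⟨a, ha, haX⟩ := exists_coordFrame_coeff p hX
  have h : ContMDiffOn (𝓡 n) 𝓘(ℝ, G) m (fun x ↦ ∑ i, a i x • mvfderiv (𝓡 n) f x (coordFrame p i x))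
      (chartAt (𝔼 n) p).source :=
    contMDiffOn_finsetSum fun i _ ↦ ((ha i).of_le ((le_self_add.trans hmk).trans hk)).smul
      (contMDiffOn_mvfderiv_coordFrame p hk hf hmk i)
  refine h.congr fun x hx ↦ ?_
  rw [haX x hx, map_sum]
  simp_rw [map_smul]

lemma contMDiffOn_divergence (p : M) {X : Π x : M, TangentSpace (𝓡 n) x}
    (hX : SmoothFieldOn X (chartAt (𝔼 n) p).source) :
    ContMDiffOn (𝓡 n) 𝓘(ℝ, ℝ) ∞ (divergence X) (chartAt (𝔼 n) p).source := by
  obtain ⟨a, ha, haX⟩ := exists_coordFrame_coeff p hX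
  refine ContMDiffOn.congr ?_ fun x hx ↦ divergence_sum_smul_coordFrame p hX ha haX hx
  exact contMDiffOn_finsetSum fun k _ ↦ ((ha k).mul (contMDiffOn_divergence_coordFrame p k)).add
    (contMDiffOn_mvfderiv_coordFrame p le_rfl (ha k) (by simp) k)

variable [MeasurableSpace M] [BorelSpace M] [T2Space M]

lemma contMDiff_of_tsupport_subset_source {G : Type*} [NormedAddCommGroup G] [NormedSpace ℝ G]
    {f : M → G} {U : Set M} (hU : IsOpen U) {k : ℕ∞ω}
    (hf : ContMDiffOn (𝓡 n) 𝓘(ℝ, G) k f U) (hs : tsupport f ⊆ U) :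
    ContMDiff (𝓡 n) 𝓘(ℝ, G) k f :=
  contMDiff_of_tsupport fun _ hx ↦ hf.contMDiffAt (hU.mem_nhds (hs hx))

lemma mvfderiv_eq_zero_of_notMem_tsupport {G : Type*} [NormedAddCommGroup G] [NormedSpace ℝ G]
    {f : M → G} {x : M} (hx : x ∉ tsupport f) : mvfderiv (𝓡 n) f x = 0 := by
  rw [mvfderiv_congr_of_eventuallyEq (notMem_tsupport_iff_eventuallyEq.1 hx)]
  exact mvfderiv_zero

/-- `X` is controlled only on the chart domain, but the function vanishes off the support of `f`,
which lies in that domain. -/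
lemma continuous_deriv_add_divergence (p : M) {X : Π x : M, TangentSpace (𝓡 n) x}
    (hX : SmoothFieldOn X (chartAt (𝔼 n) p).source) {f : M → ℂ}
    (hf : ContMDiff (𝓡 n) 𝓘(ℝ, ℂ) 1 f) (hs : tsupport f ⊆ (chartAt (𝔼 n) p).source) :
    Continuous fun x ↦ mvfderiv (𝓡 n) f x (X x) + divergence X x • f x := by
  have h1 : ContMDiffOn (𝓡 n) 𝓘(ℝ, ℂ) 0 (fun x ↦ mvfderiv (𝓡 n) f x (X x))
      (chartAt (𝔼 n) p).source :=
    contMDiffOn_mvfderiv (k := 1) p hX (by simp) hf.contMDiffOn (by simp)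
  have h2 : ContMDiffOn (𝓡 n) 𝓘(ℝ, ℂ) 0 (fun x ↦ divergence X x • f x)
      (chartAt (𝔼 n) p).source :=
    ((contMDiffOn_divergence p hX).of_le (by simp)).smul (hf.of_le (by simp)).contMDiffOn
  refine (contMDiff_of_tsupport_subset_source (n := n) (k := 0)
    (chartAt (𝔼 n) p).open_source (h1.add h2) ?_).continuous
  refine (closure_minimal (fun x hx ↦ ?_) (isClosed_tsupport f)).trans hs
  by_contra hx'
  refine hx ?_
  change mvfderiv (𝓡 n) f x (X x) + divergence X x • f x = 0
  rw [mvfderiv_eq_zero_of_notMem_tsupport hx', image_eq_zero_of_notMem_tsupport hx']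
  simp

lemma integrable_deriv_add_divergence (p : M) {X : Π x : M, TangentSpace (𝓡 n) x}
    (hX : SmoothFieldOn X (chartAt (𝔼 n) p).source) {f : M → ℂ}
    (hf : ContMDiff (𝓡 n) 𝓘(ℝ, ℂ) 1 f) (hc : HasCompactSupport f)
    (hs : tsupport f ⊆ (chartAt (𝔼 n) p).source) :
    Integrable (fun x ↦ mvfderiv (𝓡 n) f x (X x) + divergence X x • f x)
      (riemannianVolume n M) := by
  refine (continuous_deriv_add_divergence p hX hf hs).integrable_of_hasCompactSupport ?_
  refine HasCompactSupport.intro hc fun x hx ↦ ?_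
  simp only [mvfderiv_eq_zero_of_notMem_tsupport hx, image_eq_zero_of_notMem_tsupport hx]
  simp

/-- Both sides are the divergence of `f X`. The coefficients of `X` are moved into the test
function, which reduces the divergence theorem to coordinate fields. -/
lemma deriv_add_divergence_eq_sum (p : M) {X : Π x : M, TangentSpace (𝓡 n) x}
    (hX : SmoothFieldOn X (chartAt (𝔼 n) p).source) {a : Fin n → M → ℝ}
    (ha : ∀ k, ContMDiffOn (𝓡 n) 𝓘(ℝ, ℝ) ∞ (a k) (chartAt (𝔼 n) p).source)
    (haX : ∀ x ∈ (chartAt (𝔼 n) p).source, X x = ∑ k, a k x • coordFrame p k x)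
    {x : M} (hx : x ∈ (chartAt (𝔼 n) p).source) {f : M → ℂ}
    (hf : MDifferentiableAt (𝓡 n) 𝓘(ℝ, ℂ) f x) :
    mvfderiv (𝓡 n) f x (X x) + divergence X x • f x
      = ∑ k, (mvfderiv (𝓡 n) (fun x ↦ a k x • f x) x (coordFrame p k x)
        + divergence (coordFrame p k) x • (a k x • f x)) := by
  have hprod : ∀ k, mvfderiv (𝓡 n) (fun x ↦ a k x • f x) x (coordFrame p k x)
      = a k x • mvfderiv (𝓡 n) f x (coordFrame p k x)
        + mvfderiv (𝓡 n) (a k) x (coordFrame p k x) • f x := by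
    intro k
    have had : MDifferentiableAt (𝓡 n) 𝓘(ℝ, ℝ) (a k) x :=
      ((ha k).contMDiffAt ((chartAt (𝔼 n) p).open_source.mem_nhds hx)).mdifferentiableAt (by simp)
    exact congrArg (fun L : TangentSpace (𝓡 n) x →L[ℝ] ℂ ↦ L (coordFrame p k x))
      (mvfderiv_smul had hf)
  simp only [hprod, divergence_sum_smul_coordFrame p hX ha haX hx, Finset.sum_smul]
  rw [haX x hx, map_sum, ← Finset.sum_add_distrib]
  refine Finset.sum_congr rfl fun k _ ↦ ?_
  rw [map_smul]
  module

/-- The divergence theorem for a vector field which is smooth on a chart domain containing the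
support of `f`. -/
lemma integral_deriv_add_divergence (p : M) {X : Π x : M, TangentSpace (𝓡 n) x}
    (hX : SmoothFieldOn X (chartAt (𝔼 n) p).source) {f : M → ℂ}
    (hf : ContMDiff (𝓡 n) 𝓘(ℝ, ℂ) 1 f) (hc : HasCompactSupport f)
    (hs : tsupport f ⊆ (chartAt (𝔼 n) p).source) :
    ∫ x, (mvfderiv (𝓡 n) f x (X x) + divergence X x • f x) ∂(riemannianVolume n M) = 0 := by
  obtain ⟨a, ha, haX⟩ := exists_coordFrame_coeff p hX
  have hts : ∀ k, tsupport (fun x ↦ a k x • f x) ⊆ tsupport f := fun k ↦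
    tsupport_smul_subset_right (a k) f
  have haf : ∀ k, ContMDiff (𝓡 n) 𝓘(ℝ, ℂ) 1 (fun x ↦ a k x • f x) := by
    intro k
    have h1 : ContMDiffOn (𝓡 n) 𝓘(ℝ, ℝ) 1 (a k) (chartAt (𝔼 n) p).source :=
      (ha k).of_le (by simp)
    have h2 : ContMDiffOn (𝓡 n) 𝓘(ℝ, ℂ) 1 (fun x ↦ a k x • f x) (chartAt (𝔼 n) p).source :=
      h1.smul hf.contMDiffOn
    exact contMDiff_of_tsupport_subset_source (chartAt (𝔼 n) p).open_source h2 ((hts k).trans hs)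
  have hafc : ∀ k, HasCompactSupport (fun x ↦ a k x • f x) := fun k ↦
    hc.of_isClosed_subset (isClosed_tsupport _) (hts k)
  let G : Fin n → M → ℂ := fun k x ↦ mvfderiv (𝓡 n) (fun x ↦ a k x • f x) x (coordFrame p k x)
        + divergence (coordFrame p k) x • (a k x • f x)
  have hk : ∀ k, ∫ x, G k x ∂(riemannianVolume n M) = 0 := fun k ↦
    integral_deriv_add_divergence_coordFrame p (haf k) (hafc k) ((hts k).trans hs) k
  have hint : ∀ k, Integrable (G k) (riemannianVolume n M) := fun k ↦
    integrable_deriv_add_divergence p (contMDiffOn_coordFrame p k) (haf k)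
      (hafc k) ((hts k).trans hs)
  have hsum : ∫ x, ∑ k, G k x ∂(riemannianVolume n M) = 0 := by
    rw [integral_finsetSum _ fun k _ ↦ hint k]
    exact Finset.sum_eq_zero fun k _ ↦ hk k
  refine Eq.trans (integral_congr_ae (.of_forall fun x ↦ ?_)) hsum
  change mvfderiv (𝓡 n) f x (X x) + divergence X x • f x = ∑ k, G k x
  by_cases hx : x ∈ tsupport f
  · exact deriv_add_divergence_eq_sum p hX ha haX (hs hx) (hf.mdifferentiableAt (by simp))
  · have h0 : ∀ k, mvfderiv (𝓡 n) (fun x ↦ a k x • f x) x = 0 := fun k ↦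
      mvfderiv_eq_zero_of_notMem_tsupport fun h ↦ hx (hts k h)
    simp only [G, h0, mvfderiv_eq_zero_of_notMem_tsupport hx, image_eq_zero_of_notMem_tsupport hx]
    simp

end Frame

/-! ### Smoothness and pointwise calculus of sections, their gradients and Hessians. -/

section Sections

/-- The Hilbert-Schmidt product and `trHess` are defined with `stdOrthonormalBasis`, chosen point by
point with no regularity. Independence of the basis lets the smooth frame `orthoFrame` replace it.
-/
lemma sum_orthonormal_eq {T G : Type*} [NormedAddCommGroup T] [InnerProductSpace ℝ T]
    [AddCommGroup G] [Module ℝ G] {ι κ : Type*} [Fintype ι] [Fintype κ]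
    (e : OrthonormalBasis ι ℝ T) (b : OrthonormalBasis κ ℝ T) (K : T →ₗ[ℝ] T →ₗ[ℝ] G) :
    ∑ i, K (e i) (e i) = ∑ j, K (b j) (b j) := by
  classical
  have he : ∀ i, e i = ∑ j, (inner ℝ (b j) (e i) : ℝ) • b j := fun i ↦ (b.sum_repr' (e i)).symm
  have h1 : ∀ i, K (e i) (e i)
      = ∑ j, ∑ k, ((inner ℝ (b j) (e i) : ℝ) * inner ℝ (e i) (b k)) • K (b j) (b k) := by
    intro i
    conv_lhs => rw [he i]
    simp only [map_sum, map_smul, LinearMap.coe_sum, Finset.sum_apply, LinearMap.smul_apply,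
      Finset.smul_sum, smul_smul]
    rw [Finset.sum_comm]
    refine Finset.sum_congr rfl fun j _ ↦ Finset.sum_congr rfl fun k _ ↦ ?_
    rw [real_inner_comm (e i) (b k), mul_comm]
  simp_rw [h1]
  rw [Finset.sum_comm]
  refine Finset.sum_congr rfl fun j _ ↦ ?_
  rw [Finset.sum_comm]
  simp_rw [← Finset.sum_smul, e.sum_inner_mul_inner, orthonormal_iff_ite.1 b.orthonormal]
  simp

variable {n : ℕ} {M : Type*} [TopologicalSpace M] [ChartedSpace (𝔼 n) M]
  [IsManifold (𝓡 n) ∞ M] [SecondCountableTopology M] [MeasurableSpace M] [BorelSpace M]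
  [RiemannianBundle (fun x : M ↦ TangentSpace (𝓡 n) x)]
  [IsContMDiffRiemannianBundle (𝓡 n) ∞ (𝔼 n) (fun x : M ↦ TangentSpace (𝓡 n) x)]
  {F : Type*} [NormedAddCommGroup F] [NormedSpace ℂ F] [FiniteDimensional ℂ F]
  {V : M → Type*} [TopologicalSpace (TotalSpace F V)] [∀ x, NormedAddCommGroup (V x)]
  [∀ x, InnerProductSpace ℂ (V x)] [FiberBundle F V] [VectorBundle ℂ F V] [VectorBundle ℝ F V]
  [ContMDiffVectorBundle ∞ F V (𝓡 n)] [IsSmoothHermitianBundle n F V]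

variable (n F) in
/-- The section `s` is smooth on `U`. -/
abbrev SmoothSectionOn (s : Π x : M, V x) (U : Set M) : Prop :=
  ContMDiffOn (𝓡 n) ((𝓡 n).prod 𝓘(ℝ, F)) ∞ (fun x ↦ TotalSpace.mk' F x (s x)) U

lemma SmoothSectionOn.mdiffAt {s : Π x : M, V x} {U : Set M} (hs : SmoothSectionOn n F s U)
    (hU : IsOpen U) {x : M} (hx : x ∈ U) : SectionMDiffAt n F s x :=
  (hs.contMDiffAt (hU.mem_nhds hx)).mdifferentiableAt (by simp)

lemma SmoothSectionOn.inner {s t : Π x : M, V x} {U : Set M} (hs : SmoothSectionOn n F s U)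
    (ht : SmoothSectionOn n F t U) :
    ContMDiffOn (𝓡 n) 𝓘(ℝ, ℂ) ∞ (fun x ↦ (inner ℂ (s x) (t x) : ℂ)) U := by
  obtain ⟨h, hh, hinner⟩ := IsSmoothHermitianBundle.exists_contMDiff (n := n) (F := F) (V := V)
  have h3 := ContMDiffOn.clm_bundle_apply₂ (F₁ := F) (F₂ := F) (F₃ := ℂ)
    (E₃ := Bundle.Trivial M ℂ) hh.contMDiffOn hs ht
  intro x hx
  have h4 := h3 x hx
  rw [Bundle.contMDiffWithinAt_section] at h4
  simp_rw [hinner]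
  exact h4

lemma SmoothSectionOn.smul {s : Π x : M, V x} {U : Set M} {f : M → ℝ}
    (hf : ContMDiffOn (𝓡 n) 𝓘(ℝ, ℝ) ∞ f U) (hs : SmoothSectionOn n F s U) :
    SmoothSectionOn n F (fun x ↦ f x • s x) U :=
  hf.smul_section hs

lemma SmoothSectionOn.sum {ι : Type*} {t : Finset ι} {s : ι → Π x : M, V x} {U : Set M}
    (hs : ∀ i, SmoothSectionOn n F (s i) U) : SmoothSectionOn n F (fun x ↦ ∑ i ∈ t, s i x) U :=
  ContMDiffOn.sum_section fun i _ ↦ hs i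

/-- Multiplication by a smooth function supported in `U` extends a section by zero. -/
lemma smul_mem_smoothSections {s : Π x : M, V x} {U : Set M} {f : M → ℝ}
    (hf : ContMDiff (𝓡 n) 𝓘(ℝ, ℝ) ∞ f) (hU : IsOpen U) (hfU : tsupport f ⊆ U)
    (hs : SmoothSectionOn n F s U) :
    (fun x ↦ f x • s x) ∈ HermitianConnection.smoothSections n F V :=
  ContMDiffOn.smul_section_of_tsupport hf.contMDiffOn hU hfU hs

lemma smul_mem_smoothSections' {s : Π x : M, V x} {f : M → ℝ}
    (hf : ContMDiff (𝓡 n) 𝓘(ℝ, ℝ) ∞ f) (hs : s ∈ HermitianConnection.smoothSections n F V) :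
    (fun x ↦ f x • s x) ∈ HermitianConnection.smoothSections n F V :=
  ContMDiff.smul_section hf hs

lemma contMDiffOn_apply_field {A : Π x : M, TangentSpace (𝓡 n) x →L[ℝ] V x}
    {X : Π x : M, TangentSpace (𝓡 n) x} {U : Set M}
    (hA : ContMDiffOn (𝓡 n) ((𝓡 n).prod 𝓘(ℝ, 𝔼 n →L[ℝ] F)) ∞
      (fun x ↦ TotalSpace.mk' (𝔼 n →L[ℝ] F) x (A x)) U) (hX : SmoothFieldOn X U) :
    SmoothSectionOn n F (fun x ↦ A x (X x)) U :=
  ContMDiffOn.clm_bundle_apply (F₁ := 𝔼 n) (F₂ := F) hA hX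

variable (D : HermitianConnection n F V)
namespace HermitianConnection

lemma grad_real_smul {u : Π x : M, V x} {f : M → ℝ} {x : M} (hu : SectionMDiffAt n F u x)
    (hf : MDifferentiableAt (𝓡 n) 𝓘(ℝ, ℝ) f x) :
    D.grad (fun y ↦ f y • u y) x
      = f x • D.grad u x + (mvfderiv (𝓡 n) f x).smulRight (u x) :=
  D.isCovariantDerivativeOnUniv.leibniz hu hf

lemma grad_congr {u v : Π x : M, V x} {x : M} (hu : SectionMDiffAt n F u x)
    (hv : SectionMDiffAt n F v x) (h : ∀ᶠ y in 𝓝 x, u y = v y) : D.grad u x = D.grad v x :=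
  D.isCovariantDerivativeOnUniv.congr_of_eventuallyEq hu hv Filter.univ_mem h

lemma grad_eq_zero {u : Π x : M, V x} {x : M} (hu : SectionMDiffAt n F u x)
    (h : ∀ᶠ y in 𝓝 x, u y = 0) : D.grad u x = 0 := by
  have h0 : SectionMDiffAt n F (0 : Π x : M, V x) x := mdiffAt_of_smooth (zero_mem _) x
  rw [D.grad_congr hu h0 h]
  exact congrFun D.toCovariantDerivative.zero x

variable [T2Space M]

lemma contMDiff_grad {u : Π x : M, V x} (hu : u ∈ smoothSections n F V) :
    ContMDiff (𝓡 n) ((𝓡 n).prod 𝓘(ℝ, 𝔼 n →L[ℝ] F)) ∞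
      (fun x ↦ TotalSpace.mk' (𝔼 n →L[ℝ] F) x (D.grad u x)) :=
  contMDiffOn_univ.1 (D.contMDiff.contMDiff.contMDiff (σ := u) (by simpa using hu.contMDiffOn))

/-- Near a point of `U` the section agrees with its product with a bump function, which is globally
smooth, and the connection is local. -/
lemma contMDiffOn_grad {s : Π x : M, V x} {U : Set M} (hU : IsOpen U)
    (hs : SmoothSectionOn n F s U) :
    ContMDiffOn (𝓡 n) ((𝓡 n).prod 𝓘(ℝ, 𝔼 n →L[ℝ] F)) ∞
      (fun x ↦ TotalSpace.mk' (𝔼 n →L[ℝ] F) x (D.grad s x)) U := by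
  intro x hx
  obtain ⟨φ, -, hφ⟩ := (SmoothBumpFunction.nhds_basis_tsupport (I := 𝓡 n) x).mem_iff.1
    (hU.mem_nhds hx)
  have hsm := smul_mem_smoothSections φ.contMDiff hU hφ hs
  refine ((D.contMDiff_grad hsm x).congr_of_eventuallyEq ?_).contMDiffWithinAt
  filter_upwards [φ.eventuallyEq_one.eventuallyEq_nhds, hU.mem_nhds hx] with y hy hyU
  have := D.grad_congr (hs.mdiffAt hU hyU) (mdiffAt_of_smooth hsm y)
    (by filter_upwards [hy] with z hz; simp [hz])
  rw [this]

lemma smoothSectionOn_grad_apply {s : Π x : M, V x} {U : Set M} (hU : IsOpen U)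
    (hs : SmoothSectionOn n F s U) {X : Π x : M, TangentSpace (𝓡 n) x} (hX : SmoothFieldOn X U) :
    SmoothSectionOn n F (fun x ↦ D.grad s x (X x)) U :=
  contMDiffOn_apply_field (D.contMDiffOn_grad hU hs) hX

/-- By tensoriality the second argument may be extended by any differentiable field, in particular
by a frame field, instead of the extension built into `homDeriv`. -/
lemma hess_apply_field {u : Π x : M, V x} (hu : u ∈ smoothSections n F V) {x : M}
    (v : TangentSpace (𝓡 n) x) {W : Π x : M, TangentSpace (𝓡 n) x} (hW : FieldMDiffAt W x) :
    D.hess u x v (W x) = D.grad (fun y ↦ D.grad u y (W y)) x v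
      - D.grad u x (leviCivita W x v) := by
  rw [hess, homDeriv, dif_pos (D.mdiffAt_grad hu x)]
  have := TensorialAt.mkHom_apply (homDeriv_tensorial D.toCovariantDerivative (D.grad u) x
    (D.mdiffAt_grad hu x)) hW
  exact congrArg (fun L : TangentSpace (𝓡 n) x →L[ℝ] V x ↦ L v) this

lemma smoothSectionOn_leviCivita_term {u : Π x : M, V x} (hu : u ∈ smoothSections n F V) (p : M)
    (i j : Fin n) : SmoothSectionOn n F (fun x ↦ D.grad u x (leviCivita (orthoFrame p j) x
      (orthoFrame p i x))) (chartAt (𝔼 n) p).source := by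
  have h : SmoothSectionOn n F (fun x ↦ ∑ k, (inner ℝ (leviCivita (orthoFrame p j) x
      (orthoFrame p i x)) (orthoFrame p k x) : ℝ) • D.grad u x (orthoFrame p k x))
      (chartAt (𝔼 n) p).source :=
    SmoothSectionOn.sum fun k ↦ SmoothSectionOn.smul
      (contMDiffOn_inner_leviCivita_orthoFrame p j i k)
      (contMDiffOn_apply_field (D.contMDiff_grad hu).contMDiffOn (smoothFieldOn_orthoFrame p k))
  refine h.congr fun x hx ↦ ?_
  refine congrArg (TotalSpace.mk' F x) ?_
  beta_reduce
  conv_lhs => rw [← (orthoBasis p hx).sum_repr' (leviCivita (orthoFrame p j) x (orthoFrame p i x))]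
  rw [map_sum]
  refine Finset.sum_congr rfl fun k _ ↦ ?_
  rw [map_smul, orthoBasis_apply, real_inner_comm]

lemma smoothSectionOn_hess {u : Π x : M, V x} (hu : u ∈ smoothSections n F V) (p : M)
    (i j : Fin n) : SmoothSectionOn n F (fun x ↦ D.hess u x (orthoFrame p i x) (orthoFrame p j x))
      (chartAt (𝔼 n) p).source := by
  have h1 : SmoothSectionOn n F (fun y ↦ D.grad u y (orthoFrame p j y))
      (chartAt (𝔼 n) p).source :=
    contMDiffOn_apply_field (D.contMDiff_grad hu).contMDiffOn (smoothFieldOn_orthoFrame p j)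
  have h2 := D.smoothSectionOn_grad_apply (chartAt (𝔼 n) p).open_source h1
    (smoothFieldOn_orthoFrame p i)
  refine (h2.sub_section (D.smoothSectionOn_leviCivita_term hu p i j)).congr fun x hx ↦ ?_
  exact congrArg (TotalSpace.mk' F x) (D.hess_apply_field hu _ (mdiffAt_orthoFrame p hx j))

lemma _root_.Bochner.homCore_inner_eq (p : M) {x : M} (hx : x ∈ (chartAt (𝔼 n) p).source)
    (A B : TangentSpace (𝓡 n) x →L[ℝ] V x) :
    ((homMetric n (bundleMetric n F V)).core x).inner A B
      = ∑ i, inner ℂ (A (orthoFrame p i x)) (B (orthoFrame p i x)) := by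
  let K : TangentSpace (𝓡 n) x →ₗ[ℝ] TangentSpace (𝓡 n) x →ₗ[ℝ] ℂ :=
    LinearMap.mk₂ ℝ (fun v w ↦ inner ℂ (A v) (B w))
      (fun v v' w ↦ by rw [map_add, inner_add_left])
      (fun r v w ↦ by
        rw [map_smul, ← Complex.coe_smul, inner_smul_left]
        simp)
      (fun v w w' ↦ by rw [map_add, inner_add_right])
      (fun r v w ↦ by
        rw [map_smul, ← Complex.coe_smul, inner_smul_right]
        simp)
  have := sum_orthonormal_eq (stdOrthonormalBasis ℝ (TangentSpace (𝓡 n) x)) (orthoBasis p hx) K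
  simp_rw [orthoBasis_apply] at this
  exact this

lemma trHess_eq (u : Π x : M, V x) (p : M) {x : M} (hx : x ∈ (chartAt (𝔼 n) p).source) :
    D.trHess u x = ∑ i, D.hess u x (orthoFrame p i x) (orthoFrame p i x) := by
  let K : TangentSpace (𝓡 n) x →ₗ[ℝ] TangentSpace (𝓡 n) x →ₗ[ℝ] V x :=
    (ContinuousLinearMap.coeLM ℝ).comp (D.hess u x).toLinearMap
  have := sum_orthonormal_eq (stdOrthonormalBasis ℝ (TangentSpace (𝓡 n) x)) (orthoBasis p hx) K
  simp_rw [orthoBasis_apply] at this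
  exact this

lemma smooth_trHess {u : Π x : M, V x} (hu : u ∈ smoothSections n F V) :
    D.trHess u ∈ smoothSections n F V := by
  intro p
  have h : SmoothSectionOn n F (fun x ↦ ∑ i, D.hess u x (orthoFrame p i x) (orthoFrame p i x))
      (chartAt (𝔼 n) p).source := SmoothSectionOn.sum fun i ↦ D.smoothSectionOn_hess hu p i i
  refine (h.congr fun x hx ↦ congrArg (TotalSpace.mk' F x) (D.trHess_eq u p hx)).contMDiffAt ?_
  exact chart_source_mem_nhds _ p

/-- The integrand of Green's formula. -/
def greenFun (v u : Π x : M, V x) (x : M) : ℂ :=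
  ((homMetric n (bundleMetric n F V)).core x).inner (D.grad v x) (D.grad u x)
    + inner ℂ (v x) (D.trHess u x)

lemma mvfderiv_inner_grad {v u : Π x : M, V x} {x : M} (hv : SectionMDiffAt n F v x)
    (hu : u ∈ smoothSections n F V) (p : M) (hx : x ∈ (chartAt (𝔼 n) p).source) (i j : Fin n) :
    mvfderiv (𝓡 n) (fun y ↦ (inner ℂ (v y) (D.grad u y (orthoFrame p j y)) : ℂ)) x
        (orthoFrame p i x)
      = inner ℂ (D.grad v x (orthoFrame p i x)) (D.grad u x (orthoFrame p j x))
        + inner ℂ (v x) (D.hess u x (orthoFrame p i x) (orthoFrame p j x))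
        + inner ℂ (v x) (D.grad u x (leviCivita (orthoFrame p j) x (orthoFrame p i x))) := by
  have h1 : SmoothSectionOn n F (fun y ↦ D.grad u y (orthoFrame p j y))
      (chartAt (𝔼 n) p).source :=
    contMDiffOn_apply_field (D.contMDiff_grad hu).contMDiffOn (smoothFieldOn_orthoFrame p j)
  have h2 := D.compatible hv (h1.mdiffAt (chartAt (𝔼 n) p).open_source hx) (orthoFrame p i x)
  rw [D.hess_apply_field hu _ (mdiffAt_orthoFrame p hx j), inner_sub_right, h2]
  change inner ℂ (D.grad v x _) _ + inner ℂ (v x) (D.grad (fun y ↦ D.grad u y (orthoFrame p j y)) x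
    (orthoFrame p i x)) = _
  ring

/-- The integrand is the divergence of the field `∑ ⟨v, ∇_{eᵢ} u⟩ eᵢ`. Differentiating the
coefficients leaves `⟨v, ∇u(∑ ∇_{eᵢ} eᵢ)⟩`, which the divergence terms cancel by
`sum_leviCivita_orthoFrame`. -/
lemma greenFun_eq_sum {v u : Π x : M, V x} {x : M} (hv : SectionMDiffAt n F v x)
    (hu : u ∈ smoothSections n F V) (p : M) (hx : x ∈ (chartAt (𝔼 n) p).source) :
    D.greenFun v u x = ∑ i, (mvfderiv (𝓡 n) (fun y ↦ (inner ℂ (v y)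
        (D.grad u y (orthoFrame p i y)) : ℂ)) x (orthoFrame p i x)
      + divergence (orthoFrame p i) x • (inner ℂ (v x) (D.grad u x (orthoFrame p i x)) : ℂ)) := by
  simp_rw [D.mvfderiv_inner_grad hv hu p hx, Finset.sum_add_distrib]
  rw [greenFun, homCore_inner_eq p hx, D.trHess_eq u p hx, inner_sum]
  have h := congrArg (fun w ↦ (inner ℂ (v x) (D.grad u x w) : ℂ)) (sum_leviCivita_orthoFrame p hx)
  simp only [map_sum, map_neg, map_smul, inner_sum, inner_neg_right] at h
  rw [h]
  have h' : ∀ (r : ℝ) (w : V x), (inner ℂ (v x) (r • w) : ℂ) = r • inner ℂ (v x) w := by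
    intro r w
    rw [← Complex.coe_smul, inner_smul_right]
    simp
  simp only [h']
  ring

end HermitianConnection
end Sections

/-! ### Green's formula. -/

section Green

variable {n : ℕ} {M : Type*} [TopologicalSpace M] [ChartedSpace (𝔼 n) M]
  [IsManifold (𝓡 n) ∞ M] [SecondCountableTopology M] [T2Space M]

/-- Local finiteness leaves finitely many functions of the partition that do not vanish identically
on the compact set; these already sum to one on `K`. The bound by one elsewhere is needed for
smoothing Lipschitz functions. -/
lemma exists_finset_partition {K : Set M} (hK : IsCompact K) (U : M → Set M)
    (hU : ∀ x, IsOpen (U x)) (hxU : ∀ x, x ∈ U x) :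
    ∃ (t : Finset M) (ρ : M → M → ℝ), (∀ i, ContMDiff (𝓡 n) 𝓘(ℝ, ℝ) ∞ (ρ i)) ∧
      (∀ i x, 0 ≤ ρ i x) ∧ (∀ i, tsupport (ρ i) ⊆ U i) ∧ (∀ x, ∑ i ∈ t, ρ i x ≤ 1) ∧
      ∀ x ∈ K, ∑ i ∈ t, ρ i x = 1 := by
  classical
  have : LocallyCompactSpace M := ChartedSpace.locallyCompactSpace (𝔼 n) M
  obtain ⟨ρ, hρ⟩ := SmoothPartitionOfUnity.exists_isSubordinate (𝓡 n) hK.isClosed U hU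
    fun x _ ↦ Set.mem_iUnion.2 ⟨x, hxU x⟩
  have hfin := ρ.locallyFinite.finite_nonempty_inter_compact hK
  refine ⟨hfin.toFinset, fun i x ↦ ρ i x, fun i ↦ (ρ i).contMDiff, ρ.nonneg, hρ, fun x ↦ ?_,
    fun x hx ↦ ?_⟩
  · refine le_trans ?_ (ρ.sum_le_one x)
    -- Off `K` other indices may contribute at `x`; they are added to the finite set to compare with
    -- the full sum.
    rw [finsum_eq_sum_of_support_subset (s := (ρ.locallyFinite.point_finite x).toFinset ∪
      hfin.toFinset) _ fun i hi ↦ by simpa using Or.inl hi]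
    exact Finset.sum_le_sum_of_subset_of_nonneg Finset.subset_union_right fun i _ _ ↦ ρ.nonneg i x
  rw [← ρ.sum_eq_one hx, finsum_eq_sum_of_support_subset]
  intro i hi
  exact hfin.mem_toFinset.2 ⟨x, hi, hx⟩

variable [MeasurableSpace M] [BorelSpace M]
  [RiemannianBundle (fun x : M ↦ TangentSpace (𝓡 n) x)]
  [IsContMDiffRiemannianBundle (𝓡 n) ∞ (𝔼 n) (fun x : M ↦ TangentSpace (𝓡 n) x)]
  {F : Type*} [NormedAddCommGroup F] [NormedSpace ℂ F] [FiniteDimensional ℂ F]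
  {V : M → Type*} [TopologicalSpace (TotalSpace F V)] [∀ x, NormedAddCommGroup (V x)]
  [∀ x, InnerProductSpace ℂ (V x)] [FiberBundle F V] [VectorBundle ℂ F V] [VectorBundle ℝ F V]
  [ContMDiffVectorBundle ∞ F V (𝓡 n)] [IsSmoothHermitianBundle n F V]

/-- The support of a section. -/
abbrev secSupport (v : Π x : M, V x) : Set M := closure {x | v x ≠ 0}

lemma eventually_eq_zero_of_notMem {v : Π x : M, V x} {x : M} (hx : x ∉ secSupport v) :
    ∀ᶠ y in 𝓝 x, v y = 0 := by
  filter_upwards [isClosed_closure.isOpen_compl.mem_nhds hx] with y hy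
  by_contra h
  exact hy (subset_closure h)

lemma eq_zero_of_notMem {v : Π x : M, V x} {x : M} (hx : x ∉ secSupport v) : v x = 0 :=
  (eventually_eq_zero_of_notMem hx).self_of_nhds

lemma secSupport_smul_subset (f : M → ℝ) (v : Π x : M, V x) :
    secSupport (fun x ↦ f x • v x) ⊆ tsupport f ∩ secSupport v := by
  refine Set.subset_inter (closure_mono fun x hx h ↦ hx ?_) (closure_mono fun x hx h ↦ hx ?_)
  · simp only [h, zero_smul]
  · simp only [h, smul_zero]

lemma tsupport_inner_subset (s t : Π x : M, V x) :
    tsupport (fun x ↦ (inner ℂ (s x) (t x) : ℂ)) ⊆ secSupport s :=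
  closure_mono fun x hx h ↦ hx (by simp only [h, inner_zero_left])

lemma contMDiff_inner {s t : Π x : M, V x} {U : Set M} (hU : IsOpen U)
    (hs : SmoothSectionOn n F s U) (ht : SmoothSectionOn n F t U) (hsU : secSupport s ⊆ U) :
    ContMDiff (𝓡 n) 𝓘(ℝ, ℂ) ∞ (fun x ↦ (inner ℂ (s x) (t x) : ℂ)) :=
  contMDiff_of_tsupport_subset_source hU (hs.inner ht) ((tsupport_inner_subset s t).trans hsU)

lemma hasCompactSupport_inner {s : Π x : M, V x} (t : Π x : M, V x)
    (hs : IsCompact (secSupport s)) :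
    HasCompactSupport (fun x ↦ (inner ℂ (s x) (t x) : ℂ)) :=
  hs.of_isClosed_subset (isClosed_tsupport _) (tsupport_inner_subset s t)

namespace HermitianConnection

variable (D : HermitianConnection n F V)

lemma greenFun_eq_zero {v : Π x : M, V x} (u : Π x : M, V x) {x : M}
    (hv : SectionMDiffAt n F v x) (hx : x ∉ secSupport v) : D.greenFun v u x = 0 := by
  rw [greenFun, D.grad_eq_zero hv (eventually_eq_zero_of_notMem hx), eq_zero_of_notMem hx,
    inner_zero_left, homCore_inner_eq x (mem_chart_source _ x)]
  simp

lemma greenFun_chart {v u : Π x : M, V x} (hv : v ∈ smoothSections n F V)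
    (hu : u ∈ smoothSections n F V) (hc : IsCompact (secSupport v)) (p : M)
    (hp : secSupport v ⊆ (chartAt (𝔼 n) p).source) :
    Integrable (D.greenFun v u) (riemannianVolume n M) ∧
      ∫ x, D.greenFun v u x ∂(riemannianVolume n M) = 0 := by
  let f : Fin n → M → ℂ := fun i y ↦ inner ℂ (v y) (D.grad u y (orthoFrame p i y))
  have hf : ∀ i, ContMDiff (𝓡 n) 𝓘(ℝ, ℂ) 1 (f i) := fun i ↦
    (contMDiff_inner (chartAt (𝔼 n) p).open_source (ContMDiff.contMDiffOn hv)
      (contMDiffOn_apply_field (D.contMDiff_grad hu).contMDiffOn (smoothFieldOn_orthoFrame p i))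
      hp).of_le (by simp)
  have hfs : ∀ i, tsupport (f i) ⊆ secSupport v := fun i ↦ tsupport_inner_subset v _
  have hfc : ∀ i, HasCompactSupport (f i) := fun i ↦ hasCompactSupport_inner _ hc
  let G : Fin n → M → ℂ := fun i x ↦ mvfderiv (𝓡 n) (f i) x (orthoFrame p i x)
    + divergence (orthoFrame p i) x • f i x
  have hG : ∀ i, Integrable (G i) (riemannianVolume n M) := fun i ↦
    integrable_deriv_add_divergence p (smoothFieldOn_orthoFrame p i) (hf i) (hfc i)
      ((hfs i).trans hp)
  have hG0 : ∀ i, ∫ x, G i x ∂(riemannianVolume n M) = 0 := fun i ↦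
    integral_deriv_add_divergence p (smoothFieldOn_orthoFrame p i) (hf i) (hfc i)
      ((hfs i).trans hp)
  have heq : D.greenFun v u = fun x ↦ ∑ i, G i x := by
    funext x
    by_cases hx : x ∈ secSupport v
    · exact D.greenFun_eq_sum (mdiffAt_of_smooth hv x) hu p (hp hx)
    · rw [D.greenFun_eq_zero u (mdiffAt_of_smooth hv x) hx]
      refine (Finset.sum_eq_zero fun i _ ↦ ?_).symm
      have h1 : mvfderiv (𝓡 n) (f i) x = 0 :=
        mvfderiv_eq_zero_of_notMem_tsupport fun h ↦ hx (hfs i h)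
      have h2 : f i x = 0 := image_eq_zero_of_notMem_tsupport fun h ↦ hx (hfs i h)
      simp only [G, h1, h2]
      simp
  rw [heq]
  refine ⟨integrable_finsetSum _ fun i _ ↦ hG i, ?_⟩
  rw [integral_finsetSum _ fun i _ ↦ hG i]
  exact Finset.sum_eq_zero fun i _ ↦ hG0 i

lemma grad_sum {ι : Type*} (t : Finset ι) {v : ι → Π x : M, V x}
    (hv : ∀ i, v i ∈ smoothSections n F V) (x : M) :
    D.grad (fun y ↦ ∑ i ∈ t, v i y) x = ∑ i ∈ t, D.grad (v i) x := by
  have h := covariantDerivative_sum D.toCovariantDerivative t (σ := v) (x := x)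
    fun i ↦ mdiffAt_of_smooth (hv i) x
  have heq : (fun y ↦ ∑ i ∈ t, v i y) = ∑ i ∈ t, v i := by
    funext y
    simp
  rw [heq]
  exact h

lemma greenFun_sum {ι : Type*} (t : Finset ι) {v : ι → Π x : M, V x} (u : Π x : M, V x)
    (hv : ∀ i, v i ∈ smoothSections n F V) (x : M) :
    D.greenFun (fun y ↦ ∑ i ∈ t, v i y) u x = ∑ i ∈ t, D.greenFun (v i) u x := by
  simp only [greenFun, homCore_inner_eq x (mem_chart_source (𝔼 n) x), D.grad_sum t hv x,
    sum_inner, Finset.sum_add_distrib]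
  rw [Finset.sum_comm]
  simp

lemma exists_sum_smul_eq {v : Π x : M, V x} (hc : IsCompact (secSupport v)) :
    ∃ (t : Finset M) (ρ : M → M → ℝ), (∀ i, ContMDiff (𝓡 n) 𝓘(ℝ, ℝ) ∞ (ρ i)) ∧
      (∀ i x, 0 ≤ ρ i x) ∧ (∀ i, tsupport (ρ i) ⊆ (chartAt (𝔼 n) i).source) ∧
      v = fun x ↦ ∑ i ∈ t, ρ i x • v x := by
  obtain ⟨t, ρ, h1, h2, h3, -, h4⟩ := exists_finset_partition (n := n) hc
    (fun p ↦ (chartAt (𝔼 n) p).source) (fun p ↦ (chartAt (𝔼 n) p).open_source)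
    (mem_chart_source (𝔼 n))
  refine ⟨t, ρ, h1, h2, h3, ?_⟩
  funext x
  by_cases hx : x ∈ secSupport v
  · rw [← Finset.sum_smul, h4 x hx, one_smul]
  · simp [eq_zero_of_notMem hx]

/-- Green's formula. -/
lemma integral_greenFun {v u : Π x : M, V x} (hv : v ∈ smoothSections n F V)
    (hu : u ∈ smoothSections n F V) (hc : IsCompact (secSupport v)) :
    Integrable (D.greenFun v u) (riemannianVolume n M) ∧
      ∫ x, D.greenFun v u x ∂(riemannianVolume n M) = 0 := by
  obtain ⟨t, ρ, h1, -, h3, h4⟩ := exists_sum_smul_eq (n := n) hc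
  have hm : ∀ i, (fun x ↦ ρ i x • v x) ∈ smoothSections n F V := fun i ↦
    smul_mem_smoothSections' (h1 i) hv
  have hs : ∀ i, secSupport (fun x ↦ ρ i x • v x) ⊆ tsupport (ρ i) ∩ secSupport v := fun i ↦
    secSupport_smul_subset (ρ i) v
  have hch := fun i ↦ D.greenFun_chart (hm i) hu
    (hc.of_isClosed_subset isClosed_closure ((hs i).trans Set.inter_subset_right)) i
    (((hs i).trans Set.inter_subset_left).trans (h3 i))
  -- The integrand is additive in `v`, so a partition of unity on the support of `v` reduces to one
  -- chart; `u` is not cut off.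
  have heq : D.greenFun v u = fun x ↦ ∑ i ∈ t, D.greenFun (fun x ↦ ρ i x • v x) u x := by
    funext x
    conv_lhs => rw [h4]
    exact D.greenFun_sum t u hm x
  rw [heq]
  refine ⟨integrable_finsetSum _ fun i _ ↦ (hch i).1, ?_⟩
  rw [integral_finsetSum _ fun i _ ↦ (hch i).1]
  exact Finset.sum_eq_zero fun i _ ↦ (hch i).2

end HermitianConnection
end Green

/-! ### Smooth sections of `T*M ⊗ V` and integration by parts for Hessian components. -/

section SmoothHom

variable {n : ℕ} {M : Type*} [TopologicalSpace M] [ChartedSpace (𝔼 n) M]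
  [IsManifold (𝓡 n) ∞ M] [SecondCountableTopology M] [T2Space M] [MeasurableSpace M] [BorelSpace M]
  [RiemannianBundle (fun x : M ↦ TangentSpace (𝓡 n) x)]
  [IsContMDiffRiemannianBundle (𝓡 n) ∞ (𝔼 n) (fun x : M ↦ TangentSpace (𝓡 n) x)]
  {F : Type*} [NormedAddCommGroup F] [NormedSpace ℂ F] [FiniteDimensional ℂ F]
  {V : M → Type*} [TopologicalSpace (TotalSpace F V)] [∀ x, NormedAddCommGroup (V x)]
  [∀ x, InnerProductSpace ℂ (V x)] [FiberBundle F V] [VectorBundle ℂ F V] [VectorBundle ℝ F V]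
  [ContMDiffVectorBundle ∞ F V (𝓡 n)] [IsSmoothHermitianBundle n F V]

lemma measurable_of_smoothSectionOn (ν : Measure M) {s : Π x : M, V x} {U : Set M} (hU : IsOpen U)
    (hs : SmoothSectionOn n F s U) :
    s ∈ (bundleMetric n F V).measurableSections (ν.restrict U) := by
  intro p
  rw [Measure.restrict_restrict (trivializationAt F V p).open_baseSet.measurableSet]
  refine ContinuousOn.aestronglyMeasurable ?_
    ((trivializationAt F V p).open_baseSet.inter hU).measurableSet
  exact (((trivializationAt F V p).contMDiffOn_section_iff (IB := 𝓡 n) (𝕜 := ℝ) (n := ∞)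
    ((trivializationAt F V p).open_baseSet.inter hU) Set.inter_subset_left).1
    (hs.mono Set.inter_subset_right)).continuousOn

lemma measurable_of_smooth (ν : Measure M) {s : Π x : M, V x}
    (hs : s ∈ HermitianConnection.smoothSections n F V) :
    s ∈ (bundleMetric n F V).measurableSections ν := by
  have := measurable_of_smoothSectionOn (n := n) (F := F) ν isOpen_univ (ContMDiff.contMDiffOn hs)
  rwa [Measure.restrict_univ] at this

lemma squareIntegrable_of_smooth {s : Π x : M, V x}
    (hs : s ∈ HermitianConnection.smoothSections n F V) (hc : IsCompact (secSupport s)) :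
    s ∈ (bundleMetric n F V).squareIntegrable (riemannianVolume n M) := by
  refine ⟨measurable_of_smooth _ hs, ?_⟩
  have h1 : Continuous (fun x ↦ (inner ℂ (s x) (s x) : ℂ)) :=
    (contMDiff_inner isOpen_univ (ContMDiff.contMDiffOn hs) (ContMDiff.contMDiffOn hs)
      (Set.subset_univ _)).continuous
  exact (h1.integrable_of_hasCompactSupport (hasCompactSupport_inner s hc)).re

variable (n F) in
/-- The section `A` of `T*M ⊗ V` is smooth, that is, its components in charts are smooth. -/
def SmoothHom (A : Π x : M, TangentSpace (𝓡 n) x →L[ℝ] V x) : Prop :=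
  ∀ q k, SmoothSectionOn n F (fun x ↦ A x (coordFrame q k x)) (chartAt (𝔼 n) q).source

lemma SmoothHom.apply {A : Π x : M, TangentSpace (𝓡 n) x →L[ℝ] V x} (hA : SmoothHom n F A) (q : M)
    {X : Π x : M, TangentSpace (𝓡 n) x} (hX : SmoothFieldOn X (chartAt (𝔼 n) q).source) :
    SmoothSectionOn n F (fun x ↦ A x (X x)) (chartAt (𝔼 n) q).source := by
  obtain ⟨a, ha, haX⟩ := exists_coordFrame_coeff q hX
  have h : SmoothSectionOn n F (fun x ↦ ∑ k, a k x • A x (coordFrame q k x))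
      (chartAt (𝔼 n) q).source := SmoothSectionOn.sum fun k ↦ SmoothSectionOn.smul (ha k) (hA q k)
  refine h.congr fun x hx ↦ congrArg (TotalSpace.mk' F x) ?_
  beta_reduce
  rw [haX x hx, map_sum]
  simp_rw [map_smul]

lemma SmoothHom.contMDiff_inner {A B : Π x : M, TangentSpace (𝓡 n) x →L[ℝ] V x}
    (hA : SmoothHom n F A) (hB : SmoothHom n F B) :
    ContMDiff (𝓡 n) 𝓘(ℝ, ℂ) ∞
      (fun x ↦ ((homMetric n (bundleMetric n F V)).core x).inner (A x) (B x)) := by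
  intro p
  have h : ContMDiffOn (𝓡 n) 𝓘(ℝ, ℂ) ∞ (fun x ↦ ∑ i, (inner ℂ (A x (orthoFrame p i x))
      (B x (orthoFrame p i x)) : ℂ)) (chartAt (𝔼 n) p).source :=
    contMDiffOn_finsetSum fun i _ ↦ (hA.apply p (smoothFieldOn_orthoFrame p i)).inner
      (hB.apply p (smoothFieldOn_orthoFrame p i))
  exact (h.congr fun x hx ↦ homCore_inner_eq p hx _ _).contMDiffAt (chart_source_mem_nhds _ p)

lemma SmoothHom.measurable {A : Π x : M, TangentSpace (𝓡 n) x →L[ℝ] V x} (hA : SmoothHom n F A)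
    (ν : Measure M) : A ∈ (homMetric n (bundleMetric n F V)).measurableSections ν :=
  fun p i ↦ measurable_of_smoothSectionOn ν (chartAt (𝔼 n) p).open_source (hA p i)

lemma homCore_inner_zero (x : M) (B : TangentSpace (𝓡 n) x →L[ℝ] V x) :
    ((homMetric n (bundleMetric n F V)).core x).inner 0 B = 0 := by
  rw [homCore_inner_eq x (mem_chart_source _ x)]
  simp

lemma SmoothHom.squareIntegrable {A : Π x : M, TangentSpace (𝓡 n) x →L[ℝ] V x}
    (hA : SmoothHom n F A) {K : Set M} (hK : IsCompact K) (h0 : ∀ x ∉ K, A x = 0) :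
    A ∈ (homMetric n (bundleMetric n F V)).squareIntegrable (riemannianVolume n M) := by
  refine ⟨hA.measurable _, ?_⟩
  refine ((hA.contMDiff_inner hA).continuous.integrable_of_hasCompactSupport
    (HasCompactSupport.intro hK fun x hx ↦ ?_)).re
  rw [h0 x hx, homCore_inner_zero]

/-- The section `α ⊗ s` of `T*M ⊗ V`, for the one-form `α` dual to the vector field `Y`. -/
def flatSmul (Y : Π x : M, TangentSpace (𝓡 n) x) (s : Π x : M, V x) (x : M) :
    TangentSpace (𝓡 n) x →L[ℝ] V x :=
  (innerSL ℝ (Y x)).smulRight (s x)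

/-- Expanding `Y` in an orthonormal basis. It rewrites `⟨s, B Y⟩` as a pairing in `T*M ⊗ V`, so that
expressions in `∇_Y u` become pairings with `∇u`. -/
lemma inner_flatSmul (Y : Π x : M, TangentSpace (𝓡 n) x) (s : Π x : M, V x) (x : M)
    (B : TangentSpace (𝓡 n) x →L[ℝ] V x) :
    ((homMetric n (bundleMetric n F V)).core x).inner (flatSmul Y s x) B
      = inner ℂ (s x) (B (Y x)) := by
  have hx := mem_chart_source (𝔼 n) x
  rw [homCore_inner_eq x hx]
  conv_rhs => rw [← (orthoBasis x hx).sum_repr' (Y x)]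
  rw [map_sum, inner_sum]
  refine Finset.sum_congr rfl fun i _ ↦ ?_
  have h1 : flatSmul Y s x (orthoFrame x i x) = ((inner ℝ (Y x) (orthoFrame x i x) : ℝ) : ℂ) • s x :=
    (Complex.coe_smul _ _).symm
  rw [h1, map_smul, ← Complex.coe_smul, inner_smul_left, inner_smul_right, orthoBasis_apply,
    real_inner_comm]
  simp

/-- On the support of `s` both factors are smooth; off it the product is locally zero, whatever `Y`
does outside `U`. -/
lemma smoothHom_flatSmul {Y : Π x : M, TangentSpace (𝓡 n) x} {s : Π x : M, V x} {U : Set M}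
    (hU : IsOpen U) (hY : SmoothFieldOn Y U) (hs : SmoothSectionOn n F s U)
    (hsU : secSupport s ⊆ U) : SmoothHom n F (flatSmul Y s) := by
  intro q k x hx
  refine ContMDiffAt.contMDiffWithinAt ?_
  by_cases hxs : x ∈ secSupport s
  · have hV : IsOpen (U ∩ (chartAt (𝔼 n) q).source) := hU.inter (chartAt (𝔼 n) q).open_source
    have h : SmoothSectionOn n F (fun x ↦ (inner ℝ (Y x) (coordFrame q k x) : ℝ) • s x)
        (U ∩ (chartAt (𝔼 n) q).source) :=
      SmoothSectionOn.smul (SmoothFieldOn.inner (hY.mono Set.inter_subset_left)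
        ((contMDiffOn_coordFrame q k).mono Set.inter_subset_right)) (hs.mono Set.inter_subset_left)
    exact h.contMDiffAt (hV.mem_nhds ⟨hsU hxs, hx⟩)
  · refine ContMDiffAt.congr_of_eventuallyEq (f := fun x ↦ TotalSpace.mk' F x (0 : V x))
      ((contMDiff_zeroSection ℝ V).contMDiffAt) ?_
    filter_upwards [eventually_eq_zero_of_notMem hxs] with y hy
    refine congrArg (TotalSpace.mk' F y) ?_
    change (inner ℝ (Y y) (coordFrame q k y) : ℝ) • s y = 0
    rw [hy, smul_zero]

lemma flatSmul_eq_zero (Y : Π x : M, TangentSpace (𝓡 n) x) {s : Π x : M, V x} {x : M}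
    (hx : x ∉ secSupport s) : flatSmul Y s x = 0 := by
  ext v
  change (inner ℝ (Y x) v : ℝ) • s x = 0
  rw [eq_zero_of_notMem hx, smul_zero]

namespace HermitianConnection

variable (D : HermitianConnection n F V)

lemma smoothHom_grad {u : Π x : M, V x} (hu : u ∈ smoothSections n F V) :
    SmoothHom n F (D.grad u) := fun q k ↦
  contMDiffOn_apply_field (D.contMDiff_grad hu).contMDiffOn (contMDiffOn_coordFrame q k)

lemma memL2TV_grad {u : Π x : M, V x} (hu : u ∈ smoothSections n F V)
    (hc : IsCompact (secSupport u)) : D.MemL2TV (D.grad u) :=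
  (D.smoothHom_grad hu).squareIntegrable hc fun x hx ↦
    D.grad_eq_zero (mdiffAt_of_smooth hu x) (eventually_eq_zero_of_notMem hx)

/-- The vector field `∇_X Y` for members of an orthonormal frame. -/
def frameDeriv (p : M) (i j : Fin n) (x : M) : TangentSpace (𝓡 n) x :=
  leviCivita (orthoFrame p j) x (orthoFrame p i x)

lemma smoothFieldOn_frameDeriv (p : M) (i j : Fin n) :
    SmoothFieldOn (frameDeriv (n := n) p i j) (chartAt (𝔼 n) p).source := by
  have h : SmoothFieldOn (fun x ↦ ∑ k, (inner ℝ (leviCivita (orthoFrame p j) x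
      (orthoFrame p i x)) (orthoFrame p k x) : ℝ) • orthoFrame p k x) (chartAt (𝔼 n) p).source :=
    ContMDiffOn.sum_section fun k _ ↦ (contMDiffOn_inner_leviCivita_orthoFrame p j i k).smul_section
      (smoothFieldOn_orthoFrame p k)
  refine h.congr fun x hx ↦ congrArg (TotalSpace.mk' (𝔼 n) x) ?_
  refine ((orthoBasis p hx).sum_repr' (frameDeriv p i j x)).symm.trans ?_
  refine Finset.sum_congr rfl fun k _ ↦ ?_
  rw [orthoBasis_apply, real_inner_comm]
  rfl

/-- Integration by parts for the components of the Hessian: the adjoint expression. -/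
def hessAdjoint (p : M) (i j : Fin n) (s : Π x : M, V x) :
    Π x : M, TangentSpace (𝓡 n) x →L[ℝ] V x :=
  flatSmul (orthoFrame p j) (fun x ↦ D.grad s x (orthoFrame p i x))
    + (flatSmul (frameDeriv p i j) s
      + flatSmul (orthoFrame p j) (fun x ↦ divergence (orthoFrame (n := n) p i) x • s x))

lemma SmoothHom.add {A B : Π x : M, TangentSpace (𝓡 n) x →L[ℝ] V x}
    (hA : SmoothHom n F A) (hB : SmoothHom n F B) : SmoothHom n F (A + B) :=
  fun q k ↦ (hA q k).add_section (hB q k)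

variable {s : Π x : M, V x} {p : M}

lemma secSupport_grad_subset (hs : s ∈ smoothSections n F V) (X : Π x : M, TangentSpace (𝓡 n) x) :
    secSupport (fun x ↦ D.grad s x (X x)) ⊆ secSupport s := by
  refine closure_minimal (fun x hx ↦ ?_) isClosed_closure
  by_contra h
  refine hx ?_
  beta_reduce
  rw [D.grad_eq_zero (mdiffAt_of_smooth hs x) (eventually_eq_zero_of_notMem h)]
  rfl

lemma smoothHom_hessAdjoint (hs : s ∈ smoothSections n F V)
    (hp : secSupport s ⊆ (chartAt (𝔼 n) p).source) (i j : Fin n) :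
    SmoothHom n F (D.hessAdjoint p i j s) := by
  have ho := (chartAt (𝔼 n) p).open_source
  have hsU : SmoothSectionOn n F s (chartAt (𝔼 n) p).source := ContMDiff.contMDiffOn hs
  refine SmoothHom.add (smoothHom_flatSmul ho (smoothFieldOn_orthoFrame p j)
    (D.smoothSectionOn_grad_apply ho hsU (smoothFieldOn_orthoFrame p i))
    ((D.secSupport_grad_subset hs _).trans hp)) (SmoothHom.add
    (smoothHom_flatSmul ho (smoothFieldOn_frameDeriv p i j) hsU hp)
    (smoothHom_flatSmul ho (smoothFieldOn_orthoFrame p j)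
      (SmoothSectionOn.smul (contMDiffOn_divergence p (smoothFieldOn_orthoFrame p i)) hsU)
      (((secSupport_smul_subset _ s).trans Set.inter_subset_right).trans hp)))

lemma memL2TV_hessAdjoint (hs : s ∈ smoothSections n F V) (hc : IsCompact (secSupport s))
    (hp : secSupport s ⊆ (chartAt (𝔼 n) p).source) (i j : Fin n) :
    D.MemL2TV (D.hessAdjoint p i j s) := by
  refine (D.smoothHom_hessAdjoint hs hp i j).squareIntegrable hc fun x hx ↦ ?_
  have h1 := flatSmul_eq_zero (orthoFrame (n := n) p j)
    fun h ↦ hx (D.secSupport_grad_subset hs (orthoFrame p i) h)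
  have h2 := flatSmul_eq_zero (frameDeriv (n := n) p i j) hx
  have h3 := flatSmul_eq_zero (orthoFrame (n := n) p j) (s := fun x ↦
    divergence (orthoFrame (n := n) p i) x • s x)
    fun h ↦ hx (((secSupport_smul_subset _ s).trans Set.inter_subset_right) h)
  simp only [hessAdjoint, Pi.add_apply, h1, h2, h3, add_zero]

lemma inner_hessAdjoint (p : M) (i j : Fin n) (s : Π x : M, V x) (x : M)
    (B : TangentSpace (𝓡 n) x →L[ℝ] V x) :
    ((homMetric n (bundleMetric n F V)).core x).inner (D.hessAdjoint p i j s x) B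
      = inner ℂ (D.grad s x (orthoFrame p i x)) (B (orthoFrame p j x))
        + (inner ℂ (s x) (B (leviCivita (orthoFrame p j) x (orthoFrame p i x)))
          + divergence (orthoFrame p i) x • inner ℂ (s x) (B (orthoFrame p j x))) := by
  have h1 := (((homMetric n (bundleMetric n F V)).core x)).add_left
  rw [hessAdjoint, Pi.add_apply, Pi.add_apply, h1, h1, inner_flatSmul, inner_flatSmul,
    inner_flatSmul, ← Complex.coe_smul, inner_smul_left]
  simp [frameDeriv]

/-- The divergence theorem for `⟨s, ∇_{eⱼ} u⟩ eᵢ` moves one derivative off the Hessian. The right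
side involves only `∇u`, hence is continuous in the `L²` class of `∇u`. -/
lemma integral_inner_hess {u : Π x : M, V x} (hu : u ∈ smoothSections n F V)
    (hs : s ∈ smoothSections n F V) (hc : IsCompact (secSupport s))
    (hp : secSupport s ⊆ (chartAt (𝔼 n) p).source) (i j : Fin n) :
    Integrable (fun x ↦ (inner ℂ (s x) (D.hess u x (orthoFrame p i x) (orthoFrame p j x)) : ℂ))
      (riemannianVolume n M) ∧
    ∫ x, (inner ℂ (s x) (D.hess u x (orthoFrame p i x) (orthoFrame p j x)) : ℂ)
        ∂(riemannianVolume n M)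
      = - ∫ x, ((homMetric n (bundleMetric n F V)).core x).inner (D.hessAdjoint p i j s x)
          (D.grad u x) ∂(riemannianVolume n M) := by
  have ho := (chartAt (𝔼 n) p).open_source
  have hsU : SmoothSectionOn n F s (chartAt (𝔼 n) p).source := ContMDiff.contMDiffOn hs
  have hI1 : Integrable (fun x ↦ (inner ℂ (s x) (D.hess u x (orthoFrame p i x)
      (orthoFrame p j x)) : ℂ)) (riemannianVolume n M) :=
    (contMDiff_inner ho hsU (D.smoothSectionOn_hess hu p i j)
      hp).continuous.integrable_of_hasCompactSupport (hasCompactSupport_inner _ hc)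
  let f : M → ℂ := fun y ↦ inner ℂ (s y) (D.grad u y (orthoFrame p j y))
  have hf : ContMDiff (𝓡 n) 𝓘(ℝ, ℂ) 1 f :=
    (contMDiff_inner ho hsU ((D.smoothHom_grad hu).apply p (smoothFieldOn_orthoFrame p j))
      hp).of_le (by simp)
  have hfs : tsupport f ⊆ secSupport s := tsupport_inner_subset s _
  have hfc : HasCompactSupport f := hasCompactSupport_inner _ hc
  have hJ := integrable_deriv_add_divergence p (smoothFieldOn_orthoFrame p i) hf hfc
    (hfs.trans hp)
  have hJ0 := integral_deriv_add_divergence p (smoothFieldOn_orthoFrame p i) hf hfc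
    (hfs.trans hp)
  have heq : ∀ x, ((homMetric n (bundleMetric n F V)).core x).inner (D.hessAdjoint p i j s x)
      (D.grad u x) = (mvfderiv (𝓡 n) f x (orthoFrame p i x) + divergence (orthoFrame p i) x • f x)
        - inner ℂ (s x) (D.hess u x (orthoFrame p i x) (orthoFrame p j x)) := by
    intro x
    rw [inner_hessAdjoint]
    by_cases hx : x ∈ secSupport s
    · have h := D.mvfderiv_inner_grad (mdiffAt_of_smooth hs x) hu p (hp hx) i j
      change mvfderiv (𝓡 n) f x (orthoFrame p i x) = _ at h
      rw [h]
      simp only [f]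
      ring
    · have h1 : mvfderiv (𝓡 n) f x = 0 := mvfderiv_eq_zero_of_notMem_tsupport fun h ↦ hx (hfs h)
      rw [h1, D.grad_eq_zero (mdiffAt_of_smooth hs x) (eventually_eq_zero_of_notMem hx)]
      simp [f, eq_zero_of_notMem hx]
  refine ⟨hI1, ?_⟩
  simp_rw [heq]
  rw [integral_sub hJ hI1, hJ0, zero_sub, neg_neg]

end HermitianConnection
end SmoothHom

/-! ### Compactness of closed balls in a complete Riemannian manifold. -/

section HopfRinow

open Metric
open scoped NNReal

/-- An extended metric space in which the distance is approximated by lengths: any distance can be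
split in two parts of prescribed length, up to an arbitrarily small error. -/
def HasSplitDistance (X : Type*) [PseudoEMetricSpace X] : Prop :=
  ∀ (x y : X) (r s : ℝ≥0), edist x y < r + s → ∃ z, edist x z ≤ r ∧ edist z y ≤ s

variable {X : Type*} [EMetricSpace X]

/-- By splitting, every point of the ball of radius `R` is close to a point of a slightly smaller,
compact ball. So the ball is totally bounded, and it is closed in a complete space. -/
lemma HasSplitDistance.isCompact_closedEBall_of_lt (hX : HasSplitDistance X) [CompleteSpace X]
    (x : X) {R : ℝ≥0} (hR : 0 < R) (h : ∀ r < R, IsCompact (closedEBall x (r : ℝ≥0∞))) :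
    IsCompact (closedEBall x (R : ℝ≥0∞)) := by
  refine TotallyBounded.isCompact_of_isClosed ?_ isClosed_closedEBall
  rw [EMetric.totallyBounded_iff]
  intro ε hε
  obtain ⟨δ, hδ, hδε⟩ : ∃ δ : ℝ≥0, 0 < δ ∧ (δ : ℝ≥0∞) < ε / 2 := by
    obtain ⟨δ, h1, h2⟩ := ENNReal.lt_iff_exists_nnreal_btwn.1 (ENNReal.half_pos hε.ne')
    exact ⟨δ, mod_cast h1, h2⟩
  -- Half of `min R δ` is removed so that `r < R` while `R < r + min R δ` holds strictly, as
  -- splitting requires; the minimum with `R` keeps the subtraction exact.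
  let r : ℝ≥0 := R - min R δ / 2
  have hm : 0 < min R δ := lt_min hR hδ
  have hrR : r < R := tsub_lt_self hR (half_pos hm)
  have hrm : R < r + min R δ := by
    have h1 : min R δ / 2 ≤ R := (half_le_self hm.le).trans (min_le_left _ _)
    have h2 : r + min R δ / 2 = R := tsub_add_cancel_of_le h1
    calc R = r + min R δ / 2 := h2.symm
      _ < r + min R δ := by gcongr; exact half_lt_self hm
  obtain ⟨t, ht, htr⟩ := EMetric.totallyBounded_iff.1 (h r hrR).totallyBounded (ε / 2)
    (ENNReal.half_pos hε.ne')
  refine ⟨t, ht, fun y hy ↦ ?_⟩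
  have hxy : edist x y < (r : ℝ≥0∞) + (min R δ : ℝ≥0) := by
    rw [edist_comm]
    exact lt_of_le_of_lt hy (by exact_mod_cast hrm)
  obtain ⟨z, hz1, hz2⟩ := hX x y r _ hxy
  have hz := htr (show z ∈ closedEBall x (r : ℝ≥0∞) by rw [mem_closedEBall, edist_comm]; exact hz1)
  simp only [Set.mem_iUnion, mem_eball] at hz ⊢
  obtain ⟨w, hw, hzw⟩ := hz
  refine ⟨w, hw, ?_⟩
  have hyz : edist y z ≤ ε / 2 := by
    rw [edist_comm]
    refine hz2.trans (le_trans ?_ hδε.le)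
    exact_mod_cast min_le_right _ _
  have htop : edist y z ≠ ⊤ := by
    rw [edist_comm]
    exact ne_top_of_le_ne_top ENNReal.coe_ne_top hz2
  calc edist y w ≤ edist y z + edist z w := edist_triangle _ _ _
    _ < ε / 2 + ε / 2 := ENNReal.add_lt_add_of_le_of_lt htop hyz hzw
    _ = ε := ENNReal.add_halves ε

/-- By local compactness a compact ball has a compact neighbourhood containing one of its
thickenings, and by splitting a slightly larger ball lies in that thickening. -/
lemma HasSplitDistance.exists_isCompact_closedEBall (hX : HasSplitDistance X)
    [LocallyCompactSpace X] (x : X) {R : ℝ≥0} (h : IsCompact (closedEBall x (R : ℝ≥0∞))) :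
    ∃ r : ℝ≥0, R < r ∧ IsCompact (closedEBall x (r : ℝ≥0∞)) := by
  obtain ⟨K, hK, hsub⟩ := exists_compact_superset h
  obtain ⟨δ, hδ, hδK⟩ := h.exists_cthickening_subset_open isOpen_interior hsub
  lift δ to ℝ≥0 using hδ.le
  have hδ' : 0 < δ := mod_cast hδ
  refine ⟨R + δ / 2, lt_add_of_pos_right R (half_pos hδ'),
    hK.of_isClosed_subset isClosed_closedEBall fun y hy ↦ ?_⟩
  have hxy : edist x y < (R : ℝ≥0∞) + δ := by
    rw [edist_comm]
    refine lt_of_le_of_lt hy ?_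
    have : R + δ / 2 < R + δ := by gcongr; exact half_lt_self hδ'
    exact_mod_cast this
  obtain ⟨z, hz1, hz2⟩ := hX x y R δ hxy
  refine interior_subset (hδK ?_)
  refine mem_cthickening_of_edist_le y z δ _ ?_ ?_
  · rw [mem_closedEBall, edist_comm]
    exact hz1
  · rw [edist_comm]
    simpa using hz2

/-- The Hopf-Rinow theorem of Cohn-Vossen. -/
lemma HasSplitDistance.isCompact_closedEBall (hX : HasSplitDistance X) [CompleteSpace X]
    [LocallyCompactSpace X] (x : X) (R : ℝ≥0) : IsCompact (closedEBall x (R : ℝ≥0∞)) := by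
  by_contra hR
  let S : Set ℝ≥0 := {r | IsCompact (closedEBall x (r : ℝ≥0∞))}
  have hmono : ∀ r ∈ S, ∀ r' ≤ r, r' ∈ S := fun r hr r' hr' ↦
    IsCompact.of_isClosed_subset hr isClosed_closedEBall (closedEBall_subset_closedEBall
      (by exact_mod_cast hr'))
  have hbdd : BddAbove S := ⟨R, fun r hr ↦ by
    by_contra hlt
    exact hR (hmono r hr R (not_le.1 hlt).le)⟩
  have h0 : (0 : ℝ≥0) ∈ S := by
    have : closedEBall x ((0 : ℝ≥0) : ℝ≥0∞) = {x} := by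
      ext y
      simp
    change IsCompact _
    rw [this]
    exact isCompact_singleton
  -- The supremum of the admissible radii is attained, and then exceeded: a contradiction.
  have hS : sSup S ∈ S := by
    rcases (zero_le : 0 ≤ sSup S).eq_or_lt with h | h
    · rw [← h]
      exact h0
    · refine hX.isCompact_closedEBall_of_lt x h fun r hr ↦ ?_
      obtain ⟨r', hr', hrr'⟩ := exists_lt_of_lt_csSup ⟨0, h0⟩ hr
      exact hmono r' hr' r hrr'.le
  obtain ⟨r, hr, hrc⟩ := hX.exists_isCompact_closedEBall x hS
  exact absurd (le_csSup hbdd hrc) (not_le.2 hr)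

/-- Take a path from `x` to `y` of length less than `r + s` and cut it where the distance from `x`
equals `r`. The first piece has length at least `r`, so less than `s` is left for the second. -/
lemma hasSplitDistance (n : ℕ) (M : Type*) [EMetricSpace M] [ChartedSpace (𝔼 n) M]
    [IsManifold (𝓡 n) ∞ M] [RiemannianBundle (fun x : M ↦ TangentSpace (𝓡 n) x)]
    [IsRiemannianManifold (𝓡 n) M] : HasSplitDistance M := by
  intro x y r s hxy
  by_cases hr : edist x y ≤ r
  · exact ⟨y, hr, by simp⟩
  rw [not_le] at hr
  rw [IsRiemannianManifold.out (I := 𝓡 n) x y] at hxy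
  obtain ⟨γ, h0, h1, hγ, hlen⟩ := exists_lt_of_riemannianEDist_lt hxy
  have hcont : ContinuousOn (fun t ↦ edist x (γ t)) (Set.Icc 0 1) :=
    ContinuousOn.comp (t := Set.univ) (continuous_const.edist continuous_id).continuousOn
      hγ.continuousOn (fun _ _ ↦ Set.mem_univ _)
  have himg := intermediate_value_Icc zero_le_one hcont
  obtain ⟨t, ht, htr⟩ : (r : ℝ≥0∞) ∈ (fun t ↦ edist x (γ t)) '' Set.Icc 0 1 :=
    himg ⟨by simp [h0], by simp [h1, hr.le]⟩
  refine ⟨γ t, htr.le, ?_⟩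
  have h2 : edist x (γ t) ≤ pathELength (𝓡 n) γ 0 t := by
    rw [IsRiemannianManifold.out (I := 𝓡 n)]
    exact riemannianEDist_le_pathELength (hγ.mono (Set.Icc_subset_Icc le_rfl ht.2)) h0 rfl ht.1
  have h3 : edist (γ t) y ≤ pathELength (𝓡 n) γ t 1 := by
    rw [IsRiemannianManifold.out (I := 𝓡 n)]
    exact riemannianEDist_le_pathELength (hγ.mono (Set.Icc_subset_Icc ht.1 le_rfl)) rfl h1 ht.2
  have h4 : (r : ℝ≥0∞) + edist (γ t) y ≤ r + s := by
    refine (add_le_add (htr.ge.trans h2) h3).trans ?_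
    rw [pathELength_add ht.1 ht.2]
    exact hlen.le
  exact (ENNReal.add_le_add_iff_left ENNReal.coe_ne_top).1 h4

end HopfRinow

/-! ### Mollification of continuous functions in Euclidean space. -/

section Mollification

open scoped NNReal Convolution
open ContinuousLinearMap (lsmul)

/-- Convolution averages translates, so bounds on difference quotients pass to it. They are stated
direction by direction, since a Riemannian Lipschitz condition bounds each direction by its own
length. -/
lemma exists_mollification {E : Type*} [NormedAddCommGroup E] [InnerProductSpace ℝ E]
    [FiniteDimensional ℝ E] [MeasurableSpace E] [BorelSpace E] {g : E → ℝ} {c : E} {r : ℝ}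
    (hg : ContinuousOn g (Metric.closedBall c r)) (hr : 0 < r) {ε : ℝ} (hε : 0 < ε) :
    ∃ h : E → ℝ, ContDiff ℝ ∞ h ∧ (∀ y ∈ Metric.ball c (r / 2), |h y - g y| ≤ ε) ∧
      ∀ y ∈ Metric.ball c (r / 2), ∀ (w : E) (B : ℝ),
        (∀ a ∈ Metric.ball c r, ∀ τ : ℝ, a + τ • w ∈ Metric.ball c r →
          |g (a + τ • w) - g a| ≤ B * |τ|) → |fderiv ℝ h y w| ≤ B := by
  obtain ⟨δ₀, hδ₀, hunif⟩ := Metric.uniformContinuousOn_iff_le.1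
    ((isCompact_closedBall c r).uniformContinuousOn_of_continuous hg) ε hε
  -- `δ ≤ δ₀` gives the uniform approximation; `δ ≤ r / 2` keeps translates of the half ball inside
  -- the ball of radius `r`.
  obtain ⟨δ, hδ, hδ1, hδ2⟩ : ∃ δ > 0, δ ≤ δ₀ ∧ δ ≤ r / 2 :=
    ⟨min δ₀ (r / 2), lt_min hδ₀ (half_pos hr), min_le_left _ _, min_le_right _ _⟩
  let φ : ContDiffBump (0 : E) := ⟨δ / 2, δ, half_pos hδ, half_lt_self hδ⟩
  let G : E → ℝ := (Metric.closedBall c r).indicator g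
  have hGg : ∀ y ∈ Metric.closedBall c r, G y = g y := fun y hy ↦ Set.indicator_of_mem hy g
  have hGint : Integrable G :=
    (integrable_indicator_iff Metric.isClosed_closedBall.measurableSet).2
      (hg.integrableOn_compact (isCompact_closedBall c r))
  have hex : ConvolutionExists (φ.normed volume) G (lsmul ℝ ℝ) volume :=
    φ.hasCompactSupport_normed.convolutionExists_left _ φ.continuous_normed
      hGint.locallyIntegrable
  let h : E → ℝ := φ.normed volume ⋆[lsmul ℝ ℝ, volume] G
  have hh : ContDiff ℝ ∞ h := φ.hasCompactSupport_normed.contDiff_convolution_left _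
    φ.contDiff_normed hGint.locallyIntegrable
  have hsub : ∀ y ∈ Metric.ball c (r / 2), ∀ s ∈ Metric.ball (0 : E) δ,
      y - s ∈ Metric.ball c r := by
    intro y hy s hs
    rw [Metric.mem_ball, dist_eq_norm] at hy ⊢
    rw [mem_ball_zero_iff] at hs
    calc ‖y - s - c‖ = ‖(y - c) - s‖ := by congr 1; abel
      _ ≤ ‖y - c‖ + ‖s‖ := norm_sub_le _ _
      _ < r := by linarith
  refine ⟨h, hh, fun y hy ↦ ?_, fun y hy w B hB ↦ ?_⟩
  · have hyr : y ∈ Metric.closedBall c r := Metric.ball_subset_closedBall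
      (Metric.ball_subset_ball (by linarith) hy)
    have := φ.dist_normed_convolution_le (μ := volume) (g := G) (x₀ := y) (ε := ε)
      hGint.aestronglyMeasurable (fun x hx ↦ by
        have hx' : x ∈ Metric.ball c r := by
          have := hsub y hy (y - x) (by rw [mem_ball_zero_iff, ← dist_eq_norm, dist_comm]; exact hx)
          simpa using this
        rw [hGg x (Metric.ball_subset_closedBall hx'), hGg y hyr]
        exact hunif x (Metric.ball_subset_closedBall hx') y hyr
          ((Metric.mem_ball.1 hx).le.trans hδ1))
    rw [hGg y hyr, Real.dist_eq] at this
    exact this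
  · have hder : HasDerivAt (fun τ : ℝ ↦ h (y + τ • w)) (fderiv ℝ h y w) 0 := by
      have h1 : HasFDerivAt h (fderiv ℝ h y) (y + (0 : ℝ) • w) := by
        simpa using (hh.differentiable (by simp) y).hasFDerivAt
      have h2 : HasDerivAt (fun τ : ℝ ↦ y + τ • w) w 0 := by
        simpa using ((hasDerivAt_id (0 : ℝ)).smul_const w).const_add y
      exact h1.comp_hasDerivAt 0 h2
    -- The sign of `B` is not assumed; it follows from the hypothesis at the centre for one small `τ
    -- > 0`.
    have hBnn : 0 ≤ B := by
      obtain ⟨τ, hτ, hτ'⟩ : ∃ τ : ℝ, 0 < τ ∧ c + τ • w ∈ Metric.ball c r := by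
        have hc : Filter.Tendsto (fun τ : ℝ ↦ c + τ • w) (𝓝[>] 0) (𝓝 c) := by
          have : Continuous fun τ : ℝ ↦ c + τ • w := by fun_prop
          have := this.tendsto 0
          simp only [zero_smul, add_zero] at this
          exact this.mono_left nhdsWithin_le_nhds
        have h1 : Set.Ioi (0 : ℝ) ∩ (fun τ : ℝ ↦ c + τ • w) ⁻¹' Metric.ball c r ∈ 𝓝[>] (0 : ℝ) :=
          Filter.inter_mem self_mem_nhdsWithin (hc (Metric.ball_mem_nhds c hr))
        exact Filter.nonempty_of_mem h1
      have := (abs_nonneg _).trans (hB c (Metric.mem_ball_self hr) τ hτ')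
      exact nonneg_of_mul_nonneg_left this (abs_pos.2 hτ.ne')
    have hnear : ∀ᶠ τ : ℝ in 𝓝 0, y + τ • w ∈ Metric.ball c (r / 2) := by
      have : Continuous fun τ : ℝ ↦ y + τ • w := by fun_prop
      refine this.continuousAt.preimage_mem_nhds ?_
      simpa using Metric.isOpen_ball.mem_nhds hy
    have hlip : ∀ᶠ τ : ℝ in 𝓝 0, ‖h (y + τ • w) - h (y + (0 : ℝ) • w)‖ ≤ B * ‖τ - 0‖ := by
      filter_upwards [hnear] with τ hτ
      rw [zero_smul, add_zero, sub_zero]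
      have hdiff : h (y + τ • w) - h y
          = ∫ s, φ.normed volume s * (G (y + τ • w - s) - G (y - s)) := by
        simp only [h, MeasureTheory.convolution]
        rw [← integral_sub (hex _) (hex _)]
        refine integral_congr_ae (.of_forall fun s ↦ ?_)
        simp [mul_sub]
      rw [hdiff]
      have hbound : ∀ s, ‖φ.normed volume s * (G (y + τ • w - s) - G (y - s))‖
          ≤ φ.normed volume s * (B * ‖τ‖) := by
        intro s
        rw [norm_mul, Real.norm_of_nonneg (φ.nonneg_normed s)]
        by_cases hs : s ∈ Metric.ball (0 : E) δ
        · refine mul_le_mul_of_nonneg_left ?_ (φ.nonneg_normed s)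
          have h1 := hsub y hy s hs
          have h2 := hsub _ hτ s hs
          rw [hGg _ (Metric.ball_subset_closedBall h1), hGg _ (Metric.ball_subset_closedBall h2)]
          have h3 : y + τ • w - s = (y - s) + τ • w := by abel
          rw [h3] at h2 ⊢
          exact hB _ h1 τ h2
        · have : φ.normed volume s = 0 := by
            rw [← Function.notMem_support, φ.support_normed_eq]
            exact hs
          simp [this]
      refine (norm_integral_le_of_norm_le (φ.integrable_normed.mul_const _)
        (.of_forall hbound)).trans ?_
      rw [integral_mul_const, φ.integral_normed, one_mul]
    exact hder.le_of_lip' hBnn hlip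

end Mollification

/-! ### Smoothing Lipschitz functions near a point. -/

section LocalSmoothing

open scoped NNReal

variable {n : ℕ} {M : Type*} [EMetricSpace M] [ChartedSpace (𝔼 n) M] [IsManifold (𝓡 n) ∞ M]
  [RiemannianBundle (fun x : M ↦ TangentSpace (𝓡 n) x)]
  [IsContMDiffRiemannianBundle (𝓡 n) ∞ (𝔼 n) (fun x : M ↦ TangentSpace (𝓡 n) x)]

/-- The tangent vector at `x` whose components in the chart at `p` are those of `w`. -/
def pushVec (p x : M) (w : 𝔼 n) : TangentSpace (𝓡 n) x :=
  (trivializationAt (𝔼 n) (fun x : M ↦ TangentSpace (𝓡 n) x) p).symmL ℝ x w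

lemma exists_pushVec (p : M) {x : M} (hx : x ∈ (chartAt (𝔼 n) p).source)
    (v : TangentSpace (𝓡 n) x) : ∃ w : 𝔼 n, pushVec p x w = v :=
  ⟨(trivializationAt (𝔼 n) (fun x : M ↦ TangentSpace (𝓡 n) x) p).continuousLinearMapAt ℝ x v,
    Trivialization.symmL_continuousLinearMapAt _ hx v⟩

lemma mfderiv_chartAt_symm_apply (p : M) {x : M} (hx : x ∈ (chartAt (𝔼 n) p).source) (w : 𝔼 n) :
    (mfderiv 𝓘(ℝ, 𝔼 n) (𝓡 n) (chartAt (𝔼 n) p).symm (chartAt (𝔼 n) p x) : 𝔼 n →L[ℝ] 𝔼 n) w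
      = pushVec p x w := by
  have h := TangentBundle.symmL_trivializationAt (I := 𝓡 n) hx
  have h2 := congrArg (fun L : 𝔼 n →L[ℝ] TangentSpace (𝓡 n) x ↦ L w) h
  refine Eq.trans ?_ h2.symm
  simp [mfderivWithin_univ]
  rfl

lemma mvfderiv_pushVec (p : M) {x : M} (hx : x ∈ (chartAt (𝔼 n) p).source) {f : M → ℝ}
    (hf : MDifferentiableAt (𝓡 n) 𝓘(ℝ, ℝ) f x) (w : 𝔼 n) :
    mvfderiv (𝓡 n) f x (pushVec p x w)
      = fderiv ℝ (f ∘ (chartAt (𝔼 n) p).symm) (chartAt (𝔼 n) p x) w := by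
  have hxx : (chartAt (𝔼 n) p).symm (chartAt (𝔼 n) p x) = x := (chartAt (𝔼 n) p).left_inv hx
  have hc := mfderiv_comp_of_eq (I := 𝓘(ℝ, 𝔼 n)) (I' := 𝓡 n) (I'' := 𝓘(ℝ, ℝ))
    hf (mdifferentiableAt_chartAt_symm p hx) hxx
  rw [← mfderiv_eq_fderiv, hc, ← mfderiv_chartAt_symm_apply p hx, hxx]
  rfl

/-- Continuity of the metric: vectors with the same components at `x` and `p` have comparable
lengths. Any constant above one would do; `2` is used. -/
lemma eventually_norm_pushVec_le (p : M) : ∀ᶠ x in 𝓝 p, ∀ w : 𝔼 n,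
    ‖pushVec p x w‖ ≤ 2 * ‖pushVec p p w‖ ∧ ‖pushVec p p w‖ ≤ 2 * ‖pushVec p x w‖ := by
  have : IsContinuousRiemannianBundle (𝔼 n) (fun x : M ↦ TangentSpace (𝓡 n) x) := by
    obtain ⟨g, hg, h⟩ := IsContMDiffRiemannianBundle.exists_contMDiff (IB := 𝓡 n) (n := ∞)
      (F := 𝔼 n) (E := fun x : M ↦ TangentSpace (𝓡 n) x)
    exact ⟨g, hg.continuous, h⟩
  filter_upwards [eventually_norm_symmL_trivializationAt_self_comp_lt (𝔼 n)
    (fun x : M ↦ TangentSpace (𝓡 n) x) p one_lt_two,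
    eventually_norm_symmL_trivializationAt_comp_self_lt (𝔼 n)
    (fun x : M ↦ TangentSpace (𝓡 n) x) p one_lt_two, chart_source_mem_nhds (𝔼 n) p]
    with x h1 h2 hx w
  let e := trivializationAt (𝔼 n) (fun x : M ↦ TangentSpace (𝓡 n) x) p
  constructor
  · have h3 := ContinuousLinearMap.le_of_opNorm_le _ h2.le (pushVec p p w)
    have h4 : e.continuousLinearMapAt ℝ p (pushVec p p w) = w :=
      e.continuousLinearMapAt_symmL (mem_chart_source (𝔼 n) p) w
    rw [ContinuousLinearMap.comp_apply] at h3
    change ‖e.symmL ℝ x (e.continuousLinearMapAt ℝ p (pushVec p p w))‖ ≤ _ at h3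
    rw [h4] at h3
    exact h3
  · have h3 := ContinuousLinearMap.le_of_opNorm_le _ h1.le (pushVec p x w)
    have h4 : e.continuousLinearMapAt ℝ x (pushVec p x w) = w :=
      e.continuousLinearMapAt_symmL hx w
    rw [ContinuousLinearMap.comp_apply] at h3
    change ‖e.symmL ℝ p (e.continuousLinearMapAt ℝ x (pushVec p x w))‖ ≤ _ at h3
    rw [h4] at h3
    exact h3

lemma mfderiv_segment (p : M) {y z : 𝔼 n} {t : ℝ}
    (ht : y + t • (z - y) ∈ (chartAt (𝔼 n) p).target) :
    (mfderiv 𝓘(ℝ, ℝ) (𝓡 n) (fun t : ℝ ↦ (chartAt (𝔼 n) p).symm (y + t • (z - y))) t :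
      ℝ →L[ℝ] 𝔼 n) 1 = pushVec p ((chartAt (𝔼 n) p).symm (y + t • (z - y))) (z - y) := by
  have hx := (chartAt (𝔼 n) p).map_target ht
  have hxx : chartAt (𝔼 n) p ((chartAt (𝔼 n) p).symm (y + t • (z - y))) = y + t • (z - y) :=
    (chartAt (𝔼 n) p).right_inv ht
  have h1 : MDifferentiableAt 𝓘(ℝ, 𝔼 n) (𝓡 n) (chartAt (𝔼 n) p).symm (y + t • (z - y)) := by
    have := mdifferentiableAt_chartAt_symm p hx
    rwa [hxx] at this
  have h2 : HasDerivAt (fun t : ℝ ↦ y + t • (z - y)) (z - y) t := by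
    simpa using ((hasDerivAt_id t).smul_const (z - y)).const_add y
  have hc := mfderiv_comp (I := 𝓘(ℝ, ℝ)) (I' := 𝓘(ℝ, 𝔼 n)) (I'' := 𝓡 n) t h1
    h2.hasFDerivAt.differentiableAt.mdifferentiableAt
  have h3 := mfderiv_chartAt_symm_apply p hx (z - y)
  rw [hxx] at h3
  rw [← h3]
  refine (congrArg (fun L : ℝ →L[ℝ] 𝔼 n ↦ L 1) hc).trans ?_
  have h4 : (mfderiv 𝓘(ℝ, ℝ) 𝓘(ℝ, 𝔼 n) (fun t : ℝ ↦ y + t • (z - y)) t : ℝ →L[ℝ] 𝔼 n) 1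
      = z - y := by
    rw [mfderiv_eq_fderiv]
    exact h2.deriv
  exact congrArg (mfderiv 𝓘(ℝ, 𝔼 n) (𝓡 n) (chartAt (𝔼 n) p).symm (y + t • (z - y)) :
    𝔼 n →L[ℝ] 𝔼 n) h4

/-- The distance is at most the length of the path that is a straight segment in the chart. -/
lemma edist_chartAt_symm_le [IsRiemannianManifold (𝓡 n) M] (p : M) {S : Set (𝔼 n)}
    (hS : Convex ℝ S) (hSt : S ⊆ (chartAt (𝔼 n) p).target) {y z : 𝔼 n} (hy : y ∈ S) (hz : z ∈ S)
    {B : ℝ} (hB : ∀ a ∈ S, ‖pushVec p ((chartAt (𝔼 n) p).symm a) (z - y)‖ ≤ B) :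
    edist ((chartAt (𝔼 n) p).symm y) ((chartAt (𝔼 n) p).symm z) ≤ ENNReal.ofReal B := by
  let γ : ℝ → M := fun t ↦ (chartAt (𝔼 n) p).symm (y + t • (z - y))
  have hseg : ∀ t ∈ Set.Icc (0 : ℝ) 1, y + t • (z - y) ∈ S := fun t ht ↦
    hS.add_smul_sub_mem hy hz ht
  have hγ : ContMDiffOn 𝓘(ℝ, ℝ) (𝓡 n) 1 γ (Set.Icc 0 1) := by
    refine ((contMDiffOn_chart_symm (I := 𝓡 n) (n := ∞) (x := p)).of_le (by simp)).comp
      (t := (chartAt (𝔼 n) p).target) ?_ fun t ht ↦ hSt (hseg t ht)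
    refine ContMDiff.contMDiffOn ?_
    have : ContDiff ℝ 1 fun t : ℝ ↦ y + t • (z - y) := by fun_prop
    exact this.contMDiff
  rw [IsRiemannianManifold.out (I := 𝓡 n)]
  refine (riemannianEDist_le_pathELength hγ (by simp [γ]) (by simp [γ]) zero_le_one).trans ?_
  rw [pathELength_eq_lintegral_mfderiv_Icc]
  have hle : ∀ t ∈ Set.Icc (0 : ℝ) 1, ‖(mfderiv 𝓘(ℝ, ℝ) (𝓡 n) γ t (1 : ℝ) :
      TangentSpace (𝓡 n) (γ t))‖ₑ ≤ ENNReal.ofReal B := by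
    intro t ht
    have h1 : (mfderiv 𝓘(ℝ, ℝ) (𝓡 n) γ t (1 : ℝ) : TangentSpace (𝓡 n) (γ t))
      = pushVec p (γ t) (z - y) := mfderiv_segment p (hSt (hseg t ht))
    rw [h1, ← ofReal_norm]
    exact ENNReal.ofReal_le_ofReal (hB _ (hseg t ht))
  refine (setLIntegral_mono' measurableSet_Icc hle).trans ?_
  simp

/-- A Lipschitz function is approximated near `p` by smooth functions of controlled gradient. -/
lemma exists_local_smoothing [IsRiemannianManifold (𝓡 n) M] (p : M) :
    ∃ U : Set M, IsOpen U ∧ p ∈ U ∧ U ⊆ (chartAt (𝔼 n) p).source ∧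
      (∃ K, IsCompact K ∧ U ⊆ K ∧ K ⊆ (chartAt (𝔼 n) p).source) ∧
      ∀ (L : ℝ≥0) (θ : M → ℝ), LipschitzWith L θ → ∀ ε > 0, ∃ h : M → ℝ,
        ContMDiffOn (𝓡 n) 𝓘(ℝ, ℝ) ∞ h U ∧ (∀ x ∈ U, |h x - θ x| ≤ ε) ∧
        ∀ x ∈ U, ∀ v : TangentSpace (𝓡 n) x, |mvfderiv (𝓡 n) h x v| ≤ 4 * L * ‖v‖ := by
  set φ := chartAt (𝔼 n) p with hφ
  have hev : ∀ᶠ y in 𝓝 (φ p), y ∈ φ.target ∧ ∀ w : 𝔼 n,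
      ‖pushVec p (φ.symm y) w‖ ≤ 2 * ‖pushVec p p w‖ ∧
      ‖pushVec p p w‖ ≤ 2 * ‖pushVec p (φ.symm y) w‖ := by
    have hp := mem_chart_source (𝔼 n) p
    refine Filter.Eventually.and (φ.open_target.mem_nhds (φ.map_source hp)) ?_
    have hcont : Filter.Tendsto φ.symm (𝓝 (φ p)) (𝓝 p) := by
      have := (φ.continuousAt_symm (φ.map_source hp)).tendsto
      rwa [φ.left_inv hp] at this
    exact hcont.eventually (eventually_norm_pushVec_le p)
  obtain ⟨r, hr, hball⟩ := Metric.nhds_basis_closedBall.eventually_iff.1 hev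
  have hbt : Metric.closedBall (φ p) r ⊆ φ.target := fun y hy ↦ (hball hy).1
  have hbb : Metric.ball (φ p) (r / 2) ⊆ Metric.closedBall (φ p) r := fun y hy ↦
    Metric.closedBall_subset_closedBall (by linarith) (Metric.ball_subset_closedBall hy)
  refine ⟨φ.source ∩ φ ⁻¹' Metric.ball (φ p) (r / 2),
    φ.isOpen_inter_preimage Metric.isOpen_ball,
    ⟨mem_chart_source _ p, Metric.mem_ball_self (half_pos hr)⟩, Set.inter_subset_left,
    ⟨φ.symm '' Metric.closedBall (φ p) r,
      (isCompact_closedBall _ _).image_of_continuousOn (φ.continuousOn_symm.mono hbt),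
      fun x hx ↦ ⟨φ x, hbb hx.2, φ.left_inv hx.1⟩, ?_⟩, fun L θ hθ ε hε ↦ ?_⟩
  · rintro _ ⟨y, hy, rfl⟩
    exact φ.map_target (hbt hy)
  obtain ⟨h, hh, hclose, hder⟩ := exists_mollification
    (g := θ ∘ φ.symm) (c := φ p) (hθ.continuous.comp_continuousOn (φ.continuousOn_symm.mono hbt))
    hr hε
  have hsm : ContMDiffOn (𝓡 n) 𝓘(ℝ, ℝ) ∞ (h ∘ φ) φ.source :=
    hh.contMDiff.comp_contMDiffOn (contMDiffOn_chart (I := 𝓡 n) (n := ∞) (x := p))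
  refine ⟨h ∘ φ, hsm.mono Set.inter_subset_left, fun x hx ↦ ?_, fun x hx v ↦ ?_⟩
  · have := hclose _ hx.2
    simpa [φ.left_inv hx.1] using this
  · obtain ⟨w, rfl⟩ := exists_pushVec p hx.1 v
    rw [mvfderiv_pushVec p hx.1 ((hsm.contMDiffAt (φ.open_source.mem_nhds hx.1)).mdifferentiableAt
      (by simp))]
    have hcongr : (h ∘ φ) ∘ φ.symm =ᶠ[𝓝 (φ x)] h := by
      filter_upwards [φ.open_target.mem_nhds (φ.map_source hx.1)] with y hy
      simp [φ.right_inv hy]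
    rw [hcongr.fderiv_eq]
    refine hder _ hx.2 w _ fun a ha τ haτ ↦ ?_
    -- The factor `4` comes from two comparisons by `2`: from the point `b` to the centre, and from
    -- the centre to `x`.
    have hB : ∀ b ∈ Metric.ball (φ p) r, ‖pushVec p (φ.symm b) (a + τ • w - a)‖
        ≤ 4 * ‖pushVec p x w‖ * |τ| := by
      intro b hb
      have h1 : pushVec p (φ.symm b) (a + τ • w - a) = τ • pushVec p (φ.symm b) w := by
        rw [add_sub_cancel_left]
        exact map_smul _ _ _
      have h2 := ((hball (Metric.ball_subset_closedBall hb)).2 w).1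
      have h3 := ((hball (hbb hx.2)).2 w).2
      rw [φ.left_inv hx.1] at h3
      rw [h1, norm_smul, Real.norm_eq_abs, mul_comm]
      exact mul_le_mul_of_nonneg_right (by linarith) (abs_nonneg τ)
    have hd := edist_chartAt_symm_le p (convex_ball (φ p) r)
      (Metric.ball_subset_closedBall.trans hbt) ha haτ hB
    have h4 : edist (θ (φ.symm (a + τ • w))) (θ (φ.symm a))
        ≤ L * ENNReal.ofReal (4 * ‖pushVec p x w‖ * |τ|) := by
      refine (hθ (φ.symm (a + τ • w)) (φ.symm a)).trans ?_
      rw [edist_comm]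
      gcongr
    rw [edist_dist, Real.dist_eq, ← ENNReal.ofReal_coe_nnreal,
      ← ENNReal.ofReal_mul L.coe_nonneg] at h4
    have h5 := (ENNReal.ofReal_le_ofReal_iff (by positivity)).1 h4
    refine h5.trans (le_of_eq ?_)
    ring

end LocalSmoothing

/-! ### Global smoothing of compactly supported Lipschitz functions. -/

section Cutoff

open scoped NNReal

variable {n : ℕ} {M : Type*} [EMetricSpace M] [ChartedSpace (𝔼 n) M] [IsManifold (𝓡 n) ∞ M]
  [SecondCountableTopology M] [MeasurableSpace M] [BorelSpace M]
  [RiemannianBundle (fun x : M ↦ TangentSpace (𝓡 n) x)]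
  [IsContMDiffRiemannianBundle (𝓡 n) ∞ (𝔼 n) (fun x : M ↦ TangentSpace (𝓡 n) x)]

/-- The derivatives along an orthonormal frame are continuous on the compact `K`, and coefficients
in that frame are bounded by the norm. -/
lemma exists_bound_mvfderiv {f : M → ℝ} (hf : ContMDiff (𝓡 n) 𝓘(ℝ, ℝ) ∞ f) {p : M} {K : Set M}
    (hK : IsCompact K) (hKs : K ⊆ (chartAt (𝔼 n) p).source) (hfK : tsupport f ⊆ K) :
    ∃ C : ℝ, 0 ≤ C ∧ ∀ (x : M) (v : TangentSpace (𝓡 n) x), |mvfderiv (𝓡 n) f x v| ≤ C * ‖v‖ := by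
  have hcont : ContinuousOn (fun x ↦ ∑ i, |mvfderiv (𝓡 n) f x (orthoFrame p i x)|) K := by
    refine continuousOn_finsetSum _ fun i _ ↦ ContinuousOn.abs ?_
    have h := contMDiffOn_mvfderiv (k := ∞) (m := 0) p (smoothFieldOn_orthoFrame p i) le_rfl
      hf.contMDiffOn (by simp)
    exact h.continuousOn.mono hKs
  obtain ⟨C, hC⟩ := hK.exists_bound_of_continuousOn hcont
  refine ⟨max C 0, le_max_right _ _, fun x v ↦ ?_⟩
  by_cases hx : x ∈ tsupport f
  · have hxs := hKs (hfK hx)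
    have hv : mvfderiv (𝓡 n) f x v
        = ∑ i, (inner ℝ (orthoFrame p i x) v : ℝ) * mvfderiv (𝓡 n) f x (orthoFrame p i x) := by
      conv_lhs => rw [← (orthoBasis p hxs).sum_repr' v]
      rw [map_sum]
      refine Finset.sum_congr rfl fun i _ ↦ ?_
      rw [map_smul, orthoBasis_apply, smul_eq_mul]
    have h1 : ∀ i, |(inner ℝ (orthoFrame p i x) v : ℝ)| ≤ ‖v‖ := fun i ↦ by
      refine (abs_real_inner_le_norm _ _).trans ?_
      rw [← orthoBasis_apply p hxs, (orthoBasis p hxs).orthonormal.1 i, one_mul]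
    calc |mvfderiv (𝓡 n) f x v|
        ≤ ∑ i, |(inner ℝ (orthoFrame p i x) v : ℝ) * mvfderiv (𝓡 n) f x (orthoFrame p i x)| := by
          rw [hv]
          exact Finset.abs_sum_le_sum_abs _ _
      _ ≤ ∑ i, ‖v‖ * |mvfderiv (𝓡 n) f x (orthoFrame p i x)| := by
          refine Finset.sum_le_sum fun i _ ↦ ?_
          rw [abs_mul]
          exact mul_le_mul_of_nonneg_right (h1 i) (abs_nonneg _)
      _ = (∑ i, |mvfderiv (𝓡 n) f x (orthoFrame p i x)|) * ‖v‖ := by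
          rw [← Finset.mul_sum, mul_comm]
      _ ≤ max C 0 * ‖v‖ := by
          refine mul_le_mul_of_nonneg_right ?_ (norm_nonneg v)
          exact (le_abs_self _).trans ((hC x (hfK hx)).trans (le_max_left _ _))
  · rw [mvfderiv_eq_zero_of_notMem_tsupport hx]
    simpa using mul_nonneg (le_max_right C 0) (norm_nonneg v)

lemma mvfderiv_sum_real {ι : Type*} (t : Finset ι) {f : ι → M → ℝ} {x : M}
    (hf : ∀ i, MDifferentiableAt (𝓡 n) 𝓘(ℝ, ℝ) (f i) x) :
    MDifferentiableAt (𝓡 n) 𝓘(ℝ, ℝ) (fun y ↦ ∑ i ∈ t, f i y) x ∧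
    ∀ v, mvfderiv (𝓡 n) (fun y ↦ ∑ i ∈ t, f i y) x v = ∑ i ∈ t, mvfderiv (𝓡 n) (f i) x v := by
  classical
  induction t using Finset.induction_on with
  | empty =>
    refine ⟨by simpa using mdifferentiableAt_const, fun v ↦ ?_⟩
    have : (fun y : M ↦ ∑ i ∈ (∅ : Finset ι), f i y) = 0 := by
      funext y
      simp
    rw [this, mvfderiv_zero]
    simp
  | insert a s ha ih =>
    have h : (fun y ↦ ∑ i ∈ insert a s, f i y) = f a + fun y ↦ ∑ i ∈ s, f i y := by
      funext y
      simp [Finset.sum_insert ha]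
    rw [h]
    refine ⟨(hf a).add ih.1, fun v ↦ ?_⟩
    have h2 := mvfderiv_add (hf a) ih.1
    rw [Finset.sum_insert ha, ← ih.2 v]
    exact congrArg (fun L : TangentSpace (𝓡 n) x →L[ℝ] ℝ ↦ L v) h2

variable [IsRiemannianManifold (𝓡 n) M]

/-- Local smoothings `h_p` are glued to `∑ ρ_p h_p`. Since `θ ∑ dρ_p = 0`, the differential equals
`∑ ρ_p dh_p + ∑ (h_p - θ) dρ_p`; the first sum is at most `4 L`, and the second is small with `h_p -
θ`. No derivative of `θ` appears. -/
lemma exists_smoothing {θ : M → ℝ} {L : ℝ≥0} (hθ : LipschitzWith L θ) (hc : HasCompactSupport θ)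
    {ε : ℝ} (hε : 0 < ε) : ∃ χ : M → ℝ, ContMDiff (𝓡 n) 𝓘(ℝ, ℝ) ∞ χ ∧ HasCompactSupport χ ∧
      (∀ x, |χ x - θ x| ≤ ε) ∧
      ∀ (x : M) (v : TangentSpace (𝓡 n) x), |mvfderiv (𝓡 n) χ x v| ≤ (4 * L + ε) * ‖v‖ := by
  choose U hUo hpU hUs hUK hsm using exists_local_smoothing (n := n) (M := M)
  choose K hK hUK hKs using hUK
  obtain ⟨t, ρ, hρ, hρ0, hρU, hρ1, hρK⟩ := exists_finset_partition (n := n) hc U hUo hpU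
  choose C hC0 hC using fun p ↦ exists_bound_mvfderiv (hρ p) (hK p) (hKs p)
    ((hρU p).trans (hUK p))
  -- The local precision is chosen after the partition of unity: it compensates both the bound `C p`
  -- for `dρ_p` and the number of terms.
  let δ : M → ℝ := fun p ↦ ε / ((t.card + 1) * (C p + 1))
  have hδ : ∀ p, 0 < δ p := fun p ↦ by
    have := hC0 p
    positivity
  have hδ1 : ∀ p, δ p ≤ ε := fun p ↦ by
    refine div_le_self hε.le ?_
    have := hC0 p
    nlinarith [(Nat.cast_nonneg t.card : (0 : ℝ) ≤ t.card)]
  have hδC : ∀ p, δ p * C p ≤ ε / (t.card + 1) := fun p ↦ by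
    have h1 := hC0 p
    simp only [δ]
    rw [div_mul_eq_mul_div, div_le_div_iff₀ (by positivity) (by positivity)]
    have : 0 ≤ ε * (t.card + 1) := by positivity
    nlinarith
  choose h hh hhc hhd using fun p ↦ hsm p L θ hθ (δ p) (hδ p)
  let g : M → M → ℝ := fun p x ↦ ρ p x * h p x
  have hgs : ∀ p, tsupport (g p) ⊆ tsupport (ρ p) := fun p ↦
    closure_mono fun x hx h0 ↦ hx (by simp only [g, h0, zero_mul])
  have hg : ∀ p, ContMDiff (𝓡 n) 𝓘(ℝ, ℝ) ∞ (g p) := fun p ↦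
    contMDiff_of_tsupport_subset_source (hUo p) ((hρ p).contMDiffOn.mul (hh p))
      ((hgs p).trans (hρU p))
  have hzero : ∀ x, (∑ p ∈ t, ρ p x - 1) * θ x = 0 := by
    intro x
    by_cases hx : x ∈ tsupport θ
    · rw [hρK x hx, sub_self, zero_mul]
    · rw [image_eq_zero_of_notMem_tsupport hx, mul_zero]
  have hdiff : ∀ p x, |ρ p x * (h p x - θ x)| ≤ ρ p x * ε := by
    intro p x
    rw [abs_mul, abs_of_nonneg (hρ0 p x)]
    by_cases hx : x ∈ tsupport (ρ p)
    · exact mul_le_mul_of_nonneg_left ((hhc p x (hρU p hx)).trans (hδ1 p)) (hρ0 p x)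
    · simp [image_eq_zero_of_notMem_tsupport hx]
  refine ⟨fun x ↦ ∑ p ∈ t, g p x, contMDiff_finsetSum fun p _ ↦ hg p, ?_, fun x ↦ ?_,
    fun x v ↦ ?_⟩
  · refine HasCompactSupport.intro (t.isCompact_biUnion fun p _ ↦ hK p) fun x hx ↦ ?_
    refine Finset.sum_eq_zero fun p hp ↦ ?_
    have : x ∉ tsupport (ρ p) := fun hxρ ↦
      hx (Set.mem_biUnion hp (hUK p (hρU p hxρ)))
    simp [g, image_eq_zero_of_notMem_tsupport this]
  · have heq : ∑ p ∈ t, g p x - θ x = ∑ p ∈ t, ρ p x * (h p x - θ x) := by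
      have h1 : ∑ p ∈ t, ρ p x * (h p x - θ x) = ∑ p ∈ t, g p x - (∑ p ∈ t, ρ p x) * θ x := by
        simp only [g, mul_sub, Finset.sum_sub_distrib, Finset.sum_mul]
      linarith [hzero x]
    rw [heq]
    refine (Finset.abs_sum_le_sum_abs _ _).trans ((Finset.sum_le_sum fun p _ ↦ hdiff p x).trans ?_)
    rw [← Finset.sum_mul]
    exact mul_le_of_le_one_left hε.le (hρ1 x)
  · have hgd : ∀ p, MDifferentiableAt (𝓡 n) 𝓘(ℝ, ℝ) (g p) x := fun p ↦
      (hg p).mdifferentiable (by simp) x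
    have hρd : ∀ p, MDifferentiableAt (𝓡 n) 𝓘(ℝ, ℝ) (ρ p) x := fun p ↦
      (hρ p).mdifferentiable (by simp) x
    -- Where `θ` is nonzero the functions `ρ_p` sum to one on a neighbourhood, so their
    -- differentials cancel.
    have hpart : θ x * ∑ p ∈ t, mvfderiv (𝓡 n) (ρ p) x v = 0 := by
      by_cases hx : θ x = 0
      · rw [hx, zero_mul]
      · rw [← (mvfderiv_sum_real t hρd).2 v]
        have hev : (fun y ↦ ∑ p ∈ t, ρ p y) =ᶠ[𝓝 x] fun _ ↦ 1 := by
          filter_upwards [(isOpen_ne.preimage hθ.continuous).mem_nhds hx] with y hy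
          exact hρK y (subset_closure hy)
        rw [mvfderiv_congr_of_eventuallyEq hev, mvfderiv_const]
        simp
    have hterm : ∀ p, |mvfderiv (𝓡 n) (g p) x v - θ x * mvfderiv (𝓡 n) (ρ p) x v|
        ≤ ρ p x * (4 * L * ‖v‖) + ε / (t.card + 1) * ‖v‖ := by
      intro p
      by_cases hx : x ∈ tsupport (ρ p)
      · have hxU := hρU p hx
        have hhd' : MDifferentiableAt (𝓡 n) 𝓘(ℝ, ℝ) (h p) x :=
          ((hh p).contMDiffAt ((hUo p).mem_nhds hxU)).mdifferentiableAt (by simp)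
        have hprod : mvfderiv (𝓡 n) (g p) x v
            = ρ p x * mvfderiv (𝓡 n) (h p) x v + mvfderiv (𝓡 n) (ρ p) x v * h p x :=
          congrArg (fun L : TangentSpace (𝓡 n) x →L[ℝ] ℝ ↦ L v) (mvfderiv_smul (hρd p) hhd')
        have h1 : mvfderiv (𝓡 n) (g p) x v - θ x * mvfderiv (𝓡 n) (ρ p) x v
            = ρ p x * mvfderiv (𝓡 n) (h p) x v
              + (h p x - θ x) * mvfderiv (𝓡 n) (ρ p) x v := by
          rw [hprod]
          ring
        rw [h1]
        refine (abs_add_le _ _).trans (add_le_add ?_ ?_)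
        · rw [abs_mul, abs_of_nonneg (hρ0 p x)]
          exact mul_le_mul_of_nonneg_left (hhd p x hxU v) (hρ0 p x)
        · rw [abs_mul]
          calc |h p x - θ x| * |mvfderiv (𝓡 n) (ρ p) x v| ≤ δ p * (C p * ‖v‖) :=
                mul_le_mul (hhc p x hxU) (hC p x v) (abs_nonneg _) (hδ p).le
            _ = δ p * C p * ‖v‖ := by ring
            _ ≤ ε / (t.card + 1) * ‖v‖ := mul_le_mul_of_nonneg_right (hδC p) (norm_nonneg v)
      · rw [mvfderiv_eq_zero_of_notMem_tsupport hx,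
          mvfderiv_eq_zero_of_notMem_tsupport fun h ↦ hx (hgs p h)]
        have := hρ0 p x
        simp only [zero_apply, mul_zero, sub_zero, abs_zero]
        positivity
    have hsum : mvfderiv (𝓡 n) (fun x ↦ ∑ p ∈ t, g p x) x v
        = ∑ p ∈ t, (mvfderiv (𝓡 n) (g p) x v - θ x * mvfderiv (𝓡 n) (ρ p) x v) := by
      rw [(mvfderiv_sum_real t hgd).2 v, Finset.sum_sub_distrib, ← Finset.mul_sum, hpart, sub_zero]
    rw [hsum]
    refine (Finset.abs_sum_le_sum_abs _ _).trans ((Finset.sum_le_sum fun p _ ↦ hterm p).trans ?_)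
    rw [Finset.sum_add_distrib, ← Finset.sum_mul, Finset.sum_const, nsmul_eq_mul]
    have h1 : (∑ p ∈ t, ρ p x) * (4 * L * ‖v‖) ≤ 4 * L * ‖v‖ :=
      mul_le_of_le_one_left (by positivity) (hρ1 x)
    have h2 : (t.card : ℝ) * (ε / (t.card + 1) * ‖v‖) ≤ ε * ‖v‖ := by
      rw [← mul_assoc]
      refine mul_le_mul_of_nonneg_right ?_ (norm_nonneg v)
      rw [mul_div_assoc', div_le_iff₀ (by positivity)]
      nlinarith
    linarith

end Cutoff

/-! ### Cutoff functions on a complete manifold. -/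

section LipschitzCutoff

open scoped NNReal

variable {M : Type*} [EMetricSpace M]

/-- The distance to a set, truncated at `c`. -/
def truncInfDist (S : Set M) (c : ℝ≥0) (x : M) : ℝ := (min (Metric.infEDist x S) c).toReal

/-- Truncation keeps the distance to `S` finite even on components that `S` misses, while the
triangle inequality survives. -/
lemma truncInfDist_le_add (S : Set M) (c : ℝ≥0) {x y : M} (h : edist x y ≠ ⊤) :
    truncInfDist S c x ≤ truncInfDist S c y + (edist x y).toReal := by
  have htop : ∀ z, min (Metric.infEDist z S) (c : ℝ≥0∞) ≠ ⊤ := fun z ↦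
    ne_top_of_le_ne_top ENNReal.coe_ne_top (min_le_right _ _)
  rw [truncInfDist, truncInfDist, ← ENNReal.toReal_add (htop y) h]
  refine ENNReal.toReal_mono (ENNReal.add_ne_top.2 ⟨htop y, h⟩) ?_
  rcases le_total (Metric.infEDist y S) (c : ℝ≥0∞) with hc | hc
  · rw [min_eq_left hc]
    exact (min_le_left _ _).trans Metric.infEDist_le_infEDist_add_edist
  · rw [min_eq_right hc]
    exact (min_le_right _ _).trans le_self_add

lemma truncInfDist_le (S : Set M) (c : ℝ≥0) (x : M) : truncInfDist S c x ≤ c :=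
  ENNReal.toReal_mono (b := (c : ℝ≥0∞)) ENNReal.coe_ne_top (min_le_right _ _)

/-- A Lipschitz function which is `1` at distance at most `r` from `S` and `0` at distance at least
`2 r` from `S`. -/
def lipCutoff (S : Set M) (r : ℝ≥0) (x : M) : ℝ := min 1 (2 - truncInfDist S (2 * r) x / r)

lemma lipschitzWith_lipCutoff (S : Set M) {r : ℝ≥0} (hr : 0 < r) :
    LipschitzWith r⁻¹ (lipCutoff S r) := by
  intro x y
  have hr' : (0 : ℝ) < r := hr
  by_cases h : edist x y = ⊤
  · rw [h, ENNReal.mul_top (by simpa using hr.ne')]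
    exact le_top
  have h1 := truncInfDist_le_add S (2 * r) h
  have h2 := truncInfDist_le_add S (2 * r) (x := y) (y := x) (by rwa [edist_comm])
  rw [edist_comm y x] at h2
  have h3 : |lipCutoff S r x - lipCutoff S r y| ≤ (edist x y).toReal / r := by
    refine (abs_min_sub_min_le_max _ _ _ _).trans ?_
    rw [sub_self, abs_zero, max_eq_right (abs_nonneg _), sub_sub_sub_cancel_left, ← sub_div, abs_div,
      abs_of_pos hr']
    refine div_le_div_of_nonneg_right ?_ hr'.le
    rw [abs_le]
    constructor <;> linarith
  rw [edist_dist, Real.dist_eq]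
  refine (ENNReal.ofReal_le_ofReal h3).trans (le_of_eq ?_)
  rw [ENNReal.ofReal_div_of_pos hr', ENNReal.ofReal_toReal h, ENNReal.ofReal_coe_nnreal,
    ENNReal.div_eq_inv_mul, ENNReal.coe_inv hr.ne']

lemma lipCutoff_nonneg (S : Set M) {r : ℝ≥0} (hr : 0 < r) (x : M) : 0 ≤ lipCutoff S r x := by
  have hr' : (0 : ℝ) < r := hr
  refine le_min zero_le_one ?_
  rw [sub_nonneg, div_le_iff₀ hr']
  exact (truncInfDist_le S (2 * r) x).trans (by simp)

lemma lipCutoff_le_one (S : Set M) (r : ℝ≥0) (x : M) : lipCutoff S r x ≤ 1 := min_le_left _ _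

lemma lipCutoff_eq_one {S : Set M} {r : ℝ≥0} (hr : 0 < r) {x : M} (h : Metric.infEDist x S ≤ r) :
    lipCutoff S r x = 1 := by
  have hr' : (0 : ℝ) < r := hr
  refine min_eq_left ?_
  have : truncInfDist S (2 * r) x ≤ r :=
    ENNReal.toReal_mono (b := (r : ℝ≥0∞)) ENNReal.coe_ne_top ((min_le_left _ _).trans h)
  have := (div_le_one hr').2 this
  linarith

lemma infEDist_lt_of_lipCutoff_ne_zero {S : Set M} {r : ℝ≥0} (hr : 0 < r) {x : M}
    (h : lipCutoff S r x ≠ 0) : Metric.infEDist x S < (2 * r : ℝ≥0) := by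
  by_contra hlt
  refine h ?_
  have hr' : (0 : ℝ) < r := hr
  rw [lipCutoff, truncInfDist, min_eq_right (not_lt.1 hlt)]
  have hne := hr'.ne'
  simp [hne]

/-- A complete Riemannian manifold carries a sequence of smooth compactly supported functions
which converges to `1` and whose gradients converge uniformly to zero. -/
lemma exists_cutoffs {n : ℕ} {M : Type*} [EMetricSpace M] [ChartedSpace (𝔼 n) M]
    [IsManifold (𝓡 n) ∞ M] [SecondCountableTopology M] [MeasurableSpace M] [BorelSpace M]
    [RiemannianBundle (fun x : M ↦ TangentSpace (𝓡 n) x)]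
    [IsContMDiffRiemannianBundle (𝓡 n) ∞ (𝔼 n) (fun x : M ↦ TangentSpace (𝓡 n) x)]
    [IsRiemannianManifold (𝓡 n) M] [CompleteSpace M] :
    ∃ χ : ℕ → M → ℝ, (∀ k, ContMDiff (𝓡 n) 𝓘(ℝ, ℝ) ∞ (χ k)) ∧ (∀ k, HasCompactSupport (χ k)) ∧
      (∀ k x, |χ k x| ≤ 2) ∧ (∀ x, Filter.Tendsto (fun k ↦ χ k x) Filter.atTop (𝓝 1)) ∧
      ∀ (k : ℕ) (x : M) (v : TangentSpace (𝓡 n) x),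
        |mvfderiv (𝓡 n) (χ k) x v| ≤ 5 / ((k : ℝ) + 1) * ‖v‖ := by
  rcases isEmpty_or_nonempty M with hM | hM
  · exact ⟨fun _ _ ↦ 0, fun _ ↦ contMDiff_const, fun _ ↦ HasCompactSupport.zero, fun _ x ↦
      hM.elim x, fun x ↦ hM.elim x, fun _ x ↦ hM.elim x⟩
  have : LocallyCompactSpace M := ChartedSpace.locallyCompactSpace (𝔼 n) M
  let q := TopologicalSpace.denseSeq M
  -- Since `M` may have several components, balls about one point need not exhaust it; the first `k
  -- + 1` points of a dense sequence replace the base point.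
  let S : ℕ → Set M := fun k ↦ q '' Set.Iic k
  let r : ℕ → ℝ≥0 := fun k ↦ k + 1
  have hr : ∀ k, 0 < r k := fun k ↦ by positivity
  have hcs : ∀ k, HasCompactSupport (lipCutoff (S k) (r k)) := by
    intro k
    refine HasCompactSupport.intro (K := ⋃ j ∈ Finset.range (k + 1),
      Metric.closedEBall (q j) ((2 * r k : ℝ≥0) : ℝ≥0∞)) ((Finset.range (k + 1)).isCompact_biUnion
        fun j _ ↦ (hasSplitDistance n M).isCompact_closedEBall (q j) (2 * r k)) fun x hx ↦ ?_
    by_contra h0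
    obtain ⟨y, ⟨j, hj, rfl⟩, hy⟩ := Metric.infEDist_lt_iff.1
      (infEDist_lt_of_lipCutoff_ne_zero (hr k) h0)
    exact hx (Set.mem_biUnion (Finset.mem_coe.2 (Finset.mem_range.2 (Nat.lt_succ_of_le hj))) hy.le)
  -- With Lipschitz constant and error both `1 / (k + 1)`, the gradient bound `4 L + ε` becomes `5 /
  -- (k + 1)`. As the error is at most one and the Lipschitz cutoff lies in `[0, 1]`, `|χ| ≤ 2`.
  choose χ h1 h2 h3 h4 using fun k ↦ exists_smoothing (n := n)
    (lipschitzWith_lipCutoff (S k) (hr k)) (hcs k) (ε := 1 / ((k : ℝ) + 1)) (by positivity)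
  have hle : ∀ k : ℕ, 1 / ((k : ℝ) + 1) ≤ 1 := fun k ↦ by
    rw [div_le_one (by positivity)]
    linarith [(Nat.cast_nonneg k : (0 : ℝ) ≤ k)]
  refine ⟨χ, h1, h2, fun k x ↦ ?_, fun x ↦ ?_, fun k x v ↦ (h4 k x v).trans (le_of_eq ?_)⟩
  · have ha := h3 k x
    have hb := lipCutoff_nonneg (S k) (hr k) x
    have hc := lipCutoff_le_one (S k) (r k) x
    have hd := hle k
    rw [abs_le] at ha ⊢
    constructor <;> linarith [ha.1, ha.2]
  · obtain ⟨j, hj⟩ : ∃ j, edist x (q j) < 1 := by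
      obtain ⟨j, hj⟩ := (TopologicalSpace.denseRange_denseSeq M).exists_mem_open
        (Metric.isOpen_eball (x := x) (ε := 1)) ⟨x, Metric.mem_eball_self one_pos⟩
      exact ⟨j, by rw [edist_comm]; exact hj⟩
    have hone : ∀ k ≥ j, lipCutoff (S k) (r k) x = 1 := fun k hk ↦ by
      refine lipCutoff_eq_one (hr k) ?_
      refine (Metric.infEDist_le_edist_of_mem
        (Set.mem_image_of_mem q (Set.mem_Iic.2 hk) : q j ∈ S k)).trans (hj.le.trans ?_)
      have : (1 : ℝ≥0) ≤ r k := by simp [r]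
      exact_mod_cast this
    have hz : Filter.Tendsto (fun k : ℕ ↦ 1 / ((k : ℝ) + 1)) Filter.atTop (𝓝 0) :=
      tendsto_one_div_add_atTop_nhds_zero_nat
    rw [tendsto_iff_dist_tendsto_zero]
    refine squeeze_zero' (.of_forall fun _ ↦ dist_nonneg) ?_ hz
    filter_upwards [Filter.eventually_ge_atTop j] with k hk
    have h5 := h3 k x
    rw [hone k hk] at h5
    exact h5
  · simp only [r, NNReal.coe_inv, NNReal.coe_add, NNReal.coe_natCast, NNReal.coe_one]
    ring

end LipschitzCutoff

/-! ### Completeness of `L²` for a general family of fibres. -/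

section RieszFischer

open Filter

namespace FibreMetric

variable {M : Type*} [MeasurableSpace M] {W : M → Type*}
  [∀ x, AddCommGroup (W x)] [∀ x, Module ℂ (W x)] (m : FibreMetric W) (μ : Measure M)

/-- The norm of a vector in a fibre. -/
def fnorm (x : M) (w : W x) : ℝ := Real.sqrt ((m.core x).inner w w).re

lemma fnorm_nonneg (x : M) (w : W x) : 0 ≤ m.fnorm x w := Real.sqrt_nonneg _

lemma normSq_nonneg (s : Π x, W x) (x : M) : 0 ≤ m.normSq s x := (m.core x).re_inner_nonneg _

lemma fnorm_sq (s : Π x, W x) (x : M) : m.fnorm x (s x) ^ 2 = m.normSq s x :=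
  Real.sq_sqrt (m.normSq_nonneg s x)

lemma fnorm_add_le (x : M) (v w : W x) : m.fnorm x (v + w) ≤ m.fnorm x v + m.fnorm x w := by
  let _ := m.core x
  let _ := (m.core x).toNormedAddCommGroup
  exact norm_add_le v w

lemma norm_inner_le (x : M) (v w : W x) :
    ‖(m.core x).inner v w‖ ≤ m.fnorm x v * m.fnorm x w := by
  let _ := m.core x
  let _ := (m.core x).toNormedAddCommGroup
  let _ : InnerProductSpace ℂ (W x) := InnerProductSpace.ofCore (m.core x).toCore
  exact norm_inner_le_norm v w

lemma abs_fnorm_sub_le (x : M) (v w : W x) : |m.fnorm x v - m.fnorm x w| ≤ m.fnorm x (v - w) := by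
  let _ := m.core x
  let _ := (m.core x).toNormedAddCommGroup
  exact abs_norm_sub_norm_le v w

lemma norm_toL2_sq (s : m.squareIntegrable μ) :
    ‖m.toL2 μ s‖ ^ 2 = ∫ x, m.normSq s.1 x ∂μ := by
  have h := inner_self_eq_norm_sq (𝕜 := ℂ) (m.toL2 μ s)
  rw [inner_toL2] at h
  rw [← h]
  exact (integral_re (m.inner_integrable μ s.2.1 s.2.2 s.2.1 s.2.2)).symm

lemma toL2_surjective : Function.Surjective (m.toL2 μ) := fun u ↦
  (SeparationQuotient.surjective_mk u).imp fun _ h ↦ h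

lemma lintegral_normSq (s : m.squareIntegrable μ) :
    ∫⁻ x, ENNReal.ofReal (m.normSq s.1 x) ∂μ = ENNReal.ofReal (‖m.toL2 μ s‖ ^ 2) := by
  rw [norm_toL2_sq, ofReal_integral_eq_lintegral_ofReal s.2.2
    (.of_forall fun x ↦ m.normSq_nonneg s.1 x)]

lemma aestronglyMeasurable_normSq {s : Π x, W x} (hs : s ∈ m.measurableSections μ) :
    AEStronglyMeasurable (m.normSq s) μ :=
  Complex.continuous_re.comp_aestronglyMeasurable (m.aestronglyMeasurable_inner μ s s hs hs)

lemma mem_squareIntegrable_of_lintegral {s : Π x, W x} (hs : s ∈ m.measurableSections μ)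
    (h : ∫⁻ x, ENNReal.ofReal (m.normSq s x) ∂μ ≠ ⊤) : s ∈ m.squareIntegrable μ := by
  refine ⟨hs, m.aestronglyMeasurable_normSq μ hs, ?_⟩
  rw [hasFiniteIntegral_iff_ofReal (.of_forall fun x ↦ m.normSq_nonneg s x)]
  exact h.lt_top

/-- Sequences of measurable sections with summable increments converge almost everywhere, to a
measurable section. -/
def HasLimits : Prop :=
  ∀ s : ℕ → Π x, W x, (∀ k, s k ∈ m.measurableSections μ) →
    (∀ᵐ x ∂μ, Summable fun k ↦ m.fnorm x (s (k + 1) x - s k x)) →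
    ∃ t ∈ m.measurableSections μ, ∀ᵐ x ∂μ, Tendsto (fun k ↦ m.fnorm x (s k x - t x)) atTop (𝓝 0)

/-- With weights `2 ^ k`, the series `∑ 2 ^ k |f_k|²` still has finite integral, so it is finite
almost everywhere. There `|f_k|` is at most a constant times `2 ^ (-k / 2)`, which is summable. -/
lemma ae_summable_fnorm {f : ℕ → Π x, W x} (hf : ∀ k, f k ∈ m.measurableSections μ)
    (hle : ∀ k, ∫⁻ x, ENNReal.ofReal (m.normSq (f k) x) ∂μ ≤ ENNReal.ofReal ((1 / 4) ^ k)) :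
    ∀ᵐ x ∂μ, Summable fun k ↦ m.fnorm x (f k x) := by
  let g : ℕ → M → ℝ≥0∞ := fun k x ↦ ENNReal.ofReal (2 ^ k) * ENNReal.ofReal (m.normSq (f k) x)
  have hg : ∀ k, AEMeasurable (g k) μ := fun k ↦
    (m.aestronglyMeasurable_normSq μ (hf k)).aemeasurable.ennreal_ofReal.const_mul _
  have hgk : ∀ k, ∫⁻ x, g k x ∂μ ≤ ENNReal.ofReal ((1 / 2) ^ k) := by
    intro k
    rw [lintegral_const_mul' _ _ ENNReal.ofReal_ne_top]
    refine (mul_le_mul_right (hle k) _).trans (le_of_eq ?_)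
    rw [← ENNReal.ofReal_mul (by positivity), ← mul_pow]
    norm_num
  have hsum : ∫⁻ x, ∑' k, g k x ∂μ ≠ ⊤ := by
    rw [lintegral_tsum hg]
    refine ne_top_of_le_ne_top ?_ (ENNReal.tsum_le_tsum hgk)
    rw [← ENNReal.ofReal_tsum_of_nonneg (fun k ↦ by positivity)
      (summable_geometric_of_lt_one (by norm_num) (by norm_num))]
    exact ENNReal.ofReal_ne_top
  filter_upwards [ae_lt_top' (AEMeasurable.tsum hg) hsum] with x hx
  have hC : ∀ k, 2 ^ k * m.normSq (f k) x ≤ (∑' k, g k x).toReal := by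
    intro k
    have h1 : g k x ≤ ∑' k, g k x := ENNReal.le_tsum k
    have h2 := ENNReal.toReal_mono hx.ne h1
    simp only [g] at h2
    rwa [ENNReal.toReal_mul, ENNReal.toReal_ofReal (by positivity),
      ENNReal.toReal_ofReal (m.normSq_nonneg _ x)] at h2
  have hb : ∀ k, m.fnorm x (f k x) ≤ Real.sqrt (∑' k, g k x).toReal * Real.sqrt (1 / 2) ^ k := by
    intro k
    have h1 : m.normSq (f k) x ≤ (∑' k, g k x).toReal * (1 / 2) ^ k := by
      have := mul_le_mul_of_nonneg_left (hC k) (by positivity : (0 : ℝ) ≤ (1 / 2) ^ k)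
      rw [← mul_assoc, ← mul_pow] at this
      norm_num at this ⊢
      linarith
    refine Real.sqrt_le_iff.2 ⟨by positivity, ?_⟩
    rw [mul_pow, Real.sq_sqrt ENNReal.toReal_nonneg, ← pow_mul, mul_comm k 2, pow_mul,
      Real.sq_sqrt (by norm_num)]
    exact h1
  refine Summable.of_nonneg_of_le (fun k ↦ m.fnorm_nonneg x _) hb ?_
  refine (summable_geometric_of_lt_one (Real.sqrt_nonneg _) ?_).mul_left _
  rw [Real.sqrt_lt' one_pos]
  norm_num

/-- The Riesz-Fischer theorem. -/
lemma completeSpace_L2 (h : m.HasLimits μ) : CompleteSpace (m.L2 μ) := by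
  refine Metric.complete_of_convergent_controlled_sequences (fun k ↦ (1 / 2 : ℝ) ^ k)
    (fun k ↦ by positivity) fun u hu ↦ ?_
  choose s hs using fun k ↦ m.toL2_surjective μ (u k)
  have hdist : ∀ N k j, N ≤ k → N ≤ j →
      ∫⁻ x, ENNReal.ofReal (m.normSq ((s k).1 - (s j).1) x) ∂μ ≤ ENNReal.ofReal ((1 / 4) ^ N) := by
    intro N k j hk hj
    have h1 := m.lintegral_normSq μ (s k - s j)
    rw [map_sub, hs, hs, ← dist_eq_norm] at h1
    refine (le_of_eq h1).trans (ENNReal.ofReal_le_ofReal ?_)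
    calc dist (u k) (u j) ^ 2 ≤ ((1 / 2) ^ N) ^ 2 :=
          pow_le_pow_left₀ dist_nonneg (hu N k j hk hj).le 2
      _ = (1 / 4) ^ N := by rw [← pow_mul, mul_comm, pow_mul]; norm_num
  obtain ⟨t, ht, hlim⟩ := h (fun k ↦ (s k).1) (fun k ↦ (s k).2.1)
    (m.ae_summable_fnorm μ (f := fun k ↦ (s (k + 1)).1 - (s k).1)
      (fun k ↦ sub_mem (s (k + 1)).2.1 (s k).2.1) fun k ↦ hdist k (k + 1) k (by omega) le_rfl)
  -- Fatou's lemma carries the Cauchy estimate to the pointwise limit; it yields both `t ∈ L²` and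
  -- the convergence.
  have hfatou : ∀ N, ∫⁻ x, ENNReal.ofReal (m.normSq (t - (s N).1) x) ∂μ
      ≤ ENNReal.ofReal ((1 / 4) ^ N) := by
    intro N
    have h1 : ∀ᵐ x ∂μ, Tendsto (fun k ↦ ENNReal.ofReal (m.normSq ((s k).1 - (s N).1) x)) atTop
        (𝓝 (ENNReal.ofReal (m.normSq (t - (s N).1) x))) := by
      filter_upwards [hlim] with x hx
      refine ENNReal.tendsto_ofReal ?_
      simp_rw [← fnorm_sq]
      refine Tendsto.pow ?_ 2
      rw [tendsto_iff_dist_tendsto_zero]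
      refine squeeze_zero (fun _ ↦ dist_nonneg) (fun k ↦ ?_) hx
      rw [Real.dist_eq]
      refine (m.abs_fnorm_sub_le x _ _).trans (le_of_eq ?_)
      simp only [Pi.sub_apply, sub_sub_sub_cancel_right]
    have h2 : ∫⁻ x, ENNReal.ofReal (m.normSq (t - (s N).1) x) ∂μ
        ≤ liminf (fun k ↦ ∫⁻ x, ENNReal.ofReal (m.normSq ((s k).1 - (s N).1) x) ∂μ) atTop := by
      refine (lintegral_mono_ae ?_).trans (lintegral_liminf_le' fun k ↦
        (m.aestronglyMeasurable_normSq μ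
          (sub_mem (s k).2.1 (s N).2.1)).aemeasurable.ennreal_ofReal)
      filter_upwards [h1] with x hx
      exact hx.liminf_eq.ge
    refine h2.trans (liminf_le_of_frequently_le' (Eventually.frequently ?_))
    filter_upwards [eventually_ge_atTop N] with k hk
    exact hdist N k N hk le_rfl
  have hts : ∀ N, t - (s N).1 ∈ m.squareIntegrable μ := fun N ↦
    m.mem_squareIntegrable_of_lintegral μ (sub_mem ht (s N).2.1)
      (ne_top_of_le_ne_top ENNReal.ofReal_ne_top (hfatou N))
  have htm : t ∈ m.squareIntegrable μ := by
    have := add_mem (hts 0) (s 0).2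
    simpa using this
  refine ⟨m.toL2 μ ⟨t, htm⟩, ?_⟩
  rw [tendsto_iff_dist_tendsto_zero]
  refine squeeze_zero (fun _ ↦ dist_nonneg) (fun N ↦ ?_)
    (tendsto_pow_atTop_nhds_zero_of_lt_one (by norm_num : (0 : ℝ) ≤ 1 / 2) (by norm_num))
  have h1 := m.lintegral_normSq μ ⟨t - (s N).1, hts N⟩
  have h2 : m.toL2 μ ⟨t - (s N).1, hts N⟩ = m.toL2 μ ⟨t, htm⟩ - u N := by
    rw [← hs N, ← map_sub]
    rfl
  have h3 := h1.symm.le.trans (hfatou N)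
  rw [h2, ENNReal.ofReal_le_ofReal_iff (by positivity)] at h3
  rw [dist_comm, dist_eq_norm]
  refine le_of_sq_le_sq ?_ (by positivity)
  calc ‖m.toL2 μ ⟨t, htm⟩ - u N‖ ^ 2 ≤ (1 / 4) ^ N := h3
    _ = ((1 / 2) ^ N) ^ 2 := by rw [← pow_mul, mul_comm N, pow_mul]; norm_num

end FibreMetric
end RieszFischer

/-! ### Completeness of `L²(V)` and `L²(T*M ⊗ V)`. -/

section Completeness

open Filter

lemma finiteDimensional_fibre {M : Type*} [TopologicalSpace M] (F : Type*)
    [NormedAddCommGroup F] [NormedSpace ℂ F] [FiniteDimensional ℂ F] {V : M → Type*}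
    [TopologicalSpace (TotalSpace F V)] [∀ x, NormedAddCommGroup (V x)]
    [∀ x, InnerProductSpace ℂ (V x)] [FiberBundle F V] [VectorBundle ℂ F V] (x : M) :
    FiniteDimensional ℂ (V x) :=
  ((trivializationAt F V x).continuousLinearEquivAt ℂ x
    (FiberBundle.mem_baseSet_trivializationAt F V x)).symm.toLinearEquiv.finiteDimensional

lemma completeSpace_fibre {M : Type*} [TopologicalSpace M] (F : Type*)
    [NormedAddCommGroup F] [NormedSpace ℂ F] [FiniteDimensional ℂ F] {V : M → Type*}
    [TopologicalSpace (TotalSpace F V)] [∀ x, NormedAddCommGroup (V x)]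
    [∀ x, InnerProductSpace ℂ (V x)] [FiberBundle F V] [VectorBundle ℂ F V] (x : M) :
    CompleteSpace (V x) :=
  have := finiteDimensional_fibre F (V := V) x
  FiniteDimensional.complete ℂ (V x)

variable {n : ℕ} {M : Type*} [TopologicalSpace M] [ChartedSpace (𝔼 n) M]
  [IsManifold (𝓡 n) ∞ M] [SecondCountableTopology M] [T2Space M] [MeasurableSpace M] [BorelSpace M]
  [RiemannianBundle (fun x : M ↦ TangentSpace (𝓡 n) x)]
  [IsContMDiffRiemannianBundle (𝓡 n) ∞ (𝔼 n) (fun x : M ↦ TangentSpace (𝓡 n) x)]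
  {F : Type*} [NormedAddCommGroup F] [NormedSpace ℂ F] [FiniteDimensional ℂ F]
  {V : M → Type*} [TopologicalSpace (TotalSpace F V)] [∀ x, NormedAddCommGroup (V x)]
  [∀ x, InnerProductSpace ℂ (V x)] [FiberBundle F V] [VectorBundle ℂ F V] [VectorBundle ℝ F V]
  [ContMDiffVectorBundle ∞ F V (𝓡 n)] [IsSmoothHermitianBundle n F V]

lemma bundleMetric_fnorm (x : M) (v : V x) : (bundleMetric n F V).fnorm x v = ‖v‖ :=
  (norm_eq_sqrt_re_inner (𝕜 := ℂ) v).symm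

lemma measurableSections_of_tendsto {ν : Measure M} {s : ℕ → Π x : M, V x} {t : Π x : M, V x}
    (hs : ∀ k, s k ∈ (bundleMetric n F V).measurableSections ν)
    (h : ∀ᵐ x ∂ν, Tendsto (fun k ↦ s k x) atTop (𝓝 (t x))) :
    t ∈ (bundleMetric n F V).measurableSections ν := by
  intro p
  refine aestronglyMeasurable_of_tendsto_ae atTop (fun k ↦ hs k p) ?_
  filter_upwards [ae_restrict_of_ae h,
    ae_restrict_mem (trivializationAt F V p).open_baseSet.measurableSet] with x hx hxp
  have h1 := (((trivializationAt F V p).continuousLinearMapAt ℝ x).continuous.tendsto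
    (t x)).comp hx
  have h2 : ∀ v : V x, (trivializationAt F V p).continuousLinearMapAt ℝ x v
      = (trivializationAt F V p ⟨x, v⟩).2 := fun v ↦
    (trivializationAt F V p).continuousLinearMapAt_apply_of_mem ℝ hxp v
  simp only [Function.comp_def, h2] at h1
  exact h1

lemma hasLimits_bundleMetric (ν : Measure M) : (bundleMetric n F V).HasLimits ν := by
  intro s hs hsum
  simp only [bundleMetric_fnorm] at hsum ⊢
  have hlim : ∀ᵐ x ∂ν, Tendsto (fun k ↦ s k x) atTop (𝓝 (limUnder atTop fun k ↦ s k x)) := by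
    filter_upwards [hsum] with x hx
    have := completeSpace_fibre F (V := V) x
    refine CauchySeq.tendsto_limUnder (cauchySeq_of_summable_dist ?_)
    simpa only [dist_eq_norm, norm_sub_rev] using hx
  refine ⟨fun x ↦ limUnder atTop fun k ↦ s k x, measurableSections_of_tendsto hs hlim, ?_⟩
  filter_upwards [hlim] with x hx
  exact tendsto_iff_norm_sub_tendsto_zero.1 hx

lemma homMetric_fnorm_sq (x : M) (A : TangentSpace (𝓡 n) x →L[ℝ] V x) :
    (homMetric n (bundleMetric n F V)).fnorm x A ^ 2
      = ∑ i, ‖A (stdOrthonormalBasis ℝ (TangentSpace (𝓡 n) x) i)‖ ^ 2 := by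
  have h : (((homMetric n (bundleMetric n F V)).core x).inner A A).re
      = ∑ i, ‖A (stdOrthonormalBasis ℝ (TangentSpace (𝓡 n) x) i)‖ ^ 2 := by
    change (∑ i, (inner ℂ (A (stdOrthonormalBasis ℝ (TangentSpace (𝓡 n) x) i))
      (A (stdOrthonormalBasis ℝ (TangentSpace (𝓡 n) x) i)) : ℂ)).re = _
    rw [Complex.re_sum]
    exact Finset.sum_congr rfl fun i _ ↦ inner_self_eq_norm_sq (𝕜 := ℂ) _
  rw [FibreMetric.fnorm, h]
  exact Real.sq_sqrt (Finset.sum_nonneg fun i _ ↦ sq_nonneg _)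

lemma norm_apply_le_fnorm (x : M) (A : TangentSpace (𝓡 n) x →L[ℝ] V x)
    (v : TangentSpace (𝓡 n) x) :
    ‖A v‖ ≤ (homMetric n (bundleMetric n F V)).fnorm x A * ‖v‖ := by
  set e := stdOrthonormalBasis ℝ (TangentSpace (𝓡 n) x)
  have hA : A v = ∑ i, (inner ℝ (e i) v : ℝ) • A (e i) := by
    conv_lhs => rw [← e.sum_repr' v, map_sum]
    simp_rw [map_smul]
  refine le_of_sq_le_sq ?_ (mul_nonneg ((homMetric n (bundleMetric n F V)).fnorm_nonneg x A)
    (norm_nonneg v))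
  rw [mul_pow, homMetric_fnorm_sq, ← e.sum_sq_norm_inner_right v]
  have h1 : ‖A v‖ ≤ ∑ i, ‖(inner ℝ (e i) v : ℝ)‖ * ‖A (e i)‖ := by
    rw [hA]
    exact (norm_sum_le _ _).trans_eq (Finset.sum_congr rfl fun i _ ↦ norm_smul _ _)
  calc ‖A v‖ ^ 2 ≤ (∑ i, ‖(inner ℝ (e i) v : ℝ)‖ * ‖A (e i)‖) ^ 2 :=
        pow_le_pow_left₀ (norm_nonneg _) h1 2
    _ ≤ (∑ i, ‖(inner ℝ (e i) v : ℝ)‖ ^ 2) * ∑ i, ‖A (e i)‖ ^ 2 :=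
        Finset.sum_mul_sq_le_sq_mul_sq _ _ _
    _ = _ := mul_comm _ _

/-- The Hilbert-Schmidt norm dominates the operator norm, so the sequence converges in the complete
space of operators. Convergence in the Hilbert-Schmidt norm is then checked on finitely many basis
vectors. -/
lemma hasLimits_homMetric (ν : Measure M) :
    (homMetric n (bundleMetric n F V)).HasLimits ν := by
  intro A hA hsum
  have hlim : ∀ᵐ x ∂ν, Tendsto (fun k ↦ A k x) atTop (𝓝 (limUnder atTop fun k ↦ A k x)) := by
    filter_upwards [hsum] with x hx
    have := completeSpace_fibre F (V := V) x
    have hs : Summable fun k ↦ dist (A k x) (A (k + 1) x) := by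
      refine Summable.of_nonneg_of_le (fun k ↦ dist_nonneg (x := A k x) (y := A (k + 1) x))
        (fun k ↦ ?_) hx
      rw [dist_comm]
      refine (dist_eq_norm (E := TangentSpace (𝓡 n) x →L[ℝ] V x) (A (k + 1) x) (A k x)).trans_le ?_
      exact ContinuousLinearMap.opNorm_le_bound _ ((homMetric n (bundleMetric n F V)).fnorm_nonneg x _)
        (norm_apply_le_fnorm x _)
    exact CauchySeq.tendsto_limUnder (cauchySeq_of_summable_dist hs)
  have happly : ∀ᵐ x ∂ν, ∀ v, Tendsto (fun k ↦ A k x v) atTop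
      (𝓝 ((limUnder atTop fun k ↦ A k x) v)) := by
    filter_upwards [hlim] with x hx v
    exact ((ContinuousLinearMap.apply ℝ (V x) v).continuous.tendsto _).comp hx
  refine ⟨fun x ↦ limUnder atTop fun k ↦ A k x, fun p i ↦ ?_, ?_⟩
  · refine measurableSections_of_tendsto (fun k ↦ hA k p i) ?_
    filter_upwards [ae_restrict_of_ae happly] with x hx
    exact hx _
  · filter_upwards [happly] with x hx
    have h1 : Tendsto (fun k ↦ (homMetric n (bundleMetric n F V)).fnorm x
        (A k x - limUnder atTop fun k ↦ A k x) ^ 2) atTop (𝓝 0) := by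
      simp_rw [homMetric_fnorm_sq]
      rw [show (0 : ℝ) = ∑ i : Fin (Module.finrank ℝ (TangentSpace (𝓡 n) x)), (0 : ℝ) by simp]
      refine tendsto_finsetSum _ fun i _ ↦ ?_
      have h2 := (tendsto_iff_norm_sub_tendsto_zero.1
        (hx (stdOrthonormalBasis ℝ (TangentSpace (𝓡 n) x) i))).pow 2
      simpa using h2
    have h3 := (Real.continuous_sqrt.tendsto 0).comp h1
    simpa [Function.comp_def, Real.sqrt_sq ((homMetric n (bundleMetric n F V)).fnorm_nonneg x _)]
      using h3

variable (D : HermitianConnection n F V)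

/-- Completeness of the targets is what allows bounded maps to be extended to the Sobolev
completions. -/
instance : CompleteSpace D.L2V := FibreMetric.completeSpace_L2 _ _ (hasLimits_bundleMetric _)

instance : CompleteSpace D.L2TV := FibreMetric.completeSpace_L2 _ _ (hasLimits_homMetric _)

end Completeness

/-! ### Closedness of `div`, closability of `∇_c` and single-valuedness of the Laplacian. -/

section Closability

variable {n : ℕ} {M : Type*} [TopologicalSpace M] [ChartedSpace (𝔼 n) M]
  [IsManifold (𝓡 n) ∞ M] [SecondCountableTopology M] [T2Space M] [MeasurableSpace M] [BorelSpace M]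
  [RiemannianBundle (fun x : M ↦ TangentSpace (𝓡 n) x)]
  [IsContMDiffRiemannianBundle (𝓡 n) ∞ (𝔼 n) (fun x : M ↦ TangentSpace (𝓡 n) x)]
  {F : Type*} [NormedAddCommGroup F] [NormedSpace ℂ F] [FiniteDimensional ℂ F]
  {V : M → Type*} [TopologicalSpace (TotalSpace F V)] [∀ x, NormedAddCommGroup (V x)]
  [∀ x, InnerProductSpace ℂ (V x)] [FiberBundle F V] [VectorBundle ℂ F V] [VectorBundle ℝ F V]
  [ContMDiffVectorBundle ∞ F V (𝓡 n)] [IsSmoothHermitianBundle n F V]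

lemma measurableSections_restrict {ν : Measure M} {s : Π x : M, V x}
    (hs : s ∈ (bundleMetric n F V).measurableSections ν) (U : Set M) :
    s ∈ (bundleMetric n F V).measurableSections (ν.restrict U) := fun p ↦
  (hs p).mono_measure (Measure.restrict_mono le_rfl Measure.restrict_le_self)

/-- A square integrable section that is orthogonal to `C_c^∞(V)` vanishes almost everywhere. -/
lemma ae_eq_zero_of_orthogonal {s : Π x : M, V x}
    (hs : s ∈ (bundleMetric n F V).squareIntegrable (riemannianVolume n M))
    (h : ∀ v ∈ HermitianConnection.smoothSections n F V, IsCompact (secSupport v) →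
      ∫ x, (inner ℂ (v x) (s x) : ℂ) ∂(riemannianVolume n M) = 0) :
    ∀ᵐ x ∂(riemannianVolume n M), s x = 0 := by
  have : LocallyCompactSpace M := ChartedSpace.locallyCompactSpace (𝔼 n) M
  let b := Module.finBasis ℝ F
  have hp : ∀ p : M, ∀ᵐ x ∂(riemannianVolume n M),
      x ∈ (trivializationAt F V p).baseSet → s x = 0 := by
    intro p
    let e := trivializationAt F V p
    have he : ∀ i, SmoothSectionOn n F (fun x ↦ e.localFrame b i x) e.baseSet := fun i ↦
      Bundle.Trivialization.contMDiffOn_localFrame_baseSet (I := 𝓡 n) ∞ e b i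
    -- Testing against `g eᵢ` with `g` supported in the trivialization domain shows that the
    -- function `⟨eᵢ, s⟩` is zero almost everywhere there.
    have hi : ∀ i, ∀ᵐ x ∂(riemannianVolume n M), x ∈ e.baseSet →
        (inner ℂ (e.localFrame b i x) (s x) : ℂ) = 0 := by
      intro i
      refine IsOpen.ae_eq_zero_of_integral_contMDiff_smul_eq_zero (𝓡 n) e.open_baseSet ?_ ?_
      · rw [locallyIntegrableOn_iff e.open_baseSet.isLocallyClosed]
        intro K hK hKc
        refine (bundleMetric n F V).inner_integrable _ ?_ ?_ (measurableSections_restrict hs.1 K)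
          (hs.2.mono_measure Measure.restrict_le_self)
        · have h1 := measurableSections_restrict
            (measurable_of_smoothSectionOn (riemannianVolume n M) e.open_baseSet (he i)) K
          rwa [Measure.restrict_restrict hKc.measurableSet, Set.inter_eq_left.2 hK] at h1
        · have h1 : ContinuousOn (fun x ↦ (inner ℂ (e.localFrame b i x)
              (e.localFrame b i x) : ℂ).re) K := fun x hx ↦
            (Complex.continuous_re.continuousAt.comp_continuousWithinAt
              (((he i).inner (he i)).continuousOn x (hK hx))).mono hK
          exact h1.integrableOn_compact hKc
      · intro g hg hgc hgU
        have h1 := h (fun x ↦ g x • e.localFrame b i x)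
          (smul_mem_smoothSections hg e.open_baseSet hgU (he i))
          (hgc.of_isClosed_subset isClosed_closure
            ((secSupport_smul_subset g _).trans Set.inter_subset_left))
        rw [← h1]
        refine integral_congr_ae (.of_forall fun x ↦ ?_)
        beta_reduce
        rw [← Complex.coe_smul (g x) (e.localFrame b i x), inner_smul_left]
        simp
    filter_upwards [ae_all_iff.2 hi] with x hx hxe
    have h0 : (inner ℂ (s x) (s x) : ℂ) = 0 := by
      have h1 : s x = ∑ i, (e.basisAt b hxe).repr (s x) i • e.localFrame b i x := by
        conv_lhs => rw [← (e.basisAt b hxe).sum_repr (s x)]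
        refine Finset.sum_congr rfl fun i _ ↦ ?_
        rw [e.localFrame_apply_of_mem_baseSet b hxe]
      conv_lhs => rw [h1, sum_inner]
      refine Finset.sum_eq_zero fun i _ ↦ ?_
      rw [← Complex.coe_smul, inner_smul_left, ← h1, hx i hxe, mul_zero]
    exact inner_self_eq_zero.1 h0
  obtain ⟨t, ht, htU⟩ := TopologicalSpace.countable_cover_nhds
    (f := fun p ↦ (trivializationAt F V p).baseSet) fun p ↦
      (trivializationAt F V p).open_baseSet.mem_nhds (FiberBundle.mem_baseSet_trivializationAt F V p)
  filter_upwards [(ae_ball_iff ht).2 fun p _ ↦ hp p] with x hx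
  have hxt : x ∈ ⋃ p ∈ t, (trivializationAt F V p).baseSet := htU ▸ Set.mem_univ x
  obtain ⟨p, hpt, hxp⟩ := Set.mem_iUnion₂.1 hxt
  exact hx p hpt hxp

namespace HermitianConnection

variable (D : HermitianConnection n F V)

lemma classV_mem_gradGraph {v : Π x : M, V x} (hv : v ∈ smoothSections n F V)
    (hc : IsCompact (secSupport v)) :
    (D.classV v (squareIntegrable_of_smooth hv hc), D.classTV (D.grad v) (D.memL2TV_grad hv hc))
      ∈ D.gradGraph :=
  ⟨⟨v, hc, hv, squareIntegrable_of_smooth hv hc, D.memL2TV_grad hv hc⟩, rfl⟩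

/-- `C_c^∞(V)` is dense in `L²(V)`. -/
lemma eq_zero_of_mem_divGraph {f : D.L2V} (hf : ((0 : D.L2TV), f) ∈ D.divGraph) : f = 0 := by
  obtain ⟨⟨s, hs⟩, rfl⟩ := FibreMetric.toL2_surjective _ _ f
  have h0 := ae_eq_zero_of_orthogonal hs fun v hv hc ↦ by
    have h1 := hf _ (D.classV_mem_gradGraph hv hc)
    rw [inner_zero_right, eq_comm, neg_eq_zero] at h1
    exact h1
  have h2 := FibreMetric.norm_toL2_sq (bundleMetric n F V) (riemannianVolume n M) ⟨s, hs⟩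
  have h3 : ∫ x, (bundleMetric n F V).normSq s x ∂(riemannianVolume n M) = 0 := by
    refine integral_eq_zero_of_ae ?_
    filter_upwards [h0] with x hx
    rw [← FibreMetric.fnorm_sq, bundleMetric_fnorm, hx]
    simp
  rw [h3] at h2
  exact norm_eq_zero.1 (pow_eq_zero_iff two_ne_zero |>.1 h2)

/-- Green's formula against the elements of `C_c^∞(V)` is the definition of `div`; `u` itself needs
no compact support. -/
lemma mem_divGraph_of_smooth {u : Π x : M, V x} (hu : u ∈ smoothSections n F V)
    (h1 : D.MemL2TV (D.grad u)) (h2 : D.MemL2V (D.trHess u)) :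
    (D.classTV (D.grad u) h1, D.classV (D.trHess u) h2) ∈ D.divGraph := by
  rintro _ ⟨⟨v, hvc, hv, hv1, hv2⟩, rfl⟩
  have hI1 := (homMetric n (bundleMetric n F V)).inner_integrable _ hv2.1 hv2.2 h1.1 h1.2
  have hI2 := (bundleMetric n F V).inner_integrable _ hv1.1 hv1.2 h2.1 h2.2
  have h := (D.integral_greenFun hv hu hvc).2
  rw [eq_neg_iff_add_eq_zero, ← h]
  exact (integral_add hI1 hI2).symm

lemma secSupport_trHess_subset {u : Π x : M, V x} (hu : u ∈ smoothSections n F V) :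
    secSupport (D.trHess u) ⊆ secSupport u := by
  refine closure_minimal (fun x hx ↦ ?_) isClosed_closure
  by_contra h
  refine hx ?_
  obtain ⟨U, hUx, hU, hxU⟩ := mem_nhds_iff.1 (isClosed_closure.isOpen_compl.mem_nhds h)
  have hg : ∀ᶠ y in 𝓝 x, D.grad u y = 0 := by
    filter_upwards [hU.mem_nhds hxU] with y hy
    exact D.grad_eq_zero (mdiffAt_of_smooth hu y) (eventually_eq_zero_of_notMem (hUx hy))
  rw [D.trHess_eq u x (mem_chart_source _ x)]
  refine Finset.sum_eq_zero fun i _ ↦ ?_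
  rw [D.hess_apply_field hu _ (mdiffAt_orthoFrame x (mem_chart_source _ x) i), hg.self_of_nhds]
  have h3 := D.grad_eq_zero (x := x) (u := fun y ↦ D.grad u y (orthoFrame x i y))
    ((contMDiffOn_apply_field (D.contMDiff_grad hu).contMDiffOn
      (smoothFieldOn_orthoFrame x i)).mdiffAt (chartAt (𝔼 n) x).open_source (mem_chart_source _ x))
    (hg.mono fun y hy ↦ by rw [hy]; rfl)
  simp only [h3, zero_apply, sub_zero]

/-- The connection `∇_c` is closable. -/
lemma eq_zero_of_mem_closure_gradGraph {w : D.L2TV}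
    (hw : ((0 : D.L2V), w) ∈ D.gradGraph.topologicalClosure) : w = 0 := by
  -- By Green's formula each `∇v`, with `v` in `C_c^∞(V)`, lies in the domain of `div`, so pairing
  -- with it sends a limit `(0, w)` to zero. Thus `w` is orthogonal to all such `∇v`, yet it is a
  -- limit of them.
  have key : ∀ q ∈ D.gradGraph, (inner ℂ q.2 w : ℂ) = 0 := by
    rintro _ ⟨⟨v, hvc, hv, hv1, hv2⟩, rfl⟩
    have ht : D.MemL2V (D.trHess v) := squareIntegrable_of_smooth (D.smooth_trHess hv)
      (hvc.of_isClosed_subset isClosed_closure (D.secSupport_trHess_subset hv))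
    have hd := D.mem_divGraph_of_smooth hv hv2 ht
    have hcl : IsClosed {p : D.L2V × D.L2TV | (inner ℂ p.2 (D.classTV (D.grad v) hv2) : ℂ)
        = -inner ℂ p.1 (D.classV (D.trHess v) ht)} :=
      isClosed_eq (continuous_snd.inner continuous_const)
        (continuous_fst.inner continuous_const).neg
    have h1 : (inner ℂ w (D.classTV (D.grad v) hv2) : ℂ)
        = -inner ℂ (0 : D.L2V) (D.classV (D.trHess v) ht) :=
      closure_minimal (s := (D.gradGraph : Set (D.L2V × D.L2TV))) (fun p hp ↦ hd p hp) hcl hw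
    rw [inner_zero_left, neg_zero] at h1
    exact inner_eq_zero_symm.1 h1
  have hcl : IsClosed {p : D.L2V × D.L2TV | (inner ℂ p.2 w : ℂ) = 0} :=
    isClosed_eq (continuous_snd.inner continuous_const) continuous_const
  have h1 : (inner ℂ w w : ℂ) = 0 :=
    closure_minimal (s := (D.gradGraph : Set (D.L2V × D.L2TV))) (fun p hp ↦ key p hp) hcl hw
  exact inner_self_eq_zero.1 h1

lemma isClosed_divGraph : IsClosed (D.divGraph : Set (D.L2TV × D.L2V)) := by
  have : (D.divGraph : Set (D.L2TV × D.L2V)) = ⋂ q ∈ D.gradGraph,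
      {p | (inner ℂ q.2 p.1 : ℂ) = -inner ℂ q.1 p.2} := by
    ext p
    simp only [Set.mem_iInter]
    rfl
  rw [this]
  exact isClosed_biInter fun q _ ↦ isClosed_eq (continuous_const.inner continuous_fst)
    (continuous_const.inner continuous_snd).neg

/-- The Bochner Laplacian is single valued. -/
lemma eq_zero_of_mem_bochnerGraph {p : D.L2V × D.L2V} (hp : p ∈ D.bochnerGraph) (h : p.1 = 0) :
    p.2 = 0 := by
  obtain ⟨w, h1, h2⟩ := hp
  rw [h] at h1
  rw [D.eq_zero_of_mem_closure_gradGraph h1] at h2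
  exact neg_eq_zero.1 (D.eq_zero_of_mem_divGraph h2)

/-- `toLinearPMap` has the prescribed graph only for a single-valued relation, which
`eq_zero_of_mem_bochnerGraph` supplies. -/
lemma bochnerLaplacian_apply {u f : D.L2V} {w : D.L2TV}
    (h1 : (u, w) ∈ D.gradGraph.topologicalClosure) (h2 : (w, f) ∈ D.divGraph) :
    ∃ h : u ∈ D.bochnerLaplacian.domain, D.bochnerLaplacian ⟨u, h⟩ = -f := by
  have hm : (u, -f) ∈ D.bochnerGraph := ⟨w, h1, by rwa [neg_neg]⟩
  have hg : D.bochnerLaplacian.graph = D.bochnerGraph :=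
    Submodule.toLinearPMap_graph_eq _ fun p hp h ↦ D.eq_zero_of_mem_bochnerGraph hp h
  rw [← hg, LinearPMap.mem_graph_iff] at hm
  obtain ⟨y, hy1, hy2⟩ := hm
  dsimp only at hy1 hy2
  subst hy1
  exact ⟨y.2, hy2⟩

end HermitianConnection
end Closability

/-! ### Caccioppoli's inequality for compactly supported cutoffs. -/

section Estimates

open Filter

lemma FibreMetric.tendsto_toL2 {M : Type*} [MeasurableSpace M] {W : M → Type*}
    [∀ x, AddCommGroup (W x)] [∀ x, Module ℂ (W x)] (m : FibreMetric W) (μ : Measure M)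
    {s : ℕ → m.squareIntegrable μ} {t : m.squareIntegrable μ} {g : M → ℝ} (hg : Integrable g μ)
    (hb : ∀ k x, m.normSq ((s k).1 - t.1) x ≤ g x)
    (hl : ∀ x, Tendsto (fun k ↦ m.normSq ((s k).1 - t.1) x) atTop (𝓝 0)) :
    Tendsto (fun k ↦ m.toL2 μ (s k)) atTop (𝓝 (m.toL2 μ t)) := by
  have h1 : Tendsto (fun k ↦ ∫ x, m.normSq ((s k).1 - t.1) x ∂μ) atTop (𝓝 (∫ _, (0 : ℝ) ∂μ)) := by
    refine tendsto_integral_of_dominated_convergence g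
      (fun k ↦ (s k - t).2.2.aestronglyMeasurable) hg (fun k ↦ .of_forall fun x ↦ ?_)
      (.of_forall hl)
    rw [Real.norm_of_nonneg (m.normSq_nonneg _ x)]
    exact hb k x
  have h2 : ∀ k, ∫ x, m.normSq ((s k).1 - t.1) x ∂μ = ‖m.toL2 μ (s k) - m.toL2 μ t‖ ^ 2 := by
    intro k
    rw [← map_sub, FibreMetric.norm_toL2_sq]
    rfl
  simp_rw [h2, integral_zero] at h1
  rw [tendsto_iff_norm_sub_tendsto_zero]
  have h3 := (Real.continuous_sqrt.tendsto 0).comp h1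
  simpa [Function.comp_def, Real.sqrt_sq (norm_nonneg _)] using h3

variable {n : ℕ} {M : Type*} [TopologicalSpace M] [ChartedSpace (𝔼 n) M]
  [IsManifold (𝓡 n) ∞ M] [SecondCountableTopology M] [T2Space M] [MeasurableSpace M] [BorelSpace M]
  [RiemannianBundle (fun x : M ↦ TangentSpace (𝓡 n) x)]
  [IsContMDiffRiemannianBundle (𝓡 n) ∞ (𝔼 n) (fun x : M ↦ TangentSpace (𝓡 n) x)]
  {F : Type*} [NormedAddCommGroup F] [NormedSpace ℂ F] [FiniteDimensional ℂ F]
  {V : M → Type*} [TopologicalSpace (TotalSpace F V)] [∀ x, NormedAddCommGroup (V x)]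
  [∀ x, InnerProductSpace ℂ (V x)] [FiberBundle F V] [VectorBundle ℂ F V] [VectorBundle ℝ F V]
  [ContMDiffVectorBundle ∞ F V (𝓡 n)] [IsSmoothHermitianBundle n F V]

lemma bundleMetric_normSq (s : Π x : M, V x) (x : M) :
    (bundleMetric n F V).normSq s x = ‖s x‖ ^ 2 := by
  rw [← FibreMetric.fnorm_sq, bundleMetric_fnorm]

lemma homMetric_inner_real_smul (x : M) (r : ℝ) (A B : TangentSpace (𝓡 n) x →L[ℝ] V x) :
    ((homMetric n (bundleMetric n F V)).core x).inner (r • A) B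
      = r * ((homMetric n (bundleMetric n F V)).core x).inner A B := by
  change ∑ i, (inner ℂ ((r • A) (stdOrthonormalBasis ℝ (TangentSpace (𝓡 n) x) i))
      (B (stdOrthonormalBasis ℝ (TangentSpace (𝓡 n) x) i)) : ℂ)
    = r * ∑ i, inner ℂ (A (stdOrthonormalBasis ℝ (TangentSpace (𝓡 n) x) i))
      (B (stdOrthonormalBasis ℝ (TangentSpace (𝓡 n) x) i))
  rw [Finset.mul_sum]
  refine Finset.sum_congr rfl fun i _ ↦ ?_
  rw [smul_apply, ← Complex.coe_smul, inner_smul_left]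
  simp

lemma homMetric_fnorm_smul_sq (x : M) (r : ℝ) (A : TangentSpace (𝓡 n) x →L[ℝ] V x) :
    (homMetric n (bundleMetric n F V)).fnorm x (r • A) ^ 2
      = r ^ 2 * (homMetric n (bundleMetric n F V)).fnorm x A ^ 2 := by
  simp_rw [homMetric_fnorm_sq, Finset.mul_sum, smul_apply, norm_smul, mul_pow, Real.norm_eq_abs,
    sq_abs]

/-- One term `c² ‖v‖²` for each of the `n` vectors of an orthonormal basis. -/
lemma homMetric_fnorm_smulRight_sq_le (x : M) (α : TangentSpace (𝓡 n) x →L[ℝ] ℝ) (v : V x) {c : ℝ}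
    (hα : ∀ w, |α w| ≤ c * ‖w‖) :
    (homMetric n (bundleMetric n F V)).fnorm x (α.smulRight v) ^ 2 ≤ n * c ^ 2 * ‖v‖ ^ 2 := by
  have hn : Module.finrank ℝ (TangentSpace (𝓡 n) x) = n := finrank_euclideanSpace_fin (𝕜 := ℝ)
  rw [homMetric_fnorm_sq]
  refine (Finset.sum_le_sum (g := fun _ ↦ c ^ 2 * ‖v‖ ^ 2) fun i _ ↦ ?_).trans_eq ?_
  · rw [ContinuousLinearMap.smulRight_apply, norm_smul, mul_pow]
    have h := hα (stdOrthonormalBasis ℝ (TangentSpace (𝓡 n) x) i)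
    rw [OrthonormalBasis.norm_eq_one, mul_one] at h
    gcongr
    exact h
  · rw [Finset.sum_const, Finset.card_univ, Fintype.card_fin, hn, nsmul_eq_mul, mul_assoc]

namespace HermitianConnection

variable (D : HermitianConnection n F V)

/-- The pointwise estimate behind Caccioppoli's inequality. -/
lemma sq_mul_normSq_grad_le {u : Π x : M, V x} (hu : u ∈ smoothSections n F V) {f : M → ℝ}
    (hf : ContMDiff (𝓡 n) 𝓘(ℝ, ℝ) ∞ f) {c : ℝ} {x : M}
    (hc : ∀ v, |mvfderiv (𝓡 n) f x v| ≤ c * ‖v‖) (hf2 : |f x| ≤ 2) :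
    f x ^ 2 * (homMetric n (bundleMetric n F V)).normSq (D.grad u) x
      ≤ 2 * (D.greenFun (fun y ↦ f y • f y • u y) u x).re + 4 * (n * c ^ 2 * ‖u x‖ ^ 2)
        + 4 * (‖u x‖ ^ 2 + ‖D.trHess u x‖ ^ 2) := by
  set m := homMetric n (bundleMetric n F V)
  have hfx := hf.mdifferentiableAt (by simp) (x := x)
  have hg : D.grad (fun y ↦ f y • f y • u y) x
      = (f x ^ 2) • D.grad u x + (2 * f x) • (mvfderiv (𝓡 n) f x).smulRight (u x) := by
    rw [D.grad_real_smul (mdiffAt_of_smooth (smul_mem_smoothSections' hf hu) x) hfx,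
      D.grad_real_smul (mdiffAt_of_smooth hu x) hfx]
    ext v
    simp only [add_apply, smul_apply, ContinuousLinearMap.smulRight_apply]
    module
  have hgreen : (D.greenFun (fun y ↦ f y • f y • u y) u x).re
      = f x ^ 2 * m.normSq (D.grad u) x
        + 2 * f x * ((m.core x).inner ((mvfderiv (𝓡 n) f x).smulRight (u x)) (D.grad u x)).re
        + f x ^ 2 * (inner ℂ (u x) (D.trHess u x) : ℂ).re := by
    have h1 := ((m.core x)).add_left
    rw [greenFun, hg, h1, homMetric_inner_real_smul, homMetric_inner_real_smul, smul_smul,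
      ← Complex.coe_smul, inner_smul_left, Complex.add_re, Complex.add_re, Complex.conj_ofReal,
      Complex.re_ofReal_mul, Complex.re_ofReal_mul, Complex.re_ofReal_mul, FibreMetric.normSq]
    ring
  have hP := (Complex.abs_re_le_norm _).trans
    (m.norm_inner_le x ((mvfderiv (𝓡 n) f x).smulRight (u x)) (D.grad u x))
  have hQ := (Complex.abs_re_le_norm _).trans (norm_inner_le_norm (𝕜 := ℂ) (u x) (D.trHess u x))
  have hβ := homMetric_fnorm_smulRight_sq_le (n := n) (F := F) x (mvfderiv (𝓡 n) f x) (u x) hc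
  have ha := m.fnorm_sq (D.grad u) x
  have ha0 := m.fnorm_nonneg x (D.grad u x)
  have hβ0 := m.fnorm_nonneg x ((mvfderiv (𝓡 n) f x).smulRight (u x))
  have hf4 : f x ^ 2 ≤ 4 := by
    rw [← sq_abs]
    nlinarith [abs_nonneg (f x)]
  rw [hgreen, ← ha]
  change m.fnorm x ((mvfderiv (𝓡 n) f x).smulRight (u x)) ^ 2 ≤ _ at hβ
  set a := m.fnorm x (D.grad u x)
  set β := m.fnorm x ((mvfderiv (𝓡 n) f x).smulRight (u x))
  set P := ((m.core x).inner ((mvfderiv (𝓡 n) f x).smulRight (u x)) (D.grad u x)).re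
  set Q := (inner ℂ (u x) (D.trHess u x) : ℂ).re
  have h1 : -(f x * P) ≤ |f x| * (β * a) := by
    refine (neg_le_abs _).trans ?_
    rw [abs_mul]
    exact mul_le_mul_of_nonneg_left hP (abs_nonneg _)
  -- Young's inequality with the weight at which one of the two copies of `f² |∇u|²` in twice the
  -- Green integrand absorbs the cross term.
  have h2 : 4 * (|f x| * (β * a)) ≤ f x ^ 2 * a ^ 2 + 4 * β ^ 2 := by
    nlinarith [sq_nonneg (|f x| * a - 2 * β), sq_abs (f x)]
  have h3 : -(f x ^ 2 * Q) ≤ 4 * (‖u x‖ * ‖D.trHess u x‖) := by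
    refine (neg_le_abs _).trans ?_
    rw [abs_mul, abs_of_nonneg (sq_nonneg _)]
    exact mul_le_mul hf4 hQ (abs_nonneg _) (by norm_num)
  nlinarith [sq_nonneg (‖u x‖ - ‖D.trHess u x‖)]

/-- Integrating the pointwise estimate removes the Green term. What remains involves only `u` and
`tr ∇²u`, so `C` serves all cutoffs at once. -/
lemma exists_lintegral_sq_mul_normSq_grad_le {u : Π x : M, V x} (hu : u ∈ smoothSections n F V)
    (h0 : D.MemL2V u) (ht : D.MemL2V (D.trHess u)) :
    ∃ C : ℝ, ∀ {f : M → ℝ}, ContMDiff (𝓡 n) 𝓘(ℝ, ℝ) ∞ f → HasCompactSupport f →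
      (∀ x, |f x| ≤ 2) → (∀ (x : M) (v : TangentSpace (𝓡 n) x),
        |mvfderiv (𝓡 n) f x v| ≤ 5 * ‖v‖) →
      ∫⁻ x, ENNReal.ofReal (f x ^ 2 * (homMetric n (bundleMetric n F V)).normSq (D.grad u) x)
        ∂(riemannianVolume n M) ≤ ENNReal.ofReal C := by
  have hsm := D.smoothHom_grad hu
  have hu2 : Integrable (fun x ↦ ‖u x‖ ^ 2) (riemannianVolume n M) := h0.2.congr
    (.of_forall fun x ↦ bundleMetric_normSq u x)
  have ht2 : Integrable (fun x ↦ ‖D.trHess u x‖ ^ 2) (riemannianVolume n M) := ht.2.congr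
    (.of_forall fun x ↦ bundleMetric_normSq (D.trHess u) x)
  have hcont : Continuous ((homMetric n (bundleMetric n F V)).normSq (D.grad u)) :=
    Complex.continuous_re.comp (hsm.contMDiff_inner hsm).continuous
  have hint : Integrable (fun x ↦ 4 * (n * 5 ^ 2 * ‖u x‖ ^ 2)
      + 4 * (‖u x‖ ^ 2 + ‖D.trHess u x‖ ^ 2)) (riemannianVolume n M) :=
    ((hu2.const_mul _).const_mul 4).add ((hu2.add ht2).const_mul _)
  refine ⟨∫ x, (4 * (n * 5 ^ 2 * ‖u x‖ ^ 2) + 4 * (‖u x‖ ^ 2 + ‖D.trHess u x‖ ^ 2))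
    ∂(riemannianVolume n M), fun {f} h1 h2 h3 h5 ↦ ?_⟩
  have hI : Integrable (fun x ↦ f x ^ 2 * (homMetric n (bundleMetric n F V)).normSq (D.grad u) x)
      (riemannianVolume n M) :=
    ((h1.continuous.pow 2).mul hcont).integrable_of_hasCompactSupport
      (HasCompactSupport.intro h2 fun x hx ↦ by simp [image_eq_zero_of_notMem_tsupport hx])
  rw [← ofReal_integral_eq_lintegral_ofReal hI (.of_forall fun x ↦
    mul_nonneg (sq_nonneg _) (FibreMetric.normSq_nonneg _ _ x))]
  refine ENNReal.ofReal_le_ofReal ?_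
  obtain ⟨hG, hG0⟩ := D.integral_greenFun
    (smul_mem_smoothSections' h1 (smul_mem_smoothSections' h1 hu)) hu
    (h2.of_isClosed_subset isClosed_closure
      ((secSupport_smul_subset f _).trans Set.inter_subset_left))
  have hGr : ∫ x, (D.greenFun (fun y ↦ f y • f y • u y) u x).re ∂(riemannianVolume n M) = 0 := by
    refine (integral_re hG).trans ?_
    rw [hG0]
    exact Complex.zero_re
  have hGi : Integrable (fun x ↦ 2 * (D.greenFun (fun y ↦ f y • f y • u y) u x).re)
      (riemannianVolume n M) := Integrable.const_mul hG.re 2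
  have hmono := integral_mono hI (hGi.add hint) fun x ↦
    (D.sq_mul_normSq_grad_le hu h1 (x := x) (h5 x) (h3 x)).trans_eq (add_assoc _ _ _)
  refine hmono.trans_eq ?_
  refine (integral_add hGi hint).trans ?_
  rw [integral_const_mul, hGr, mul_zero, zero_add]

end HermitianConnection
end Estimates

/-! ### The Bochner Laplacian on smooth sections of a complete manifold. -/

section Cutoff

open Filter

variable {n : ℕ} {M : Type*} [EMetricSpace M] [ChartedSpace (𝔼 n) M]
  [IsManifold (𝓡 n) ∞ M] [SecondCountableTopology M] [MeasurableSpace M] [BorelSpace M]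
  [RiemannianBundle (fun x : M ↦ TangentSpace (𝓡 n) x)]
  [IsContMDiffRiemannianBundle (𝓡 n) ∞ (𝔼 n) (fun x : M ↦ TangentSpace (𝓡 n) x)]
  [IsRiemannianManifold (𝓡 n) M] [CompleteSpace M]
  {F : Type*} [NormedAddCommGroup F] [NormedSpace ℂ F] [FiniteDimensional ℂ F]
  {V : M → Type*} [TopologicalSpace (TotalSpace F V)] [∀ x, NormedAddCommGroup (V x)]
  [∀ x, InnerProductSpace ℂ (V x)] [FiberBundle F V] [VectorBundle ℂ F V] [VectorBundle ℝ F V]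
  [ContMDiffVectorBundle ∞ F V (𝓡 n)] [IsSmoothHermitianBundle n F V]

namespace HermitianConnection

variable (D : HermitianConnection n F V)

/-- Caccioppoli's inequality: `∇u` is square integrable if `u` and `tr ∇²u` are. -/
lemma memL2TV_grad_of_trHess {u : Π x : M, V x} (hu : u ∈ smoothSections n F V) (h0 : D.MemL2V u)
    (ht : D.MemL2V (D.trHess u)) : D.MemL2TV (D.grad u) := by
  obtain ⟨χ, h1, h2, h3, h4, h5⟩ := exists_cutoffs (n := n) (M := M)
  have hsm := D.smoothHom_grad hu
  refine FibreMetric.mem_squareIntegrable_of_lintegral _ _ (hsm.measurable _) ?_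
  obtain ⟨C, hC⟩ := D.exists_lintegral_sq_mul_normSq_grad_le hu h0 ht
  have hle : ∀ k, ∫⁻ x, ENNReal.ofReal (χ k x ^ 2 *
      (homMetric n (bundleMetric n F V)).normSq (D.grad u) x) ∂(riemannianVolume n M)
      ≤ ENNReal.ofReal C := fun k ↦ by
    refine hC (h1 k) (h2 k) (h3 k) fun x v ↦ (h5 k x v).trans ?_
    exact mul_le_mul_of_nonneg_right (div_le_self (by norm_num) (by simp)) (norm_nonneg v)
  have hcont : Continuous ((homMetric n (bundleMetric n F V)).normSq (D.grad u)) :=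
    Complex.continuous_re.comp (hsm.contMDiff_inner hsm).continuous
  -- Fatou's lemma: the integrals with `χ_k²` are bounded uniformly, and `χ_k² → 1` pointwise.
  have hF := lintegral_liminf_le (μ := riemannianVolume n M) (u := atTop)
    (f := fun k x ↦ ENNReal.ofReal (χ k x ^ 2 *
      (homMetric n (bundleMetric n F V)).normSq (D.grad u) x))
    fun k ↦ (((h1 k).continuous.pow 2).mul hcont).measurable.ennreal_ofReal
  have hlim : ∀ x, liminf (fun k ↦ ENNReal.ofReal (χ k x ^ 2 *
      (homMetric n (bundleMetric n F V)).normSq (D.grad u) x)) atTop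
      = ENNReal.ofReal ((homMetric n (bundleMetric n F V)).normSq (D.grad u) x) := by
    intro x
    refine Tendsto.liminf_eq (ENNReal.tendsto_ofReal ?_)
    simpa using ((h4 x).pow 2).mul_const ((homMetric n (bundleMetric n F V)).normSq (D.grad u) x)
  simp_rw [hlim] at hF
  refine ne_top_of_le_ne_top ENNReal.ofReal_ne_top (hF.trans (?_ : _ ≤ ENNReal.ofReal C))
  exact liminf_le_of_le (by isBoundedDefault) fun b hb ↦
    (hb.exists.elim fun k hk ↦ hk.trans (hle k))

/-- `C_c^∞(V)` is dense in the space of smooth sections with `u` and `∇u` square integrable. -/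
lemma mem_closure_gradGraph {u : Π x : M, V x} (hu : u ∈ smoothSections n F V) (h0 : D.MemL2V u)
    (hg : D.MemL2TV (D.grad u)) :
    (D.classV u h0, D.classTV (D.grad u) hg) ∈ D.gradGraph.topologicalClosure := by
  obtain ⟨χ, h1, h2, h3, h4, h5⟩ := exists_cutoffs (n := n) (M := M)
  have hu2 : Integrable (fun x ↦ ‖u x‖ ^ 2) (riemannianVolume n M) := h0.2.congr
    (.of_forall fun x ↦ bundleMetric_normSq u x)
  have hv : ∀ k, (fun x ↦ χ k x • u x) ∈ smoothSections n F V := fun k ↦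
    smul_mem_smoothSections' (h1 k) hu
  have hvc : ∀ k, IsCompact (secSupport fun x ↦ χ k x • u x) := fun k ↦
    (h2 k).of_isClosed_subset isClosed_closure
      ((secSupport_smul_subset (χ k) _).trans Set.inter_subset_left)
  -- From `|χ| ≤ 2`; this provides the dominating functions below.
  have hχ9 : ∀ k x, (χ k x - 1) ^ 2 ≤ 9 := fun k x ↦ by
    have := abs_le.1 (h3 k x)
    nlinarith
  have hχ0 : ∀ x, Tendsto (fun k ↦ (χ k x - 1) ^ 2) atTop (𝓝 0) := fun x ↦ by
    simpa using ((h4 x).sub_const 1).pow 2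
  have hA : Tendsto (fun k ↦ D.classV _ (squareIntegrable_of_smooth (hv k) (hvc k))) atTop
      (𝓝 (D.classV u h0)) := by
    have heq : ∀ k x, (bundleMetric n F V).normSq ((fun x ↦ χ k x • u x) - u) x
        = (χ k x - 1) ^ 2 * ‖u x‖ ^ 2 := by
      intro k x
      have : ((fun x ↦ χ k x • u x) - u) x = (χ k x - 1) • u x := by
        rw [sub_smul, one_smul]
        rfl
      rw [bundleMetric_normSq, this, norm_smul, mul_pow, Real.norm_eq_abs, sq_abs]
    refine FibreMetric.tendsto_toL2 _ _ (hu2.const_mul 9) (fun k x ↦ ?_) fun x ↦ ?_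
    · rw [heq]
      exact mul_le_mul_of_nonneg_right (hχ9 k x) (sq_nonneg _)
    · simp_rw [heq]
      simpa using (hχ0 x).mul_const (‖u x‖ ^ 2)
  have hB : Tendsto (fun k ↦ D.classTV _ (D.memL2TV_grad (hv k) (hvc k))) atTop
      (𝓝 (D.classTV (D.grad u) hg)) := by
    -- The Leibniz rule splits the difference into `(χ_k - 1) ∇u`, treated by dominated convergence,
    -- and `dχ_k ⊗ u`, which tends to zero because the gradients of the cutoffs do.
    have hle : ∀ k x, (homMetric n (bundleMetric n F V)).normSq
        (D.grad (fun x ↦ χ k x • u x) - D.grad u) x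
        ≤ 2 * ((χ k x - 1) ^ 2 * (homMetric n (bundleMetric n F V)).normSq (D.grad u) x)
          + 2 * (n * (5 / ((k : ℝ) + 1)) ^ 2 * ‖u x‖ ^ 2) := by
      intro k x
      have : (D.grad (fun x ↦ χ k x • u x) - D.grad u) x
          = (χ k x - 1) • D.grad u x + (mvfderiv (𝓡 n) (χ k) x).smulRight (u x) := by
        rw [Pi.sub_apply, D.grad_real_smul (mdiffAt_of_smooth hu x)
          ((h1 k).mdifferentiableAt (by simp)), sub_smul, one_smul]
        abel
      have ht := FibreMetric.fnorm_add_le (homMetric n (bundleMetric n F V)) x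
        ((χ k x - 1) • D.grad u x) ((mvfderiv (𝓡 n) (χ k) x).smulRight (u x))
      have e1 := homMetric_fnorm_smul_sq (n := n) (F := F) x (χ k x - 1) (D.grad u x)
      have e2 := homMetric_fnorm_smulRight_sq_le (n := n) (F := F) x (mvfderiv (𝓡 n) (χ k) x)
        (u x) (h5 k x)
      have e3 := FibreMetric.fnorm_nonneg (homMetric n (bundleMetric n F V)) x
        ((χ k x - 1) • D.grad u x + (mvfderiv (𝓡 n) (χ k) x).smulRight (u x))
      rw [← FibreMetric.fnorm_sq, ← FibreMetric.fnorm_sq, this, ← e1]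
      refine (pow_le_pow_left₀ e3 ht 2).trans ((add_sq_le).trans ?_)
      linarith
    refine FibreMetric.tendsto_toL2 _ _ (g := fun x ↦
      2 * (9 * (homMetric n (bundleMetric n F V)).normSq (D.grad u) x)
        + 2 * (n * 5 ^ 2 * ‖u x‖ ^ 2)) ?_ (fun k x ↦ (hle k x).trans ?_) fun x ↦ ?_
    · exact ((hg.2.const_mul 9).const_mul 2).add ((hu2.const_mul _).const_mul 2)
    · have hk : 5 / ((k : ℝ) + 1) ≤ 5 := div_le_self (by norm_num) (by simp)
      have hk0 : 0 ≤ 5 / ((k : ℝ) + 1) := by positivity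
      have := FibreMetric.normSq_nonneg (homMetric n (bundleMetric n F V)) (D.grad u) x
      have := hχ9 k x
      gcongr
    · refine squeeze_zero (fun k ↦ FibreMetric.normSq_nonneg _ _ x) (fun k ↦ hle k x) ?_
      have e1 := ((hχ0 x).mul_const
        ((homMetric n (bundleMetric n F V)).normSq (D.grad u) x)).const_mul 2
      have e2 : Tendsto (fun k : ℕ ↦ 5 / ((k : ℝ) + 1)) atTop (𝓝 0) := by
        simpa [div_eq_mul_inv] using (tendsto_one_div_add_atTop_nhds_zero_nat (𝕜 := ℝ)).const_mul 5
      have e3 := (((e2.pow 2).const_mul (n : ℝ)).mul_const (‖u x‖ ^ 2)).const_mul 2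
      simpa using e1.add e3
  exact mem_closure_of_tendsto (hA.prodMk_nhds hB)
    (.of_forall fun k ↦ D.classV_mem_gradGraph (hv k) (hvc k))

/-- The Bochner Laplacian on smooth sections. -/
theorem bochnerLaplacian_smooth {u : Π x : M, V x} (hu : u ∈ smoothSections n F V)
    (h0 : D.MemL2V u) (ht : D.MemL2V (D.trHess u)) :
    ∃ h : D.classV u h0 ∈ D.bochnerLaplacian.domain,
      D.bochnerLaplacian ⟨D.classV u h0, h⟩ = -D.classV (D.trHess u) ht :=
  D.bochnerLaplacian_apply
    (D.mem_closure_gradGraph hu h0 (D.memL2TV_grad_of_trHess hu h0 ht))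
    (D.mem_divGraph_of_smooth hu (D.memL2TV_grad_of_trHess hu h0 ht) ht)

end HermitianConnection
end Cutoff

/-! ### Estimates for the trace of the Hessian and pairing with Hessians. -/

section Hessian

open Filter

variable {n : ℕ} {M : Type*} [TopologicalSpace M] [ChartedSpace (𝔼 n) M]
  [IsManifold (𝓡 n) ∞ M] [SecondCountableTopology M] [T2Space M] [MeasurableSpace M] [BorelSpace M]
  [RiemannianBundle (fun x : M ↦ TangentSpace (𝓡 n) x)]
  [IsContMDiffRiemannianBundle (𝓡 n) ∞ (𝔼 n) (fun x : M ↦ TangentSpace (𝓡 n) x)]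
  {F : Type*} [NormedAddCommGroup F] [NormedSpace ℂ F] [FiniteDimensional ℂ F]
  {V : M → Type*} [TopologicalSpace (TotalSpace F V)] [∀ x, NormedAddCommGroup (V x)]
  [∀ x, InnerProductSpace ℂ (V x)] [FiberBundle F V] [VectorBundle ℂ F V] [VectorBundle ℝ F V]
  [ContMDiffVectorBundle ∞ F V (𝓡 n)] [IsSmoothHermitianBundle n F V]

lemma homMetric_homMetric_inner_eq (p : M) {x : M} (hx : x ∈ (chartAt (𝔼 n) p).source)
    (A B : TangentSpace (𝓡 n) x →L[ℝ] TangentSpace (𝓡 n) x →L[ℝ] V x) :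
    ((homMetric n (homMetric n (bundleMetric n F V))).core x).inner A B
      = ∑ i, ∑ j, inner ℂ (A (orthoFrame p i x) (orthoFrame p j x))
        (B (orthoFrame p i x) (orthoFrame p j x)) := by
  have h1 : ((homMetric n (homMetric n (bundleMetric n F V))).core x).inner A B
      = ∑ i, ∑ j, inner ℂ (A (stdOrthonormalBasis ℝ (TangentSpace (𝓡 n) x) i) (orthoFrame p j x))
        (B (stdOrthonormalBasis ℝ (TangentSpace (𝓡 n) x) i) (orthoFrame p j x)) :=
    Finset.sum_congr rfl fun i _ ↦ homCore_inner_eq (F := F) p hx _ _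
  refine h1.trans (Finset.sum_comm.trans (Eq.trans ?_ Finset.sum_comm))
  -- The inner index is already in the smooth frame; freezing it with `flip` allows the same change
  -- of basis in the outer one.
  exact Finset.sum_congr rfl fun j _ ↦ homCore_inner_eq (F := F) p hx
    (A.flip (orthoFrame p j x)) (B.flip (orthoFrame p j x))

lemma homMetric_homMetric_normSq
    (A : Π x : M, TangentSpace (𝓡 n) x →L[ℝ] TangentSpace (𝓡 n) x →L[ℝ] V x) (x : M) :
    (homMetric n (homMetric n (bundleMetric n F V))).normSq A x
      = ∑ i, ∑ j, ‖A x (stdOrthonormalBasis ℝ (TangentSpace (𝓡 n) x) i)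
        (stdOrthonormalBasis ℝ (TangentSpace (𝓡 n) x) j)‖ ^ 2 := by
  change (∑ i, ∑ j, (inner ℂ (A x (stdOrthonormalBasis ℝ (TangentSpace (𝓡 n) x) i)
    (stdOrthonormalBasis ℝ (TangentSpace (𝓡 n) x) j)) (A x (stdOrthonormalBasis ℝ
      (TangentSpace (𝓡 n) x) i) (stdOrthonormalBasis ℝ (TangentSpace (𝓡 n) x) j)) : ℂ)).re = _
  rw [Complex.re_sum]
  refine Finset.sum_congr rfl fun i _ ↦ ?_
  rw [Complex.re_sum]
  exact Finset.sum_congr rfl fun j _ ↦ inner_self_eq_norm_sq (𝕜 := ℂ) _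

lemma homMetric_homMetric_normSq_smul (f : M → ℝ)
    (A : Π x : M, TangentSpace (𝓡 n) x →L[ℝ] TangentSpace (𝓡 n) x →L[ℝ] V x) (x : M) :
    (homMetric n (homMetric n (bundleMetric n F V))).normSq (fun x ↦ f x • A x) x
      = f x ^ 2 * (homMetric n (homMetric n (bundleMetric n F V))).normSq A x := by
  simp_rw [homMetric_homMetric_normSq, Finset.mul_sum, smul_apply, norm_smul, mul_pow,
    Real.norm_eq_abs, sq_abs]

lemma smul_mem_measurableSections {ν : Measure M} {f : M → ℝ} (hf : Continuous f)
    {s : Π x : M, V x} (hs : s ∈ (bundleMetric n F V).measurableSections ν) :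
    (fun x ↦ f x • s x) ∈ (bundleMetric n F V).measurableSections ν := by
  intro p
  refine (hf.aestronglyMeasurable.smul (hs p)).congr ?_
  filter_upwards [ae_restrict_mem (trivializationAt F V p).open_baseSet.measurableSet] with x hx
  exact (((trivializationAt F V p).linear ℝ hx).map_smul _ _).symm

lemma smul_mem_squareIntegrable {f : M → ℝ} (hf : Continuous f) (hf2 : ∀ x, |f x| ≤ 2)
    {ν : Measure M} {A : Π x : M, TangentSpace (𝓡 n) x →L[ℝ] TangentSpace (𝓡 n) x →L[ℝ] V x}
    (hA : A ∈ (homMetric n (homMetric n (bundleMetric n F V))).squareIntegrable ν) :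
    (fun x ↦ f x • A x) ∈ (homMetric n (homMetric n (bundleMetric n F V))).squareIntegrable ν := by
  have hm : (fun x ↦ f x • A x) ∈
      (homMetric n (homMetric n (bundleMetric n F V))).measurableSections ν := fun p i q j ↦
    smul_mem_measurableSections hf (hA.1 p i q j)
  refine ⟨hm, (hA.2.const_mul 4).mono' (FibreMetric.aestronglyMeasurable_normSq _ _ hm)
    (.of_forall fun x ↦ ?_)⟩
  rw [Real.norm_of_nonneg (FibreMetric.normSq_nonneg _ _ x), homMetric_homMetric_normSq_smul]
  refine mul_le_mul_of_nonneg_right ?_ (FibreMetric.normSq_nonneg _ _ x)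
  have := abs_le.1 (hf2 x)
  nlinarith

namespace HermitianConnection

variable (D : HermitianConnection n F V)

/-- Cauchy-Schwarz for the `n` diagonal entries, which are among the entries of the Hilbert-Schmidt
norm. -/
lemma norm_trHess_sq_le (u : Π x : M, V x) (x : M) :
    ‖D.trHess u x‖ ^ 2
      ≤ n * (homMetric n (homMetric n (bundleMetric n F V))).normSq (D.hess u) x := by
  have hn : Module.finrank ℝ (TangentSpace (𝓡 n) x) = n := finrank_euclideanSpace_fin (𝕜 := ℝ)
  let e := stdOrthonormalBasis ℝ (TangentSpace (𝓡 n) x)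
  have h1 : ‖D.trHess u x‖ ≤ ∑ i, ‖D.hess u x (e i) (e i)‖ := norm_sum_le _ _
  have h2 : (∑ i, ‖D.hess u x (e i) (e i)‖) ^ 2 ≤ n * ∑ i, ‖D.hess u x (e i) (e i)‖ ^ 2 := by
    have := sq_sum_le_card_mul_sum_sq (s := Finset.univ)
      (f := fun i ↦ ‖D.hess u x (e i) (e i)‖)
    rw [Finset.card_univ, Fintype.card_fin] at this
    exact this.trans_eq (congrArg (fun k : ℕ ↦ (k : ℝ) * _) hn)
  refine (pow_le_pow_left₀ (norm_nonneg _) h1 2).trans (h2.trans ?_)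
  refine mul_le_mul_of_nonneg_left ?_ (Nat.cast_nonneg n)
  rw [homMetric_homMetric_normSq]
  exact Finset.sum_le_sum fun i _ ↦ Finset.single_le_sum
    (f := fun j ↦ ‖D.hess u x (e i) (e j)‖ ^ 2) (fun j _ ↦ sq_nonneg _) (Finset.mem_univ i)

lemma memL2V_trHess {u : Π x : M, V x} (hu : u ∈ smoothSections n F V)
    (h : D.MemL2TTV (D.hess u)) : D.MemL2V (D.trHess u) := by
  have hm := measurable_of_smooth (riemannianVolume n M) (D.smooth_trHess hu)
  refine ⟨hm, (h.2.const_mul n).mono' (FibreMetric.aestronglyMeasurable_normSq _ _ hm)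
    (.of_forall fun x ↦ ?_)⟩
  rw [Real.norm_of_nonneg (FibreMetric.normSq_nonneg _ _ x), bundleMetric_normSq]
  exact D.norm_trHess_sq_le u x

lemma norm_classV_trHess_le {u : Π x : M, V x} (hu : u ∈ smoothSections n F V)
    (h : D.MemL2TTV (D.hess u)) :
    ‖D.classV (D.trHess u) (D.memL2V_trHess hu h)‖ ≤ Real.sqrt n * ‖D.classTTV (D.hess u) h‖ := by
  refine le_of_sq_le_sq ?_ (by positivity)
  rw [mul_pow, Real.sq_sqrt (Nat.cast_nonneg n), classV, classTTV, FibreMetric.norm_toL2_sq,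
    FibreMetric.norm_toL2_sq, ← integral_const_mul]
  refine integral_mono (D.memL2V_trHess hu h).2 (h.2.const_mul _) fun x ↦ ?_
  dsimp only
  rw [bundleMetric_normSq]
  exact D.norm_trHess_sq_le u x

lemma trHess_add {u v : Π x : M, V x} (hu : u ∈ smoothSections n F V)
    (hv : v ∈ smoothSections n F V) : D.trHess (u + v) = D.trHess u + D.trHess v := by
  funext x
  simp only [trHess, D.hess_add hu hv, Pi.add_apply, add_apply, Finset.sum_add_distrib]

lemma trHess_smul (c : ℂ) {u : Π x : M, V x} (hu : u ∈ smoothSections n F V) :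
    D.trHess (c • u) = c • D.trHess u := by
  funext x
  simp only [trHess, D.hess_smul c hu, Pi.smul_apply, smul_apply, Finset.smul_sum]

/-- Pairing with a compactly supported multiple of `∇²u` is a pairing with the gradient. -/
lemma exists_integral_inner_hess_eq {u : Π x : M, V x} (hu : u ∈ smoothSections n F V) {f : M → ℝ}
    (hf : ContMDiff (𝓡 n) 𝓘(ℝ, ℝ) ∞ f) (hc : HasCompactSupport f) :
    ∃ B : D.L2TV, ∀ v ∈ smoothSections n F V, ∀ hv : D.MemL2TV (D.grad v),
      ∫ x, ((homMetric n (homMetric n (bundleMetric n F V))).core x).inner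
          (f x • D.hess u x) (D.hess v x) ∂(riemannianVolume n M)
        = -inner ℂ B (D.classTV (D.grad v) hv) := by
  obtain ⟨t, ρ, h1, -, h3, -, h4⟩ := exists_finset_partition (n := n) hc
    (fun p ↦ (chartAt (𝔼 n) p).source) (fun p ↦ (chartAt (𝔼 n) p).open_source)
    (mem_chart_source (𝔼 n))
  -- Components of `f ∇²u` in the frame at `p`, localized by `ρ_p`: smooth sections with compact
  -- support in one chart, hence admissible in `integral_inner_hess`. They do not depend on `v`, so
  -- neither does the resulting `B`.
  let s : M → Fin n → Fin n → Π x : M, V x := fun p i j x ↦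
    (ρ p x * f x) • D.hess u x (orthoFrame p i x) (orthoFrame p j x)
  have hρf : ∀ p, ContMDiff (𝓡 n) 𝓘(ℝ, ℝ) ∞ (fun x ↦ ρ p x * f x) := fun p ↦ (h1 p).mul hf
  have hsub : ∀ p, tsupport (fun x ↦ ρ p x * f x) ⊆ tsupport (ρ p) ∩ tsupport f := fun p ↦
    Set.subset_inter (tsupport_mul_subset_left) (tsupport_mul_subset_right)
  have hs : ∀ p i j, s p i j ∈ smoothSections n F V := fun p i j ↦
    smul_mem_smoothSections (hρf p) (chartAt (𝔼 n) p).open_source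
      (((hsub p).trans Set.inter_subset_left).trans (h3 p)) (D.smoothSectionOn_hess hu p i j)
  have hsup : ∀ p i j, secSupport (s p i j) ⊆ tsupport (fun x ↦ ρ p x * f x) := fun p i j ↦
    (secSupport_smul_subset _ _).trans Set.inter_subset_left
  have hsc : ∀ p i j, IsCompact (secSupport (s p i j)) := fun p i j ↦
    hc.of_isClosed_subset isClosed_closure
      ((hsup p i j).trans ((hsub p).trans Set.inter_subset_right))
  have hsp : ∀ p i j, secSupport (s p i j) ⊆ (chartAt (𝔼 n) p).source := fun p i j ↦
    (hsup p i j).trans (((hsub p).trans Set.inter_subset_left).trans (h3 p))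
  refine ⟨∑ p ∈ t, ∑ i, ∑ j, D.classTV (D.hessAdjoint p i j (s p i j))
    (D.memL2TV_hessAdjoint (hs p i j) (hsc p i j) (hsp p i j) i j), fun v hv hvg ↦ ?_⟩
  have hpt : ∀ x, ((homMetric n (homMetric n (bundleMetric n F V))).core x).inner
      (f x • D.hess u x) (D.hess v x) = ∑ p ∈ t, ∑ i, ∑ j, (inner ℂ (s p i j x)
        (D.hess v x (orthoFrame p i x) (orthoFrame p j x)) : ℂ) := by
    intro x
    -- Although the frames differ from chart to chart, each double sum is `ρ_p` times the same
    -- invariant inner product, so the sum over `p` collapses.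
    have hp : ∀ p, ∑ i, ∑ j, (inner ℂ (s p i j x)
        (D.hess v x (orthoFrame p i x) (orthoFrame p j x)) : ℂ)
        = ((ρ p x : ℝ) : ℂ) * ((homMetric n (homMetric n (bundleMetric n F V))).core x).inner
          (f x • D.hess u x) (D.hess v x) := by
      intro p
      by_cases hx : x ∈ tsupport (ρ p)
      · rw [homMetric_homMetric_inner_eq p (h3 p hx), Finset.mul_sum]
        refine Finset.sum_congr rfl fun i _ ↦ ?_
        rw [Finset.mul_sum]
        refine Finset.sum_congr rfl fun j _ ↦ ?_
        have e1 : s p i j x = ((ρ p x : ℝ) : ℂ) •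
            (f x • D.hess u x) (orthoFrame p i x) (orthoFrame p j x) := by
          rw [Complex.coe_smul, smul_apply, smul_apply, smul_smul]
        rw [e1, inner_smul_left, Complex.conj_ofReal]
      · have h0 : ρ p x = 0 := image_eq_zero_of_notMem_tsupport hx
        have e1 : ∀ i j, s p i j x = 0 := fun i j ↦ by simp only [s, h0, zero_mul, zero_smul]
        simp only [e1, inner_zero_left, Finset.sum_const_zero, h0, Complex.ofReal_zero, zero_mul]
    simp_rw [hp]
    rw [← Finset.sum_mul]
    by_cases hx : x ∈ tsupport f
    · rw [← Complex.ofReal_sum, h4 x hx, Complex.ofReal_one, one_mul]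
    · rw [image_eq_zero_of_notMem_tsupport hx, homMetric_homMetric_inner_eq x
        (mem_chart_source _ x)]
      simp
  have key : ∀ p i j, _ := fun p i j ↦
    D.integral_inner_hess hv (hs p i j) (hsc p i j) (hsp p i j) i j
  simp_rw [hpt]
  rw [integral_finsetSum _ fun p _ ↦ integrable_finsetSum _ fun i _ ↦
    integrable_finsetSum _ fun j _ ↦ (key p i j).1, sum_inner, ← Finset.sum_neg_distrib]
  refine Finset.sum_congr rfl fun p _ ↦ ?_
  rw [integral_finsetSum _ fun i _ ↦ integrable_finsetSum _ fun j _ ↦ (key p i j).1, sum_inner,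
    ← Finset.sum_neg_distrib]
  refine Finset.sum_congr rfl fun i _ ↦ ?_
  rw [integral_finsetSum _ fun j _ ↦ (key p i j).1, sum_inner, ← Finset.sum_neg_distrib]
  exact Finset.sum_congr rfl fun j _ ↦ (key p i j).2

end HermitianConnection
end Hessian

/-! ### The Sobolev completions inside the domain of the Laplacian. -/

section Embedding

open Filter UniformSpace

lemma exists_completion_extension {E G : Type*} [SeminormedAddCommGroup E] [NormedSpace ℂ E]
    [NormedAddCommGroup G] [NormedSpace ℂ G] [CompleteSpace G] (f : E →ₗ[ℂ] G) {C : ℝ}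
    (hf : ∀ u, ‖f u‖ ≤ C * ‖u‖) :
    ∃ g : Completion E →L[ℂ] G, ∀ u : E, g (u : Completion E) = f u :=
  ⟨(f.mkContinuous C hf).extend Completion.toComplL, fun u ↦
    ContinuousLinearMap.extend_eq (f.mkContinuous C hf) (e := Completion.toComplL)
      Completion.denseRange_coe (Completion.isUniformInducing_coe E) u⟩

variable {n : ℕ} {M : Type*} [EMetricSpace M] [ChartedSpace (𝔼 n) M]
  [IsManifold (𝓡 n) ∞ M] [SecondCountableTopology M] [MeasurableSpace M] [BorelSpace M]
  [RiemannianBundle (fun x : M ↦ TangentSpace (𝓡 n) x)]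
  [IsContMDiffRiemannianBundle (𝓡 n) ∞ (𝔼 n) (fun x : M ↦ TangentSpace (𝓡 n) x)]
  [IsRiemannianManifold (𝓡 n) M] [CompleteSpace M]
  {F : Type*} [NormedAddCommGroup F] [NormedSpace ℂ F] [FiniteDimensional ℂ F]
  {V : M → Type*} [TopologicalSpace (TotalSpace F V)] [∀ x, NormedAddCommGroup (V x)]
  [∀ x, InnerProductSpace ℂ (V x)] [FiberBundle F V] [VectorBundle ℂ F V] [VectorBundle ℝ F V]
  [ContMDiffVectorBundle ∞ F V (𝓡 n)] [IsSmoothHermitianBundle n F V]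

namespace HermitianConnection

variable (D : HermitianConnection n F V) (P : Submodule ℂ (Π x : M, V x))

/-- The class of `u`, as a linear map. -/
def sobolevVal : D.PreSobolev P →ₗ[ℂ] D.L2V :=
  (LinearMap.fst ℂ D.L2V D.L2TV).comp ((D.jet₁ P).comp (D.incl P))

/-- The class of `∇u`, as a linear map. -/
def sobolevGrad : D.PreSobolev P →ₗ[ℂ] D.L2TV :=
  (LinearMap.snd ℂ D.L2V D.L2TV).comp ((D.jet₁ P).comp (D.incl P))

/-- The class of `∇²u` in the completion of `L²(T*M ⊗ T*M ⊗ V)`, as a linear map. -/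
def sobolevHess : D.PreSobolev P →ₗ[ℂ] Completion D.L2TTV :=
  (Completion.toComplL (𝕜 := ℂ) (E := D.L2TTV)).toLinearMap.comp (D.hessL2 P)

/-- The class of `tr ∇²u`, as a linear map. -/
def sobolevTrace : D.PreSobolev P →ₗ[ℂ] D.L2V where
  toFun u := D.classV (D.trHess u.1) (D.memL2V_trHess u.2.1.2.1 u.2.2)
  map_add' u v := by
    refine Eq.trans ?_ (map_add ((bundleMetric n F V).toL2 (riemannianVolume n M))
      ⟨D.trHess u.1, D.memL2V_trHess u.2.1.2.1 u.2.2⟩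
      ⟨D.trHess v.1, D.memL2V_trHess v.2.1.2.1 v.2.2⟩)
    exact congrArg _ (Subtype.ext (D.trHess_add u.2.1.2.1 v.2.1.2.1))
  map_smul' c u := by
    refine Eq.trans ?_ (map_smul ((bundleMetric n F V).toL2 (riemannianVolume n M))
      c ⟨D.trHess u.1, D.memL2V_trHess u.2.1.2.1 u.2.2⟩)
    exact congrArg _ (Subtype.ext (D.trHess_smul c u.2.1.2.1))

variable {P}

lemma norm_eq_sobolev (u : D.PreSobolev P) :
    ‖u‖ = ‖D.sobolevVal P u‖ + ‖D.sobolevGrad P u‖ + ‖D.sobolevHess P u‖ := by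
  have h : ‖D.sobolevHess P u‖ = ‖D.hessL2 P u‖ := Completion.norm_coe _
  rw [h]
  rfl

lemma norm_sobolevVal_le (u : D.PreSobolev P) : ‖D.sobolevVal P u‖ ≤ 1 * ‖u‖ := by
  rw [D.norm_eq_sobolev, one_mul]
  linarith [norm_nonneg (D.sobolevGrad P u), norm_nonneg (D.sobolevHess P u)]

lemma norm_sobolevGrad_le (u : D.PreSobolev P) : ‖D.sobolevGrad P u‖ ≤ 1 * ‖u‖ := by
  rw [D.norm_eq_sobolev, one_mul]
  linarith [norm_nonneg (D.sobolevVal P u), norm_nonneg (D.sobolevHess P u)]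

lemma norm_sobolevHess_le (u : D.PreSobolev P) : ‖D.sobolevHess P u‖ ≤ 1 * ‖u‖ := by
  rw [D.norm_eq_sobolev, one_mul]
  linarith [norm_nonneg (D.sobolevVal P u), norm_nonneg (D.sobolevGrad P u)]

lemma norm_sobolevTrace_le (u : D.PreSobolev P) : ‖D.sobolevTrace P u‖ ≤ Real.sqrt n * ‖u‖ := by
  refine (D.norm_classV_trHess_le u.2.1.2.1 u.2.2).trans ?_
  refine mul_le_mul_of_nonneg_left ?_ (Real.sqrt_nonneg _)
  have h : ‖D.sobolevHess P u‖ = ‖D.classTTV (D.hess u.1) u.2.2‖ := Completion.norm_coe _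
  rw [← h]
  simpa using D.norm_sobolevHess_le u

/-- Compactly supported multiples of `∇²u` approximate `∇²u`; pairing with them is a pairing with
the gradient. -/
lemma exists_approx_hess (u : D.PreSobolev P) :
    ∃ (a : ℕ → D.L2TTV) (b : ℕ → D.L2TV), Tendsto a atTop (𝓝 (D.hessL2 P u)) ∧
      ∀ k (v : D.PreSobolev P), (inner ℂ (a k) (D.hessL2 P v) : ℂ)
        = -inner ℂ (b k) (D.sobolevGrad P v) := by
  obtain ⟨χ, h1, h2, h3, h4, -⟩ := exists_cutoffs (n := n) (M := M)
  have hmem : ∀ k, D.MemL2TTV (fun x ↦ χ k x • D.hess u.1 x) := fun k ↦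
    smul_mem_squareIntegrable (h1 k).continuous (h3 k) u.2.2
  choose B hB using fun k ↦ D.exists_integral_inner_hess_eq u.2.1.2.1 (h1 k) (h2 k)
  refine ⟨fun k ↦ D.classTTV _ (hmem k), B, ?_, fun k v ↦ hB k v.1 v.2.1.2.1 v.2.1.2.2.2⟩
  have heq : ∀ k x, (homMetric n (homMetric n (bundleMetric n F V))).normSq
      ((fun x ↦ χ k x • D.hess u.1 x) - D.hess u.1) x
      = (χ k x - 1) ^ 2 * (homMetric n (homMetric n (bundleMetric n F V))).normSq
        (D.hess u.1) x := by
    intro k x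
    rw [← homMetric_homMetric_normSq_smul (fun x ↦ χ k x - 1)]
    refine congrArg (fun A ↦ (homMetric n (homMetric n (bundleMetric n F V))).normSq A x) ?_
    funext y
    have hsub : ∀ (r : ℝ) (A : TangentSpace (𝓡 n) y →L[ℝ] TangentSpace (𝓡 n) y →L[ℝ] V y),
        r • A - A = (r - 1) • A := fun r A ↦ by
      ext v w
      simp only [sub_apply, smul_apply, sub_smul, one_smul]
    exact hsub _ _
  refine FibreMetric.tendsto_toL2 _ _ (u.2.2.2.const_mul 9) (fun k x ↦ ?_) fun x ↦ ?_
  · rw [heq]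
    refine mul_le_mul_of_nonneg_right ?_ (FibreMetric.normSq_nonneg _ _ x)
    have := abs_le.1 (h3 k x)
    nlinarith
  · simp_rw [heq]
    simpa using (((h4 x).sub_const 1).pow 2).mul_const
      ((homMetric n (homMetric n (bundleMetric n F V))).normSq (D.hess u.1) x)

/-- If the gradient of an element of the completion vanishes then so does its Hessian. -/
lemma hess_eq_zero_of_grad_eq_zero {G : Completion (D.PreSobolev P) →L[ℂ] D.L2TV}
    {H : Completion (D.PreSobolev P) →L[ℂ] Completion D.L2TTV}
    (hG : ∀ u : D.PreSobolev P, G u = D.sobolevGrad P u)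
    (hH : ∀ u : D.PreSobolev P, H u = D.sobolevHess P u) {w : Completion (D.PreSobolev P)}
    (hw : G w = 0) : H w = 0 := by
  have h1 : ∀ u : D.PreSobolev P, (inner ℂ (D.sobolevHess P u) (H w) : ℂ) = 0 := by
    intro u
    obtain ⟨a, b, ha, hab⟩ := D.exists_approx_hess u
    -- For fixed `k` both sides are continuous in `z`, so the integration by parts extends from
    -- smooth sections to the completion.
    have h2 : ∀ k, ∀ z : Completion (D.PreSobolev P),
        (inner ℂ (a k : Completion D.L2TTV) (H z) : ℂ) = -inner ℂ (b k) (G z) := by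
      intro k z
      refine Completion.induction_on z (isClosed_eq (continuous_const.inner H.continuous)
        (continuous_const.inner G.continuous).neg) fun v ↦ ?_
      rw [hG, hH, ← hab k v]
      exact Completion.inner_coe _ _
    have h3 : Tendsto (fun k ↦ (inner ℂ (a k : Completion D.L2TTV) (H w) : ℂ)) atTop
        (𝓝 (inner ℂ (D.sobolevHess P u) (H w))) :=
      (((Completion.continuous_coe D.L2TTV).tendsto _).comp ha).inner tendsto_const_nhds
    simp_rw [h2, hw, inner_zero_right, neg_zero] at h3
    exact tendsto_nhds_unique h3 tendsto_const_nhds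
  -- The Hessians of sections are dense in the range of `H`, so `H w` is orthogonal to that range,
  -- which contains it.
  have h4 : ∀ z : Completion (D.PreSobolev P), (inner ℂ (H z) (H w) : ℂ) = 0 := fun z ↦
    Completion.induction_on z (isClosed_eq (H.continuous.inner continuous_const) continuous_const)
      fun v ↦ by rw [hH, h1]
  exact inner_self_eq_zero.1 (h4 w)

variable (P)

/-- The completion of the sections in `P` for the Sobolev norm embeds continuously into the domain
of the Bochner Laplacian. -/
theorem exists_sobolev_embedding :
    ∃ ι : Completion (D.PreSobolev P) →L[ℂ] D.L2V, Function.Injective ι ∧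
      (∀ u : D.PreSobolev P, ι (u : Completion (D.PreSobolev P)) = u.toL2V) ∧
      ∃ C : ℝ, ∀ w : Completion (D.PreSobolev P), ∃ hw : ι w ∈ D.bochnerLaplacian.domain,
        ‖ι w‖ + ‖D.bochnerLaplacian ⟨ι w, hw⟩‖ ≤ C * ‖w‖ := by
  obtain ⟨ι, hι⟩ := exists_completion_extension (D.sobolevVal P) D.norm_sobolevVal_le
  obtain ⟨G, hG⟩ := exists_completion_extension (D.sobolevGrad P) D.norm_sobolevGrad_le
  obtain ⟨H, hH⟩ := exists_completion_extension (D.sobolevHess P) D.norm_sobolevHess_le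
  obtain ⟨T, hT⟩ := exists_completion_extension (D.sobolevTrace P) D.norm_sobolevTrace_le
  have hgrad : ∀ w, (ι w, G w) ∈ D.gradGraph.topologicalClosure := fun w ↦
    Completion.induction_on w (D.gradGraph.isClosed_topologicalClosure.preimage
      (ι.continuous.prodMk G.continuous)) fun u ↦ by
        rw [hι, hG]
        exact D.mem_closure_gradGraph u.2.1.2.1 u.2.1.2.2.1 u.2.1.2.2.2
  have hdiv : ∀ w, (G w, T w) ∈ D.divGraph := fun w ↦
    Completion.induction_on w (D.isClosed_divGraph.preimage
      (G.continuous.prodMk T.continuous)) fun u ↦ by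
        rw [hG, hT]
        exact D.mem_divGraph_of_smooth u.2.1.2.1 u.2.1.2.2.2 (D.memL2V_trHess u.2.1.2.1 u.2.2)
  -- The norm of the completion is still the sum of the three `L²` norms, so injectivity amounts to
  -- `ι w = 0` forcing `G w = 0` and `H w = 0`.
  have hnorm : ∀ w, ‖w‖ = ‖ι w‖ + ‖G w‖ + ‖H w‖ := fun w ↦
    Completion.induction_on w (isClosed_eq continuous_norm
      ((ι.continuous.norm.add G.continuous.norm).add H.continuous.norm)) fun u ↦ by
        rw [hι, hG, hH, Completion.norm_coe, D.norm_eq_sobolev]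
  refine ⟨ι, ?_, hι, ‖ι‖ + ‖T‖, fun w ↦ ?_⟩
  · refine (injective_iff_map_eq_zero ι).2 fun w hw ↦ ?_
    have hGw : G w = 0 := D.eq_zero_of_mem_closure_gradGraph (hw ▸ hgrad w)
    rw [← norm_eq_zero, hnorm, hw, hGw, D.hess_eq_zero_of_grad_eq_zero hG hH hGw]
    simp
  · obtain ⟨h, heq⟩ := D.bochnerLaplacian_apply (hgrad w) (hdiv w)
    refine ⟨h, ?_⟩
    rw [heq, norm_neg, add_mul]
    exact add_le_add (ι.le_opNorm w) (T.le_opNorm w)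

end HermitianConnection
end Embedding

end Bochner

end

theorem proposition3p11 {n : ℕ} {M : Type*} [EMetricSpace M]
    [ChartedSpace (EuclideanSpace ℝ (Fin n)) M] [IsManifold (𝓡 n) ∞ M]
    [SecondCountableTopology M] [MeasurableSpace M] [BorelSpace M]
    [RiemannianBundle (fun x : M ↦ TangentSpace (𝓡 n) x)]
    [IsContMDiffRiemannianBundle (𝓡 n) ∞ (EuclideanSpace ℝ (Fin n))
      (fun x : M ↦ TangentSpace (𝓡 n) x)]
    [IsRiemannianManifold (𝓡 n) M] [CompleteSpace M]
    {F : Type*} [NormedAddCommGroup F] [NormedSpace ℂ F] [FiniteDimensional ℂ F]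
    {V : M → Type*} [TopologicalSpace (TotalSpace F V)] [∀ x, NormedAddCommGroup (V x)]
    [∀ x, InnerProductSpace ℂ (V x)] [FiberBundle F V] [VectorBundle ℂ F V] [VectorBundle ℝ F V]
    [ContMDiffVectorBundle ∞ F V (𝓡 n)] [Bochner.IsSmoothHermitianBundle n F V]
    (D : Bochner.HermitianConnection n F V) :
    (∃ ι : D.W22₀ →L[ℂ] D.L2V, Function.Injective ι ∧
      (∀ u : D.PreSobolev (Bochner.HermitianConnection.compactlySupported V),
        ι (u : D.W22₀) = u.toL2V) ∧
      ∃ C : ℝ, ∀ w : D.W22₀, ∃ hw : ι w ∈ D.bochnerLaplacian.domain,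
        ‖ι w‖ + ‖D.bochnerLaplacian ⟨ι w, hw⟩‖ ≤ C * ‖w‖) ∧
    (∃ ι : D.W22 →L[ℂ] D.L2V, Function.Injective ι ∧
      (∀ u : D.PreSobolev ⊤, ι (u : D.W22) = u.toL2V) ∧
      ∃ C : ℝ, ∀ w : D.W22, ∃ hw : ι w ∈ D.bochnerLaplacian.domain,
        ‖ι w‖ + ‖D.bochnerLaplacian ⟨ι w, hw⟩‖ ≤ C * ‖w‖) ∧
    (∀ u ∈ Bochner.HermitianConnection.smoothSections n F V,
      ∀ (hu : D.MemL2V u) (htr : D.MemL2V (D.trHess u)),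
        ∃ h : D.classV u hu ∈ D.bochnerLaplacian.domain,
          D.bochnerLaplacian ⟨D.classV u hu, h⟩ = -D.classV (D.trHess u) htr) := by
  -- The two completions are the cases `P = compactlySupported V` and `P = ⊤` of the same embedding.
  exact ⟨D.exists_sobolev_embedding _, D.exists_sobolev_embedding _,
    fun u hu h0 ht ↦ D.bochnerLaplacian_smooth hu h0 ht⟩
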